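/- For integers $d\ge 2$, $m\ge 1$ let $P_{s},P_{a}$ be the projectors onto the symmetric and antisymmetric subspaces of $\mathbb C^d\otimes\mathbb C^d$, let $\rho_s=\frac{2}{d^2+d}P_s$, $\rho_a=\frac{2}{d^2-d}P_a$, and let $\tau_1=2^{-m}(\rho_s+\rho_a)^{\otimes m}$, $\tau_2=\rho_s^{\otimes m}$ be the hiding states on $A'B'$, where $A'$ and $B'$ each consist of $m$ systems of dimension $d$. Let $A$ be a qubit, and let $B$ be a qubit extended by an erasure flag $|e\rangle$ orthogonal to $|0\rangle,|1\rangle$. Let $\Phi_\pm$ be the projector onto $\frac1{\sqrt2}(|00\rangle\pm|11\rangle)$, $\omega_{sep}=\frac12(|01\rangle\langle01|+|10\rangle\langle10|)$, and let $\pi^A=\frac12\mathbb 1$ be the maximally mixed state of $A$. For $p\in(\frac14,\frac13)$ and $\alpha\in(0,1]$ let $\eta_\alpha$ be the state on $AA':BB'$ obtained by dividing the positive operator $$\frac p2\Big([\alpha\Phi_+^{AB}+(1-\alpha)\pi^A\otimes|e\rangle\langle e|^B]\otimes\tau_1^{A'B'}+[\alpha\Phi_-^{AB}+(1-\alpha)\pi^A\otimes|e\rangle\langle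 e|^B]\otimes\tau_2^{A'B'}\Big)+\alpha(1-p)\,\omega_{sep}^{AB}\otimes\tau_2^{A'B'}$$ by its trace $p+\alpha(1-p)$. Let $D(\rho,\mathrm{SEP})=\min_{\sigma\in\mathrm{SEP}}\frac12\|\rho-\sigma\|_1$ denote the trace distance of $\rho$ to the set of states that are separable between Alice (all systems $A,A'$) and Bob (all systems $B,B'$). There is $m_0$ such that for all $m\ge m_0$, all $d\ge2$, all $p\in(\frac14,\frac13)$ and every function $f:\mathbb N\to\mathbb R$ with $f(n)=o(n)$ and $f(n)\ge1$ for all sufficiently large $n$ the following hold. (a) For every $p_s\in(\frac1{32},\frac1{28})$ and every $n$ with $f(n)\ge1$, $\;D\big(\eta_{1/\lfloor f(n)\rfloor},\mathrm{SEP}\big)\ge \frac{p_s}{\lfloor f(n)\rfloor}$. (b) $D\big((\eta_{1/\lfloor f(n)\rfloor})^{\otimes n},\mathrm{SEP}\big)\to1$ as $n\to\infty$. -/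

import Mathlib

open Filter Topology Asymptotics
open scoped Kronecker ComplexOrder

noncomputable section

namespace Hybrid

/-! Finite-dimensional quantum states are represented by complex matrices. A bipartite system
with Alice's index type `A` and Bob's index type `B` is indexed by `A × B`. -/

/-- Density matrices: positive semidefinite of unit trace. -/
def IsDensity {ι : Type*} [Fintype ι] (ρ : Matrix ι ι ℂ) : Prop :=
  ρ.PosSemidef ∧ ρ.trace = 1

/-- `SEP`: the convex hull of the product states. -/
def separableStates (A B : Type*) [Fintype A] [Fintype B] :
    Set (Matrix (A × B) (A × B) ℂ) :=
  convexHull ℝ {ρ | ∃ (σ : Matrix A A ℂ) (τ : Matrix B B ℂ),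
    IsDensity σ ∧ IsDensity τ ∧ ρ = σ ⊗ₖ τ}

/-- The trace norm `Tr √(Xᴴ X)`, that is, the sum of the singular values of `X`. -/
def traceNorm {ι : Type*} [Fintype ι] [DecidableEq ι] (X : Matrix ι ι ℂ) : ℝ :=
  ∑ i, √((Matrix.isHermitian_conjTranspose_mul_self X).eigenvalues i)

/-- The trace distance `½ ‖ρ - σ‖₁`. -/
def traceDist {ι : Type*} [Fintype ι] [DecidableEq ι] (ρ σ : Matrix ι ι ℂ) : ℝ :=
  traceNorm (ρ - σ) / 2

/-- The trace distance of `ρ` to the set of separable states. -/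
def sepDist {A B : Type*} [Fintype A] [Fintype B] [DecidableEq A] [DecidableEq B]
    (ρ : Matrix (A × B) (A × B) ℂ) : ℝ :=
  sInf (traceDist ρ '' separableStates A B)

/-- The `n`-fold tensor power of a bipartite operator, regarded as a bipartite operator in which
Alice holds all the `A` systems and Bob holds all the `B` systems. -/
def tensorPow {A B : Type*} (n : ℕ) (ρ : Matrix (A × B) (A × B) ℂ) :
    Matrix ((Fin n → A) × (Fin n → B)) ((Fin n → A) × (Fin n → B)) ℂ :=
  Matrix.of fun x y => ∏ i, ρ (x.1 i, x.2 i) (y.1 i, y.2 i)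

/-- The tensor product `K^{AB} ⊗ S^{A'B'}`, regarded as an operator on `AA' : BB'`. -/
def combine {A B A' B' : Type*} (K : Matrix (A × B) (A × B) ℂ)
    (S : Matrix (A' × B') (A' × B') ℂ) :
    Matrix ((A × A') × (B × B')) ((A × A') × (B × B')) ℂ :=
  Matrix.of fun x y =>
    K (x.1.1, x.2.1) (y.1.1, y.2.1) * S (x.1.2, x.2.2) (y.1.2, y.2.2)

/-! The shield systems. -/

/-- The flip operator `F |i⟩|j⟩ = |j⟩|i⟩` on `ℂ^d ⊗ ℂ^d`. -/
def flipOp (d : ℕ) : Matrix (Fin d × Fin d) (Fin d × Fin d) ℂ :=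
  Matrix.of fun x y => if x.1 = y.2 ∧ x.2 = y.1 then 1 else 0

/-- The normalised projector onto the symmetric subspace. -/
def rhoSym (d : ℕ) : Matrix (Fin d × Fin d) (Fin d × Fin d) ℂ :=
  (2 / ((d : ℂ) ^ 2 + d)) • ((1 / 2 : ℂ) • (1 + flipOp d))

/-- The normalised projector onto the antisymmetric subspace. -/
def rhoAnti (d : ℕ) : Matrix (Fin d × Fin d) (Fin d × Fin d) ℂ :=
  (2 / ((d : ℂ) ^ 2 - d)) • ((1 / 2 : ℂ) • (1 - flipOp d))

/-- Index type of each party's share of the shield: `m` systems of dimension `d`. -/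
abbrev Shield (d m : ℕ) : Type := Fin m → Fin d

/-- `τ₁ = 2^{-m} (ρ_s + ρ_a)^{⊗ m}`. -/
def tau₁ (d m : ℕ) : Matrix (Shield d m × Shield d m) (Shield d m × Shield d m) ℂ :=
  (1 / 2 ^ m : ℂ) • tensorPow m (rhoSym d + rhoAnti d)

/-- `τ₂ = ρ_s^{⊗ m}`. -/
def tau₂ (d m : ℕ) : Matrix (Shield d m × Shield d m) (Shield d m × Shield d m) ℂ :=
  tensorPow m (rhoSym d)

/-! The key systems: `A` is a qubit, with basis indexed by `Fin 2`. `B` is a qubit together with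
an orthogonal erasure flag, with basis indexed by `Option (Fin 2)`; the flag `|e⟩` is `none`. -/

/-- The vector `(|00⟩ + s |11⟩) / √2`. -/
def bellVec (s : ℂ) : Fin 2 × Option (Fin 2) → ℂ := fun x =>
  if x = (0, some 0) then 1 / (√2 : ℝ)
  else if x = (1, some 1) then s / (√2 : ℝ)
  else 0

/-- The projector onto `(|00⟩ + s |11⟩) / √2`; it is `Φ₊` for `s = 1` and `Φ₋` for `s = -1`. -/
def bell (s : ℂ) : Matrix (Fin 2 × Option (Fin 2)) (Fin 2 × Option (Fin 2)) ℂ :=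
  Matrix.vecMulVec (bellVec s) (star (bellVec s))

/-- The maximally mixed state of `A` tensored with the erasure flag `|e⟩⟨e|` of `B`. -/
def erased : Matrix (Fin 2 × Option (Fin 2)) (Fin 2 × Option (Fin 2)) ℂ :=
  ((1 / 2 : ℂ) • (1 : Matrix (Fin 2) (Fin 2) ℂ)) ⊗ₖ
    (Matrix.single none none 1 : Matrix (Option (Fin 2)) (Option (Fin 2)) ℂ)

/-- `ω_sep = ½ (|01⟩⟨01| + |10⟩⟨10|)`. -/
def omegaSep : Matrix (Fin 2 × Option (Fin 2)) (Fin 2 × Option (Fin 2)) ℂ :=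
  (1 / 2 : ℂ) • (Matrix.single (0, some 1) (0, some 1) 1 +
    Matrix.single (1, some 0) (1, some 0) 1)

/-- Index type of Alice's systems `AA'`. -/
abbrev Alice (d m : ℕ) : Type := Fin 2 × Shield d m

/-- Index type of Bob's systems `BB'`. -/
abbrev Bob (d m : ℕ) : Type := Option (Fin 2) × Shield d m

/-- The hybrid operator before normalisation; its trace is `p + α (1 - p)`. -/
def hybridOp (d m : ℕ) (p α : ℝ) :
    Matrix (Alice d m × Bob d m) (Alice d m × Bob d m) ℂ :=
  ((p / 2 : ℝ) : ℂ) •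
      (combine ((α : ℂ) • bell 1 + ((1 - α : ℝ) : ℂ) • erased) (tau₁ d m) +
        combine ((α : ℂ) • bell (-1) + ((1 - α : ℝ) : ℂ) • erased) (tau₂ d m)) +
    ((α * (1 - p) : ℝ) : ℂ) • combine omegaSep (tau₂ d m)

/-- The hybrid state `η_α`: the hybrid operator normalised to unit trace. -/
def hybridState (d m : ℕ) (p α : ℝ) :
    Matrix (Alice d m × Bob d m) (Alice d m × Bob d m) ℂ :=
  (hybridOp d m p α).trace⁻¹ • hybridOp d m p α

end Hybrid

end

/-!
The theorem reduces to the construction of one entanglement witness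
`W = (|00⟩⟨11| + |11⟩⟨00|) ⊗ O - (|01⟩⟨01| + |10⟩⟨10|) ⊗ (2.4 Q + θ)` (`witness`), in which `Q` is
the projection onto the complement of the fully symmetric subspace of the shield
`(ℂ^d)^{⊗ m} ⊗ (ℂ^d)^{⊗ m}` and `O` is an operator with `O τ₂ = 0` and `tr (O τ₁) → 1` as `m → ∞`,
uniformly in `d`. The witness is blind to the erased part of `η_α`, so its expectation in `η_α` is
proportional to `α`, as is the expectation of `W²`. Since `-(2.4 + θ) ≤ W ≤ 1` and `W` is
nonpositive on product vectors, duality (`le_sepDist`) gives the lower bound of the first part; the constants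
fit because `0.122 / 3.401 > 1 / 28`.

That `W` is nonpositive on product vectors is the core inequality (`exists_norm_avg_swapForm_le`):
for unit vectors, `|⟨x ⊗ v, O (z ⊗ y)⟩| ≤ 2.4 √(⟨x ⊗ y, Q (x ⊗ y)⟩ ⟨z ⊗ v, Q (z ⊗ v)⟩) + θ`, with no
dependence on `m` and `d`. The matrix element of the identity minus a partial swap `F_T` is large
only if both of the pairs `(x, y)` and `(z, v)` are far from being two copies of a common product
state, and a pair far from product states has a weight outside the symmetric subspace. To make this
quantitative, one compares the pairs with nearly optimal product states `α` and `γ` on a random set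
`R` of sites, and averages `F_T` over random subsets `T ⊆ A ⊆ R`. The comparison is accurate if
dropping the conditions on `A` changes neither the overlaps (`subsetAvg_gain_le`) nor the largest
overlap itself (`deficit`). The latter can fail at some densities of `R`, but the largest overlap is
monotone in `R`, so along a geometric sequence of densities `σ, σ², …, σ^L` it is almost stationary
at most steps; `O` is the average of `1 - F_T` over these densities. That a vector whose overlaps
with product states are small has little symmetric weight (`norm_symProj_tens_sq_le`) is shown by
adding the sites one at a time, in a basis that diagonalises the reduced state of the site.

For the second part, `G = 1 + s W` is a separable operator for small `s > 0`
(`NearOne.of_isHermitian`) and is at most `1` on product vectors. Contracting one copy at a time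
shows that `G^{⊗ n}` is at most `1` on product vectors of the `n` copies (`ProdBounded.tensorPow`).
So the spectral projection of `G^{⊗ n}` onto the eigenvalues at least `Λ` has expectation at most
`1 / Λ` in separable states, while it has expectation at least `1 - Λ (tr (G⁻¹ η))^n` in `η^{⊗ n}`
(`one_sub_le_sepDist_tensorPow`). As `tr (G⁻¹ η) ≤ 1 - c α` and `n α → ∞`, the choice
`Λ = exp (c n α / 2)` makes both errors vanish.
-/

noncomputable section

namespace Hybrid

/-! ### Random subsets -/

section SubsetAvg

variable {ι : Type*} [DecidableEq ι] {E : Type*} [AddCommGroup E] [Module ℝ E]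

/-- The expectation of `f T` over the random subset `T` of `R` that contains each element of `R`
independently with probability `ρ`. -/
def subsetAvg (ρ : ℝ) (R : Finset ι) (f : Finset ι → E) : E :=
  ∑ T ∈ R.powerset, (ρ ^ T.card * (1 - ρ) ^ (R \ T).card) • f T

@[simp] theorem subsetAvg_empty (ρ : ℝ) (f : Finset ι → E) : subsetAvg ρ ∅ f = f ∅ := by
  simp [subsetAvg]

theorem subsetAvg_congr {ρ : ℝ} {R : Finset ι} {f g : Finset ι → E}
    (h : ∀ T ⊆ R, f T = g T) : subsetAvg ρ R f = subsetAvg ρ R g :=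
  Finset.sum_congr rfl fun T hT => by rw [h T (Finset.mem_powerset.1 hT)]

theorem subsetAvg_add (ρ : ℝ) (R : Finset ι) (f g : Finset ι → E) :
    subsetAvg ρ R (fun T => f T + g T) = subsetAvg ρ R f + subsetAvg ρ R g := by
  simp [subsetAvg, Finset.sum_add_distrib]

theorem subsetAvg_map {F : Type*} [AddCommGroup F] [Module ℝ F] (L : E →ₗ[ℝ] F) (ρ : ℝ)
    (R : Finset ι) (f : Finset ι → E) :
    subsetAvg ρ R (fun T => L (f T)) = L (subsetAvg ρ R f) := by
  simp [subsetAvg, map_sum]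

theorem subsetAvg_insert (ρ : ℝ) {R : Finset ι} {i : ι} (hi : i ∉ R) (f : Finset ι → E) :
    subsetAvg ρ (insert i R) f =
      (1 - ρ) • subsetAvg ρ R f + ρ • subsetAvg ρ R (fun T => f (insert i T)) := by
  unfold subsetAvg
  rw [Finset.sum_powerset_insert hi, Finset.smul_sum, Finset.smul_sum]
  congr 1
  · refine Finset.sum_congr rfl fun T hT => ?_
    have hT' := Finset.mem_powerset.1 hT
    have hiT : i ∉ T := fun h => hi (hT' h)
    rw [Finset.insert_sdiff_of_notMem _ hiT, Finset.card_insert_of_notMem (by simp [hi]), smul_smul]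
    congr 1
    ring
  · refine Finset.sum_congr rfl fun T hT => ?_
    have hT' := Finset.mem_powerset.1 hT
    have hiT : i ∉ T := fun h => hi (hT' h)
    rw [Finset.insert_sdiff_insert, Finset.card_insert_of_notMem hiT, smul_smul,
      Finset.sdiff_insert_of_notMem hi]
    congr 1
    ring

theorem subsetAvg_const (ρ : ℝ) (R : Finset ι) (c : E) : subsetAvg ρ R (fun _ => c) = c := by
  induction R using Finset.induction_on with
  | empty => simp
  | insert i R hi ih => rw [subsetAvg_insert ρ hi, ih, ← add_smul]; simp

/-- A random subset of a random subset is a random subset. -/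
theorem subsetAvg_comp (ρ σ : ℝ) (R : Finset ι) (f : Finset ι → E) :
    subsetAvg ρ R (fun S => subsetAvg σ S f) = subsetAvg (ρ * σ) R f := by
  induction R using Finset.induction_on generalizing f with
  | empty => simp
  | insert i R hi ih =>
    have h : subsetAvg ρ R (fun T => subsetAvg σ (insert i T) f) =
        (1 - σ) • subsetAvg (ρ * σ) R f +
          σ • subsetAvg (ρ * σ) R (fun T => f (insert i T)) := by
      rw [← ih, ← ih]
      rw [subsetAvg_congr (g := fun T => (1 - σ) • subsetAvg σ T f +
          σ • subsetAvg σ T (fun T => f (insert i T)))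
          fun T hT => subsetAvg_insert σ (fun h => hi (hT h)) f, subsetAvg_add]
      congr 1
      · exact subsetAvg_map (LinearMap.lsmul ℝ E (1 - σ)) ρ R _
      · exact subsetAvg_map (LinearMap.lsmul ℝ E σ) ρ R _
    rw [subsetAvg_insert _ hi, subsetAvg_insert _ hi, h, ih]
    module

theorem subsetAvg_mono {ρ : ℝ} (h0 : 0 ≤ ρ) (h1 : ρ ≤ 1) {R : Finset ι} {f g : Finset ι → ℝ}
    (h : ∀ T ⊆ R, f T ≤ g T) : subsetAvg ρ R f ≤ subsetAvg ρ R g :=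
  Finset.sum_le_sum fun T hT => by
    have := h T (Finset.mem_powerset.1 hT)
    have := sub_nonneg.2 h1
    simp only [smul_eq_mul]
    gcongr

theorem subsetAvg_nonneg {ρ : ℝ} (h0 : 0 ≤ ρ) (h1 : ρ ≤ 1) {R : Finset ι} {f : Finset ι → ℝ}
    (h : ∀ T ⊆ R, 0 ≤ f T) : 0 ≤ subsetAvg ρ R f := by
  simpa [subsetAvg_const] using subsetAvg_mono h0 h1 h

theorem subsetAvg_le {ρ : ℝ} (h0 : 0 ≤ ρ) (h1 : ρ ≤ 1) {R : Finset ι} {f : Finset ι → ℝ} {c : ℝ}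
    (h : ∀ T ⊆ R, f T ≤ c) : subsetAvg ρ R f ≤ c :=
  (subsetAvg_mono h0 h1 h).trans_eq (subsetAvg_const _ _ _)

theorem norm_subsetAvg_le {F : Type*} [NormedAddCommGroup F] [NormedSpace ℝ F] {ρ : ℝ}
    (h0 : 0 ≤ ρ) (h1 : ρ ≤ 1) (R : Finset ι) (f : Finset ι → F) :
    ‖subsetAvg ρ R f‖ ≤ subsetAvg ρ R (fun T => ‖f T‖) := by
  refine (norm_sum_le _ _).trans (Finset.sum_le_sum fun T _ => ?_)
  have := sub_nonneg.2 h1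
  rw [norm_smul, Real.norm_of_nonneg (by positivity), smul_eq_mul]

theorem subsetAvg_smul (ρ : ℝ) (R : Finset ι) (c : ℝ) (f : Finset ι → E) :
    subsetAvg ρ R (fun T => c • f T) = c • subsetAvg ρ R f :=
  subsetAvg_map (LinearMap.lsmul ℝ E c) ρ R f

theorem subsetAvg_sub (ρ : ℝ) (R : Finset ι) (f g : Finset ι → E) :
    subsetAvg ρ R (fun T => f T - g T) = subsetAvg ρ R f - subsetAvg ρ R g := by
  simp [subsetAvg, smul_sub, Finset.sum_sub_distrib]

end SubsetAvg

/-! ### Families of commuting orthogonal projections -/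

section CommProj

variable {ι : Type*} [DecidableEq ι] {H : Type*} [NormedAddCommGroup H] [InnerProductSpace ℂ H]

/-- A family of orthogonal projections indexed by finite sets that turns unions into products. -/
structure IsProjFamily (P : Finset ι → H →L[ℂ] H) : Prop where
  empty : P ∅ = 1
  union : ∀ S T, P (S ∪ T) = P S * P T
  symm : ∀ S x y, inner ℂ (P S x) y = inner ℂ x (P S y)

namespace IsProjFamily

variable {P : Finset ι → H →L[ℂ] H}
theorem idem (hP : IsProjFamily P) (S : Finset ι) (x : H) : P S (P S x) = P S x := by
  have := congrArg (· x) (hP.union S S)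
  simpa using this.symm

theorem comm (hP : IsProjFamily P) (S T : Finset ι) (x : H) : P S (P T x) = P T (P S x) := by
  have h1 := congrArg (· x) (hP.union S T)
  have h2 := congrArg (· x) (hP.union T S)
  rw [Finset.union_comm] at h2
  simpa using h1.symm.trans h2

theorem apply_of_subset (hP : IsProjFamily P) {S T : Finset ι} (h : S ⊆ T) (x : H) :
    P S (P T x) = P T x := by
  have h1 := congrArg (· x) (hP.union S T)
  rw [Finset.union_eq_right.2 h] at h1
  simpa using h1.symm

theorem inner_apply_self (hP : IsProjFamily P) (S : Finset ι) (x : H) :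
    inner ℂ x (P S x) = (‖P S x‖ : ℂ) ^ 2 := by
  rw [show inner ℂ x (P S x) = inner ℂ (P S x) (P S x) by rw [hP.symm, hP.idem],
    inner_self_eq_norm_sq_to_K]
  rfl

theorem norm_sq_add (hP : IsProjFamily P) {S T : Finset ι} (h : S ⊆ T) (x : H) :
    ‖P S x‖ ^ 2 = ‖P T x‖ ^ 2 + ‖P S x - P T x‖ ^ 2 := by
  have h0 : inner ℂ (P T x) (P S x - P T x) = 0 := by
    rw [hP.symm, map_sub, hP.idem, hP.comm, hP.apply_of_subset h, sub_self, inner_zero_right]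
  have := norm_add_sq_eq_norm_sq_add_norm_sq_of_inner_eq_zero (𝕜 := ℂ) (P T x) (P S x - P T x) h0
  rw [add_sub_cancel] at this
  nlinarith [this]

theorem norm_sq_add_self (hP : IsProjFamily P) (T : Finset ι) (x : H) :
    ‖x‖ ^ 2 = ‖P T x‖ ^ 2 + ‖x - P T x‖ ^ 2 := by
  simpa [hP.empty] using hP.norm_sq_add (Finset.empty_subset T) x

theorem norm_le_of_subset (hP : IsProjFamily P) {S T : Finset ι} (h : S ⊆ T) (x : H) :
    ‖P T x‖ ≤ ‖P S x‖ := by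
  have := hP.norm_sq_add h x
  nlinarith [norm_nonneg (P T x), norm_nonneg (P S x), sq_nonneg ‖P S x - P T x‖]

theorem norm_le (hP : IsProjFamily P) (T : Finset ι) (x : H) : ‖P T x‖ ≤ ‖x‖ := by
  simpa [hP.empty] using hP.norm_le_of_subset (Finset.empty_subset T) x

theorem norm_sub_le (hP : IsProjFamily P) (T : Finset ι) (x : H) : ‖x - P T x‖ ≤ ‖x‖ := by
  have := hP.norm_sq_add_self T x
  nlinarith [norm_nonneg (x - P T x), norm_nonneg x, sq_nonneg ‖P T x‖]

/-- The weight that `x` gains in the range of the projection when the conditions indexed by `A`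
are dropped from those indexed by `R`. -/
def _root_.Hybrid.gain (P : Finset ι → H →L[ℂ] H) (R A : Finset ι) (x : H) : ℝ :=
  ‖P (R \ A) x‖ ^ 2 - ‖P R x‖ ^ 2

theorem gain_nonneg (hP : IsProjFamily P) (R A : Finset ι) (x : H) : 0 ≤ gain P R A x := by
  have := hP.norm_le_of_subset (Finset.sdiff_subset : R \ A ⊆ R) x
  have := norm_nonneg (P R x)
  unfold gain
  nlinarith

theorem gain_eq (hP : IsProjFamily P) (R A : Finset ι) (x : H) :
    gain P R A x = ‖P (R \ A) x - P R x‖ ^ 2 := by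
  unfold gain
  rw [hP.norm_sq_add (Finset.sdiff_subset : R \ A ⊆ R) x]; ring

theorem gain_mono (hP : IsProjFamily P) {R A B : Finset ι} (h : A ⊆ B) (x : H) :
    gain P R A x ≤ gain P R B x := by
  have h1 := hP.norm_le_of_subset (Finset.sdiff_subset_sdiff (subset_refl R) h) x
  have := norm_nonneg (P (R \ A) x)
  unfold gain
  nlinarith

/-- Dropping each condition with a small probability `τ` gains at most the weight `τ ‖x‖²`:
a component that violates a condition is gained only if all the conditions it violates are
dropped. -/
theorem subsetAvg_gain_le (hP : IsProjFamily P) {τ : ℝ} (h0 : 0 ≤ τ) (h1 : τ ≤ 1) (R : Finset ι)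
    (x : H) : subsetAvg τ R (fun A => gain P R A x) ≤ τ * ‖x‖ ^ 2 := by
  suffices h : ∀ x : H, subsetAvg τ R (fun A => ‖P (R \ A) x‖ ^ 2) ≤
      ‖P R x‖ ^ 2 + τ * ‖x - P R x‖ ^ 2 by
    have h2 := h x
    have h3 := hP.norm_sq_add_self R x
    unfold gain
    rw [subsetAvg_sub, subsetAvg_const]
    nlinarith [sq_nonneg ‖P R x‖]
  clear x
  induction R using Finset.induction_on with
  | empty => intro x; simp [hP.empty]
  | insert i R hi ih =>
    intro x
    have hins : ∀ (S : Finset ι) (y : H), P (insert i S) y = P S (P {i} y) := fun S y => by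
      rw [Finset.insert_eq, hP.union, mul_apply_eq_comp, hP.comm]
    rw [subsetAvg_insert _ hi]
    have e1 : subsetAvg τ R (fun A => ‖P (insert i R \ A) x‖ ^ 2) =
        subsetAvg τ R (fun A => ‖P (R \ A) (P {i} x)‖ ^ 2) := by
      refine subsetAvg_congr fun A hA => ?_
      rw [Finset.insert_sdiff_of_notMem _ (fun h => hi (hA h)), hins]
    have e2 : subsetAvg τ R (fun A => ‖P (insert i R \ insert i A) x‖ ^ 2) =
        subsetAvg τ R (fun A => ‖P (R \ A) (P {i} x)‖ ^ 2) +
        subsetAvg τ R (fun A => ‖P (R \ A) (x - P {i} x)‖ ^ 2) := by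
      rw [← subsetAvg_add]
      refine subsetAvg_congr fun A hA => ?_
      rw [Finset.insert_sdiff_insert, Finset.sdiff_insert_of_notMem hi,
        hP.norm_sq_add (Finset.subset_insert i (R \ A)) x, hins, map_sub]
    have e3 : subsetAvg τ R (fun A => ‖P (R \ A) (x - P {i} x)‖ ^ 2) ≤ ‖x - P {i} x‖ ^ 2 :=
      subsetAvg_le h0 h1 fun A _ => by
        have := hP.norm_le (R \ A) (x - P {i} x)
        gcongr
    have e4 := ih (P {i} x)
    rw [e1, e2, hins]
    have e5 : ‖x - P R (P {i} x)‖ ^ 2 = ‖x - P {i} x‖ ^ 2 + ‖P {i} x - P R (P {i} x)‖ ^ 2 := by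
      have a1 := hP.norm_sq_add_self (insert i R) x
      have a2 := hP.norm_sq_add_self {i} x
      have a3 := hP.norm_sq_add_self R (P {i} x)
      rw [hins] at a1
      linarith
    simp only [smul_eq_mul]
    rw [e5]
    nlinarith

end IsProjFamily

end CommProj

/-! ### Partial swaps and product projections -/

section Swap

variable {ι D κ : Type*} [Fintype ι] [DecidableEq ι] [Fintype D] [DecidableEq D] [Fintype κ]
  [DecidableEq κ]

/-- The Hilbert space `(ℂ^D)^{⊗ ι} ⊗ ℂ^κ`. The register `κ` is never swapped. -/
abbrev Hil (ι D κ : Type*) : Type _ := EuclideanSpace ℂ ((ι → D) × κ)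

/-- Two copies of `Hil ι D κ`. -/
abbrev Hil₂ (ι D κ : Type*) : Type _ := EuclideanSpace ℂ (((ι → D) × κ) × ((ι → D) × κ))

/-- The product vector `x ⊗ y`. -/
def tens (x y : Hil ι D κ) : Hil₂ ι D κ := WithLp.toLp 2 fun z => x z.1 * y z.2

theorem inner_tens (x y x' y' : Hil ι D κ) :
    inner ℂ (tens x y) (tens x' y') = inner ℂ x x' * inner ℂ y y' := by
  simp only [tens, PiLp.inner_apply, RCLike.inner_apply, map_mul]
  rw [Finset.sum_mul_sum, Fintype.sum_prod_type]
  refine Finset.sum_congr rfl fun a _ => Finset.sum_congr rfl fun b _ => ?_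
  ring

theorem norm_tens (x y : Hil ι D κ) : ‖tens x y‖ = ‖x‖ * ‖y‖ := by
  have h := inner_tens x y x y
  simp only [inner_self_eq_norm_sq_to_K] at h
  have h' : ‖tens x y‖ ^ 2 = (‖x‖ * ‖y‖) ^ 2 := by
    rw [mul_pow]; exact_mod_cast h
  exact (pow_left_inj₀ (norm_nonneg _) (by positivity) two_ne_zero).1 h'

/-- The configuration that agrees with `b` on the sites in `T` and with `a` elsewhere. -/
def mix (T : Finset ι) (a b : (ι → D) × κ) : (ι → D) × κ := (T.piecewise b.1 a.1, a.2)

/-- Exchange of the sites in `T` between the two copies. -/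
def swapPerm (κ : Type*) (D : Type*) (T : Finset ι) :
    Equiv.Perm (((ι → D) × κ) × ((ι → D) × κ)) where
  toFun z := (mix T z.1 z.2, mix T z.2 z.1)
  invFun z := (mix T z.1 z.2, mix T z.2 z.1)
  left_inv z := by
    ext i <;> simp [mix, Finset.piecewise]
  right_inv z := by
    ext i <;> simp [mix, Finset.piecewise]

/-- The operator `F_T` that exchanges the sites in `T` between the two copies. -/
def swapOp (T : Finset ι) : Hil₂ ι D κ ≃ₗᵢ[ℂ] Hil₂ ι D κ :=
  LinearIsometryEquiv.piLpCongrLeft 2 ℂ ℂ (swapPerm κ D T)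

theorem swapOp_apply (T : Finset ι) (v : Hil₂ ι D κ) (a b : (ι → D) × κ) :
    swapOp T v (a, b) = v (mix T a b, mix T b a) := rfl

/-- The matrix of `⨂ᵢ Aᵢ ⊗ 1`. -/
def prodMat (κ : Type*) [DecidableEq κ] (A : ι → Matrix D D ℂ) :
    Matrix ((ι → D) × κ) ((ι → D) × κ) ℂ :=
  Matrix.of fun x y => if x.2 = y.2 then ∏ i, A i (x.1 i) (y.1 i) else 0

theorem prodMat_one : prodMat κ (fun _ => 1 : ι → Matrix D D ℂ) = 1 := by
  ext x y
  have h : x = y ↔ x.2 = y.2 ∧ ∀ i, x.1 i = y.1 i := by rw [Prod.ext_iff, and_comm, funext_iff]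
  simp only [prodMat, Matrix.of_apply, Matrix.one_apply, Finset.prod_ite_zero,
    Finset.mem_univ, true_imp_iff, h, Finset.prod_const_one, ite_and]

theorem prodMat_mul (A B : ι → Matrix D D ℂ) :
    prodMat κ (fun i => A i * B i) = prodMat κ A * prodMat κ B := by
  ext x y
  simp only [prodMat, Matrix.mul_apply, Matrix.of_apply, Fintype.sum_prod_type_right]
  rw [Finset.sum_eq_single x.2 (fun k _ hk => by simp [Ne.symm hk]) (by simp)]
  by_cases h : x.2 = y.2
  · simp [h, Finset.prod_univ_sum, Finset.prod_mul_distrib]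
  · simp [h]

theorem conjTranspose_prodMat (A : ι → Matrix D D ℂ) :
    (prodMat κ A).conjTranspose = prodMat κ (fun i => (A i).conjTranspose) := by
  ext x y
  simp only [prodMat, Matrix.conjTranspose_apply, Matrix.of_apply, eq_comm (a := y.2)]
  split_ifs <;> simp

theorem inner_toEuclideanCLM {n : Type*} [Fintype n] [DecidableEq n] (M : Matrix n n ℂ)
    (x y : EuclideanSpace ℂ n) :
    inner ℂ (Matrix.toEuclideanCLM (𝕜 := ℂ) M x) y =
      inner ℂ x (Matrix.toEuclideanCLM (𝕜 := ℂ) M.conjTranspose y) := by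
  rw [← Matrix.star_eq_conjTranspose, map_star, ContinuousLinearMap.star_eq_adjoint,
    ContinuousLinearMap.adjoint_inner_right]

/-- The operator `⨂ᵢ Aᵢ`, acting trivially on the register. -/
def prodOp (A : ι → Matrix D D ℂ) : Hil ι D κ →L[ℂ] Hil ι D κ :=
  Matrix.toEuclideanCLM (𝕜 := ℂ) (prodMat κ A)

theorem prodOp_apply (A : ι → Matrix D D ℂ) (x : Hil ι D κ) (a : (ι → D) × κ) :
    prodOp A x a = ∑ c : ι → D, (∏ i, A i (a.1 i) (c i)) * x (c, a.2) := by
  simp [prodOp, prodMat, Matrix.mulVec, dotProduct, Fintype.sum_prod_type]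

theorem prodOp_one : prodOp (fun _ => 1 : ι → Matrix D D ℂ) = (1 : Hil ι D κ →L[ℂ] Hil ι D κ) := by
  rw [prodOp, prodMat_one, map_one]

theorem prodOp_mul (A B : ι → Matrix D D ℂ) :
    (prodOp (fun i => A i * B i) : Hil ι D κ →L[ℂ] Hil ι D κ) = prodOp A * prodOp B := by
  rw [prodOp, prodMat_mul, map_mul]; rfl

theorem prodOp_prodOp (A B : ι → Matrix D D ℂ) (x : Hil ι D κ) :
    prodOp A (prodOp B x) = prodOp (fun i => A i * B i) x := by
  rw [prodOp_mul]; rfl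

theorem inner_prodOp (A : ι → Matrix D D ℂ) (x y : Hil ι D κ) :
    inner ℂ (prodOp A x) y = inner ℂ x (prodOp (fun i => (A i).conjTranspose) y) := by
  rw [prodOp, inner_toEuclideanCLM, conjTranspose_prodMat]; rfl

/-- The operator `(⨂ᵢ Aᵢ) ⊗ (⨂ᵢ Bᵢ)` on two copies. -/
def pairOp (A B : ι → Matrix D D ℂ) : Hil₂ ι D κ →L[ℂ] Hil₂ ι D κ :=
  Matrix.toEuclideanCLM (𝕜 := ℂ) (prodMat κ A ⊗ₖ prodMat κ B)

theorem pairOp_apply (A B : ι → Matrix D D ℂ) (w : Hil₂ ι D κ) (a b : (ι → D) × κ) :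
    pairOp A B w (a, b) = ∑ c : ι → D, ∑ e : ι → D, (∏ i, A i (a.1 i) (c i)) *
      (∏ i, B i (b.1 i) (e i)) * w ((c, a.2), (e, b.2)) := by
  simp [pairOp, prodMat, Matrix.mulVec, dotProduct, Fintype.sum_prod_type]

theorem inner_pairOp (A B : ι → Matrix D D ℂ) (x y : Hil₂ ι D κ) :
    inner ℂ (pairOp A B x) y =
      inner ℂ x (pairOp (fun i => (A i).conjTranspose) (fun i => (B i).conjTranspose) y) := by
  rw [pairOp, inner_toEuclideanCLM, Matrix.conjTranspose_kronecker, conjTranspose_prodMat,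
    conjTranspose_prodMat]; rfl

theorem tens_apply (x y : Hil ι D κ) (a b : (ι → D) × κ) : tens x y (a, b) = x a * y b := rfl

theorem pairOp_tens (A B : ι → Matrix D D ℂ) (x y : Hil ι D κ) :
    pairOp A B (tens x y) = tens (prodOp A x) (prodOp B y) := by
  ext ⟨a, b⟩
  simp only [pairOp_apply, tens_apply, prodOp_apply, Finset.sum_mul_sum]
  exact Finset.sum_congr rfl fun c _ => Finset.sum_congr rfl fun e _ => by ring

/-- Operators on the sites in `T` change the copy they act on when they pass the swap `F_T`. -/
theorem swapOp_pairOp (T : Finset ι) (A B : ι → Matrix D D ℂ) (w : Hil₂ ι D κ) :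
    swapOp T (pairOp A B w) =
      pairOp (fun i => if i ∈ T then B i else A i) (fun i => if i ∈ T then A i else B i)
        (swapOp T w) := by
  ext ⟨a, b⟩
  simp only [swapOp_apply, pairOp_apply, mix]
  rw [← Fintype.sum_prod_type', ← Fintype.sum_prod_type']
  let σ : Equiv.Perm ((ι → D) × (ι → D)) :=
    ⟨fun w => (T.piecewise w.2 w.1, T.piecewise w.1 w.2),
      fun w => (T.piecewise w.2 w.1, T.piecewise w.1 w.2),
      fun w => by ext i <;> by_cases h : i ∈ T <;> simp [h],
      fun w => by ext i <;> by_cases h : i ∈ T <;> simp [h]⟩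
  rw [← Equiv.sum_comp σ]
  refine Finset.sum_congr rfl fun w _ => ?_
  simp only [σ, Equiv.coe_fn_mk]
  rw [← Finset.prod_mul_distrib, ← Finset.prod_mul_distrib]
  congr 1
  refine Finset.prod_congr rfl fun i _ => ?_
  by_cases h : i ∈ T <;> simp [h, mul_comm]

/-- If two families of local operators agree after exchanging the outputs on `T`, so do the
products. -/
theorem swapOp_tens_prodOp (T : Finset ι) (A B A' B' : ι → Matrix D D ℂ)
    (hT : ∀ i ∈ T, ∀ a b c e, A i b c * B i a e = A' i a c * B' i b e)
    (hT' : ∀ i ∉ T, ∀ a b c e, A i a c * B i b e = A' i a c * B' i b e) (z y : Hil ι D κ) :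
    swapOp T (tens (prodOp A z) (prodOp B y)) = tens (prodOp A' z) (prodOp B' y) := by
  ext ⟨a, b⟩
  simp only [swapOp_apply, tens_apply, prodOp_apply, mix, Finset.sum_mul_sum]
  refine Finset.sum_congr rfl fun c _ => Finset.sum_congr rfl fun e _ => ?_
  rw [mul_mul_mul_comm, mul_mul_mul_comm (∏ i, A' i _ _), ← Finset.prod_mul_distrib,
    ← Finset.prod_mul_distrib]
  congr 1
  refine Finset.prod_congr rfl fun i _ => ?_
  by_cases h : i ∈ T
  · simpa [h] using hT i h _ _ _ _
  · simpa [h] using hT' i h _ _ _ _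

/-- The form `⟨x ⊗ v, F_T (z ⊗ y)⟩`. -/
def swapForm (T : Finset ι) (x y z v : Hil ι D κ) : ℂ := inner ℂ (tens x v) (swapOp T (tens z y))

theorem swapForm_prodOp (T : Finset ι) (A B : ι → Matrix D D ℂ) (x y z v : Hil ι D κ) :
    swapForm T x (prodOp B y) (prodOp A z) v =
      swapForm T (prodOp (fun i => (if i ∈ T then B i else A i).conjTranspose) x) y z
        (prodOp (fun i => (if i ∈ T then A i else B i).conjTranspose) v) := by
  rw [swapForm, ← pairOp_tens, swapOp_pairOp, swapForm, ← pairOp_tens, inner_pairOp]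
  simp only [Matrix.conjTranspose_conjTranspose]

theorem norm_swapForm_le (T : Finset ι) (x y z v : Hil ι D κ) :
    ‖swapForm T x y z v‖ ≤ ‖x‖ * ‖y‖ * (‖z‖ * ‖v‖) := by
  refine (norm_inner_le_norm _ _).trans_eq ?_
  rw [LinearIsometryEquiv.norm_map, norm_tens, norm_tens]; ring

theorem swapOp_empty (w : Hil₂ ι D κ) : swapOp ∅ w = w := by
  ext ⟨a, b⟩
  simp [swapOp_apply, mix]

theorem swapForm_empty (x y z v : Hil ι D κ) :
    swapForm ∅ x y z v = inner ℂ x z * inner ℂ v y := by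
  rw [swapForm, swapOp_empty, inner_tens]

theorem tens_sum {α : Type*} (s : Finset α) (x y : α → Hil ι D κ) :
    tens (∑ a ∈ s, x a) (∑ a ∈ s, y a) = ∑ a ∈ s, ∑ b ∈ s, tens (x a) (y b) := by
  ext ⟨a, b⟩; simp [tens_apply, Finset.sum_mul_sum]

/-- The exchange of the two copies, registers included. -/
def flipAll : Hil₂ ι D κ ≃ₗᵢ[ℂ] Hil₂ ι D κ :=
  LinearIsometryEquiv.piLpCongrLeft 2 ℂ ℂ (Equiv.prodComm _ _)

theorem flipAll_apply (w : Hil₂ ι D κ) (a b : (ι → D) × κ) : flipAll w (a, b) = w (b, a) := rfl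

theorem flipAll_tens (x y : Hil ι D κ) : flipAll (tens x y) = tens y x := by
  ext ⟨a, b⟩; simp [flipAll_apply, tens_apply, mul_comm]

theorem flipAll_swapOp (T : Finset ι) (w : Hil₂ ι D κ) :
    flipAll (swapOp T w) = swapOp T (flipAll w) := by
  ext ⟨a, b⟩; rfl

theorem swapOp_swapOp (S T : Finset ι) (w : Hil₂ ι D κ) :
    swapOp S (swapOp T w) = swapOp (symmDiff S T) w := by
  ext ⟨a, b⟩
  simp only [swapOp_apply]
  refine congrArg (fun z => w z) (Prod.ext (Prod.ext (funext fun i => ?_) rfl)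
    (Prod.ext (funext fun i => ?_) rfl)) <;>
  by_cases h : i ∈ S <;> by_cases h' : i ∈ T <;> simp [mix, Finset.mem_symmDiff, h, h']

theorem inner_swapOp (T : Finset ι) (v w : Hil₂ ι D κ) :
    inner ℂ (swapOp T v) w = inner ℂ v (swapOp T w) := by
  rw [← LinearIsometryEquiv.inner_map_map (swapOp T) v, swapOp_swapOp]
  simp [swapOp_empty]

end Swap

/-! ### Partial contractions -/

section Contract

variable {ι D κ : Type*} [Fintype ι] [DecidableEq ι] [Fintype D] [DecidableEq D] [Fintype κ]
  [DecidableEq κ]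

/-- The configuration given by `s` on `T` and by `t` outside `T` and on the register. -/
def glue (T : Finset ι) (s : {i // i ∈ T} → D) (t : ({i // i ∉ T} → D) × κ) : (ι → D) × κ :=
  ((Equiv.piEquivPiSubtypeProd (· ∈ T) fun _ => D).symm (s, t.1), t.2)

theorem sum_glue {M : Type*} [AddCommMonoid M] (T : Finset ι) (f : (ι → D) × κ → M) :
    ∑ a, f a = ∑ s, ∑ t, f (glue T s t) := by
  rw [Fintype.sum_prod_type, ← Equiv.sum_comp (Equiv.piEquivPiSubtypeProd (· ∈ T) fun _ => D).symm,
    Fintype.sum_prod_type]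
  refine Finset.sum_congr rfl fun s _ => ?_
  rw [Fintype.sum_prod_type]
  rfl

theorem mix_glue (T : Finset ι) (s s' : {i // i ∈ T} → D) (t t' : ({i // i ∉ T} → D) × κ) :
    mix T (glue T s t) (glue T s' t') = glue T s' t := by
  refine Prod.ext (funext fun i => ?_) rfl
  by_cases h : i ∈ T <;> simp [mix, glue, Equiv.piEquivPiSubtypeProd, h]

/-- The contraction of the conjugate of `x` with `y` over the sites in `T`. -/
def contract (T : Finset ι) (x y : Hil ι D κ) :
    EuclideanSpace ℂ ((({i // i ∉ T} → D) × κ) × (({i // i ∉ T} → D) × κ)) :=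
  WithLp.toLp 2 fun t => ∑ s, starRingEnd ℂ (x (glue T s t.1)) * y (glue T s t.2)

/-- The contraction of the conjugate of `x` with `y` over the sites outside `T` and the
register. -/
def contractOff (T : Finset ι) (x y : Hil ι D κ) :
    EuclideanSpace ℂ (({i // i ∈ T} → D) × ({i // i ∈ T} → D)) :=
  WithLp.toLp 2 fun s => ∑ t, starRingEnd ℂ (x (glue T s.1 t)) * y (glue T s.2 t)

theorem swapForm_eq_sum (T : Finset ι) (x y z v : Hil ι D κ) :
    swapForm T x y z v = ∑ s, ∑ t, ∑ s', ∑ t', starRingEnd ℂ (x (glue T s t)) *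
      starRingEnd ℂ (v (glue T s' t')) * (z (glue T s' t) * y (glue T s t')) := by
  simp only [swapForm, PiLp.inner_apply, RCLike.inner_apply]
  rw [Fintype.sum_prod_type, sum_glue T]
  refine Finset.sum_congr rfl fun s _ => Finset.sum_congr rfl fun t _ => ?_
  rw [sum_glue T]
  refine Finset.sum_congr rfl fun s' _ => Finset.sum_congr rfl fun t' _ => ?_
  rw [swapOp_apply, mix_glue, mix_glue, tens_apply, tens_apply, map_mul]
  ring

theorem swapForm_eq_inner (T : Finset ι) (x y z v : Hil ι D κ) :
    swapForm T x y z v = inner ℂ (contract T z v) (contract T x y) := by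
  rw [swapForm_eq_sum]
  simp only [contract, PiLp.inner_apply, RCLike.inner_apply, map_sum, map_mul,
    RingHomCompTriple.comp_apply, RingHom.id_apply, Fintype.sum_prod_type (α₁ := _ × κ)]
  simp only [Finset.sum_mul_sum]
  rw [Finset.sum_comm]
  refine Finset.sum_congr rfl fun t _ => ?_
  simp only [Finset.sum_comm (s := (Finset.univ : Finset (({i // i ∉ T} → D) × κ)))
    (t := (Finset.univ : Finset ({i // i ∈ T} → D)))]
  refine Finset.sum_congr rfl fun s _ => ?_
  refine Finset.sum_congr rfl fun s' _ => Finset.sum_congr rfl fun t' _ => ?_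
  ring

theorem swapForm_eq_inner_off (T : Finset ι) (x y z v : Hil ι D κ) :
    swapForm T x y z v = inner ℂ (contractOff T y v) (contractOff T x z) := by
  rw [swapForm_eq_sum]
  simp only [contractOff, PiLp.inner_apply, RCLike.inner_apply, map_sum, map_mul,
    RingHomCompTriple.comp_apply, RingHom.id_apply, Finset.sum_mul_sum]
  rw [Fintype.sum_prod_type]
  refine Finset.sum_congr rfl fun s _ => ?_
  rw [Finset.sum_comm]
  refine Finset.sum_congr rfl fun s' _ => ?_
  refine Finset.sum_congr rfl fun t _ => Finset.sum_congr rfl fun t' _ => ?_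
  ring

theorem contract_add_left (T : Finset ι) (x x' y : Hil ι D κ) :
    contract T (x + x') y = contract T x y + contract T x' y := by
  ext t; simp [contract, add_mul, Finset.sum_add_distrib]

theorem contract_add_right (T : Finset ι) (x y y' : Hil ι D κ) :
    contract T x (y + y') = contract T x y + contract T x y' := by
  ext t; simp [contract, mul_add, Finset.sum_add_distrib]

theorem norm_contract_sq (T : Finset ι) (x y : Hil ι D κ) :
    swapForm T x y x y = (‖contract T x y‖ : ℂ) ^ 2 := by
  rw [swapForm_eq_inner, inner_self_eq_norm_sq_to_K]; rfl

theorem norm_contract_le (T : Finset ι) (x y : Hil ι D κ) : ‖contract T x y‖ ≤ ‖x‖ * ‖y‖ := by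
  have h := norm_swapForm_le T x y x y
  rw [norm_contract_sq] at h
  simp only [norm_pow, Complex.norm_real, norm_norm] at h
  refine (sq_le_sq₀ (norm_nonneg _) (by positivity)).1 (by nlinarith)

theorem two_mul_norm_contract_sq_le (T : Finset ι) (x y : Hil ι D κ) :
    2 * ‖contract T x y‖ ^ 2 ≤ ‖contract T x x‖ ^ 2 + ‖contract T y y‖ ^ 2 := by
  have h : ∀ x : Hil ι D κ, ‖contract T x x‖ ^ 2 = ‖contractOff T x x‖ ^ 2 := fun x => by
    have h1 := (norm_contract_sq T x x).symm.trans (swapForm_eq_inner_off T x x x x)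
    rw [inner_self_eq_norm_sq_to_K] at h1
    exact Complex.ofReal_injective (by simpa using h1)
  have h2 := congrArg norm ((norm_contract_sq T x y).symm.trans (swapForm_eq_inner_off T x y x y))
  have h3 := norm_inner_le_norm (𝕜 := ℂ) (contractOff T y y) (contractOff T x x)
  rw [← h2] at h3
  simp only [norm_pow, Complex.norm_real, norm_norm] at h3
  rw [h x, h y]
  nlinarith [sq_nonneg (‖contractOff T x x‖ - ‖contractOff T y y‖)]

end Contract

/-! ### Symmetrisation over a set of sites -/

section Sym

variable {ι D κ : Type*} [Fintype ι] [DecidableEq ι] [Fintype D] [DecidableEq D] [Fintype κ]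
  [DecidableEq κ]

/-- The projection `∏_{i ∈ A} (1 + F_i) / 2`, as the average of `F_T` over the subsets of `A`. -/
def symProj (A : Finset ι) : Hil₂ ι D κ →L[ℂ] Hil₂ ι D κ :=
  subsetAvg (1 / 2) A fun T => (swapOp T).toContinuousLinearEquiv.toContinuousLinearMap

theorem symProj_apply (A : Finset ι) (w : Hil₂ ι D κ) :
    symProj A w = subsetAvg (1 / 2) A fun T => swapOp T w := by
  simp only [symProj, subsetAvg, sum_apply, smul_apply]
  rfl

theorem swapOp_subsetAvg (S A : Finset ι) (ρ : ℝ) (f : Finset ι → Hil₂ ι D κ) :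
    swapOp S (subsetAvg ρ A f) = subsetAvg ρ A fun T => swapOp S (f T) :=
  (subsetAvg_map ((swapOp S).toLinearEquiv.toLinearMap.restrictScalars ℝ) ρ A f).symm

theorem inner_subsetAvg (A : Finset ι) (ρ : ℝ) (v : Hil₂ ι D κ) (f : Finset ι → Hil₂ ι D κ) :
    inner ℂ v (subsetAvg ρ A f) = subsetAvg ρ A fun T => inner ℂ v (f T) :=
  (subsetAvg_map ((innerSL ℂ v).restrictScalars ℝ).toLinearMap ρ A f).symm

theorem inner_symProj (A : Finset ι) (v w : Hil₂ ι D κ) :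
    inner ℂ v (symProj A w) = subsetAvg (1 / 2) A fun T => inner ℂ v (swapOp T w) := by
  rw [symProj_apply, inner_subsetAvg]

theorem swapOp_symProj {S A : Finset ι} (h : S ⊆ A) (w : Hil₂ ι D κ) :
    swapOp S (symProj A w) = symProj A w := by
  rw [symProj_apply, swapOp_subsetAvg]
  have hw : ∀ T ∈ A.powerset, (1 / 2 : ℝ) ^ T.card * (1 - 1 / 2) ^ (A \ T).card =
      (1 / 2) ^ A.card := fun T hT => by
    rw [show (1 : ℝ) - 1 / 2 = 1 / 2 by norm_num, ← pow_add,
      add_comm, Finset.card_sdiff_add_card_eq_card (Finset.mem_powerset.1 hT)]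
  unfold subsetAvg
  rw [Finset.sum_congr rfl fun T hT => by rw [hw T hT]]
  conv_rhs => rw [Finset.sum_congr rfl fun T hT => by rw [hw T hT]]
  have hmem : ∀ T ∈ A.powerset, symmDiff S T ∈ A.powerset := fun T hT => by
    rw [Finset.mem_powerset] at hT ⊢
    exact symmDiff_le_sup.trans (Finset.union_subset h hT)
  refine Finset.sum_nbij' (symmDiff S) (symmDiff S) hmem hmem (fun T _ => by simp)
    (fun T _ => by simp) fun T _ => ?_
  exact congrArg _ (swapOp_swapOp S T w)

theorem swapOp_insert {T : Finset ι} {i : ι} (hi : i ∉ T) (w : Hil₂ ι D κ) :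
    swapOp (insert i T) w = swapOp {i} (swapOp T w) := by
  rw [swapOp_swapOp, Finset.insert_eq]
  congr 1
  exact ((Finset.disjoint_singleton_left.2 hi).symmDiff_eq_sup).symm ▸ rfl

theorem symProj_insert {A : Finset ι} {i : ι} (hi : i ∉ A) (w : Hil₂ ι D κ) :
    symProj (insert i A) w = (1 / 2 : ℝ) • (symProj A w + swapOp {i} (symProj A w)) := by
  rw [symProj_apply, subsetAvg_insert _ hi, symProj_apply, swapOp_subsetAvg, smul_add]
  congr 1
  · norm_num
  · congr 1
    exact subsetAvg_congr fun T hT => swapOp_insert (fun h => hi (hT h)) w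

theorem isProjFamily_symProj : IsProjFamily (symProj : Finset ι → Hil₂ ι D κ →L[ℂ] Hil₂ ι D κ) where
  empty := by ext w; simp [symProj_apply, swapOp_empty]
  union S T := by
    ext1 w
    rw [mul_apply_eq_comp]
    induction S using Finset.induction_on with
    | empty => rw [Finset.empty_union, symProj_apply ∅]; simp [swapOp_empty]
    | insert i S hi ih =>
      rw [symProj_insert hi, ← ih, Finset.insert_union]
      by_cases h : i ∈ S ∪ T
      · rw [Finset.insert_eq_of_mem h, swapOp_symProj (by simpa using h), ← two_smul ℝ, smul_smul]
        norm_num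
      · rw [symProj_insert h]
  symm S x y := by
    rw [inner_symProj, ← inner_conj_symm, inner_symProj]
    have h := subsetAvg_map (Complex.conjAe.toLinearMap) (1 / 2) S
      fun T => inner ℂ y (swapOp T x)
    exact h.symm.trans (subsetAvg_congr fun T _ => by simp [inner_swapOp])

theorem symProj_swapOp (S A : Finset ι) (w : Hil₂ ι D κ) :
    symProj A (swapOp S w) = swapOp S (symProj A w) := by
  simp only [symProj_apply, swapOp_subsetAvg, swapOp_swapOp, symmDiff_comm]

theorem symProj_flipAll (A : Finset ι) (w : Hil₂ ι D κ) :
    symProj A (flipAll w) = flipAll (symProj A w) := by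
  simp only [symProj_apply, ← flipAll_swapOp]
  exact (subsetAvg_map ((flipAll (ι := ι)).toLinearEquiv.toLinearMap.restrictScalars ℝ) _ _ _)

end Sym

/-! ### Product projections -/

section SiteProj

variable {ι D κ : Type*} [Fintype ι] [DecidableEq ι] [Fintype D] [DecidableEq D] [Fintype κ]
  [DecidableEq κ]

/-- The rank-one operator `|a⟩⟨b|`. -/
abbrev ketBra (a b : D → ℂ) : Matrix D D ℂ := Matrix.vecMulVec a (star b)

theorem ketBra_mul_ketBra (a b c e : D → ℂ) :
    ketBra a b * ketBra c e = (star b ⬝ᵥ c) • ketBra a e := by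
  rw [ketBra, Matrix.vecMulVec_mul_vecMulVec, ketBra, Matrix.vecMulVec_smul]

theorem conjTranspose_ketBra (a b : D → ℂ) : (ketBra a b).conjTranspose = ketBra b a := by
  ext i j; simp [ketBra, Matrix.vecMulVec_apply, mul_comm]

/-- A choice of a unit vector at each site. -/
def IsUnitFamily (α : ι → D → ℂ) : Prop := ∀ i, star (α i) ⬝ᵥ α i = 1

/-- The projection onto the vectors that are in the state `α i` at each site `i ∈ T`. -/
def siteProj (α : ι → D → ℂ) (T : Finset ι) : Hil ι D κ →L[ℂ] Hil ι D κ :=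
  prodOp fun i => if i ∈ T then ketBra (α i) (α i) else 1

theorem isProjFamily_siteProj {α : ι → D → ℂ} (hα : IsUnitFamily α) :
    IsProjFamily (siteProj α : Finset ι → Hil ι D κ →L[ℂ] Hil ι D κ) where
  empty := by simp [siteProj, prodOp_one]
  union S T := by
    rw [siteProj, siteProj, siteProj, ← prodOp_mul]
    congr 1
    funext i
    by_cases h : i ∈ S <;> by_cases h' : i ∈ T <;>
      simp [h, h', ketBra_mul_ketBra, hα i]
  symm S x y := by
    rw [siteProj, inner_prodOp]
    congr 3
    funext i
    split_ifs <;> simp [conjTranspose_ketBra]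

theorem siteProj_comm (α γ : ι → D → ℂ) {S T : Finset ι} (h : Disjoint S T) (x : Hil ι D κ) :
    siteProj α S (siteProj γ T x) = siteProj γ T (siteProj α S x) := by
  rw [siteProj, siteProj, prodOp_prodOp, prodOp_prodOp]
  congr 2
  funext i
  by_cases h1 : i ∈ S
  · simp [h1, Finset.disjoint_left.1 h h1]
  · simp [h1]

/-- The swap of `T` fixes a pair of vectors that are in the same product state on `T`. -/
theorem swapOp_tens_siteProj (α : ι → D → ℂ) (T : Finset ι) (z y : Hil ι D κ) :
    swapOp T (tens (siteProj α T z) (siteProj α T y)) =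
      tens (siteProj α T z) (siteProj α T y) := by
  refine swapOp_tens_prodOp T _ _ _ _ (fun i hi a b c e => ?_) (fun i hi a b c e => rfl) z y
  simp [hi, ketBra, Matrix.vecMulVec_apply]
  ring

/-- Projections on the sites that are not swapped stay on their copy. -/
theorem swapForm_siteProj_of_disjoint {α : ι → D → ℂ} {S T : Finset ι}
    (h : Disjoint S T) (x y z v : Hil ι D κ) :
    swapForm T (siteProj α S x) (siteProj α S y) z v =
      swapForm T x y (siteProj α S z) (siteProj α S v) := by
  have hone : ∀ w : Hil ι D κ, prodOp (fun _ => 1) w = w := fun w => by rw [prodOp_one]; rfl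
  have e1 : (fun i => (if i ∈ T then if i ∈ S then ketBra (α i) (α i) else 1
      else (1 : Matrix D D ℂ)).conjTranspose) = fun _ => 1 := by
    funext i
    by_cases hi : i ∈ T <;> simp [hi, Finset.disjoint_right.1 h]
  have e2 : (fun i => (if i ∈ T then (1 : Matrix D D ℂ)
      else if i ∈ S then ketBra (α i) (α i) else 1).conjTranspose) =
      fun i => if i ∈ S then ketBra (α i) (α i) else 1 := by
    funext i
    by_cases hi : i ∈ T <;> by_cases hj : i ∈ S <;>
      simp_all [Finset.disjoint_right.1 h, conjTranspose_ketBra]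
  have h1 := swapForm_prodOp T (fun _ => 1) (fun i => if i ∈ S then ketBra (α i) (α i) else 1)
    (siteProj α S x) y z v
  have h2 := swapForm_prodOp T (fun i => if i ∈ S then ketBra (α i) (α i) else 1) (fun _ => 1)
    x y z (siteProj α S v)
  rw [e1, e2, hone, hone] at h1 h2
  exact h1.trans h2.symm

end SiteProj

/-! ### Swap forms of vectors that are in product states -/

section ProductState

variable {ι D κ : Type*} [Fintype ι] [DecidableEq ι] [Fintype D] [DecidableEq D] [Fintype κ]
  [DecidableEq κ]

theorem swapForm_siteProj_right (α : ι → D → ℂ) (T : Finset ι) (x y z v : Hil ι D κ) :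
    swapForm T x y (siteProj α T z) v = swapForm T x y z (siteProj α T v) := by
  have hone : ∀ w : Hil ι D κ, prodOp (fun _ => 1) w = w := fun w => by rw [prodOp_one]; rfl
  have e1 : (fun i => (if i ∈ T then (1 : Matrix D D ℂ) else
      if i ∈ T then ketBra (α i) (α i) else 1).conjTranspose) = fun _ => 1 := by
    funext i
    by_cases hi : i ∈ T <;> simp [hi]
  have e2 : (fun i => (if i ∈ T then if i ∈ T then ketBra (α i) (α i) else 1
      else (1 : Matrix D D ℂ)).conjTranspose) =
      fun i => if i ∈ T then ketBra (α i) (α i) else 1 := by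
    funext i
    by_cases hi : i ∈ T <;> simp [hi]
  have h := swapForm_prodOp T (fun i => if i ∈ T then ketBra (α i) (α i) else 1) (fun _ => 1)
    x y z v
  rw [e1, e2, hone, hone] at h
  exact h

theorem swapForm_siteProj_left (α : ι → D → ℂ) (T : Finset ι) (x y z v : Hil ι D κ) :
    swapForm T (siteProj α T x) y z v = swapForm T x (siteProj α T y) z v := by
  rw [swapForm_eq_inner, swapForm_eq_inner, ← inner_conj_symm, ← swapForm_eq_inner,
    swapForm_siteProj_right, swapForm_eq_inner, inner_conj_symm]

variable {α : ι → D → ℂ}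

theorem norm_contract_siteProj_left_le (hα : IsUnitFamily α) (T : Finset ι) (x y : Hil ι D κ) :
    ‖contract T (siteProj α T x) y‖ ≤ ‖siteProj α T x‖ * ‖siteProj α T y‖ := by
  have hP : IsProjFamily (siteProj (κ := κ) α) := isProjFamily_siteProj hα
  have h : swapForm T (siteProj α T x) y (siteProj α T x) y =
      swapForm T (siteProj α T x) (siteProj α T y) (siteProj α T x) (siteProj α T y) := by
    rw [← swapForm_siteProj_left, ← swapForm_siteProj_right, hP.idem]
  rw [norm_contract_sq, norm_contract_sq] at h
  have h' : ‖contract T (siteProj α T x) y‖ ^ 2 =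
    ‖contract T (siteProj α T x) (siteProj α T y)‖ ^ 2 := by exact_mod_cast h
  rw [(pow_left_inj₀ (norm_nonneg _) (norm_nonneg _) two_ne_zero).1 h']
  exact norm_contract_le _ _ _

theorem norm_contract_siteProj_right_le (hα : IsUnitFamily α) (T : Finset ι) (x y : Hil ι D κ) :
    ‖contract T x (siteProj α T y)‖ ≤ ‖siteProj α T x‖ * ‖siteProj α T y‖ := by
  have hP : IsProjFamily (siteProj (κ := κ) α) := isProjFamily_siteProj hα
  have h : swapForm T x (siteProj α T y) x (siteProj α T y) =
      swapForm T (siteProj α T x) (siteProj α T y) (siteProj α T x) (siteProj α T y) := by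
    rw [swapForm_siteProj_left, swapForm_siteProj_right, hP.idem]
  rw [norm_contract_sq, norm_contract_sq] at h
  have h' : ‖contract T x (siteProj α T y)‖ ^ 2 =
    ‖contract T (siteProj α T x) (siteProj α T y)‖ ^ 2 := by exact_mod_cast h
  rw [(pow_left_inj₀ (norm_nonneg _) (norm_nonneg _) two_ne_zero).1 h']
  exact norm_contract_le _ _ _

/-- If `x` and `y` are in the same product state on `R`, a swap of `T ⊆ R` acts on them almost
trivially, up to the weight of `z` and `v` that violates the product state on `T` only. -/
theorem norm_swapForm_siteProj_sub_le (hα : IsUnitFamily α) {T R : Finset ι} (hT : T ⊆ R)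
    (x y z v : Hil ι D κ) :
    ‖swapForm T (siteProj α R x) (siteProj α R y) z v -
        inner ℂ (siteProj α R x) z * inner ℂ v (siteProj α R y)‖ ≤
      ‖siteProj α R x‖ * ‖siteProj α R y‖ *
        (‖siteProj α (R \ T) z - siteProj α R z‖ * ‖siteProj α (R \ T) v - siteProj α R v‖) := by
  have hP : IsProjFamily (siteProj (κ := κ) α) := isProjFamily_siteProj hα
  set P := siteProj (κ := κ) α
  have hRT : ∀ w, P T (P (R \ T) w) = P R w := fun w => by
    have := congrArg (· w) (hP.union T (R \ T))
    rw [Finset.union_sdiff_of_subset hT] at this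
    simpa using this.symm
  have h1 : swapForm T (P R x) (P R y) z v =
      swapForm T (P R x) (P R y) (P (R \ T) z) (P (R \ T) v) := by
    rw [← swapForm_siteProj_of_disjoint Finset.sdiff_disjoint,
      hP.apply_of_subset Finset.sdiff_subset, hP.apply_of_subset Finset.sdiff_subset]
  set Δz := P (R \ T) z - P R z with hΔz
  set Δv := P (R \ T) v - P R v with hΔv
  have h2 : swapForm T (P R x) (P R y) (P R z) (P (R \ T) v) =
      inner ℂ (P R x) z * inner ℂ v (P R y) := by
    rw [swapForm, ← hP.apply_of_subset hT z, ← hP.apply_of_subset hT y, swapOp_tens_siteProj,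
      inner_tens, hP.apply_of_subset hT, hP.apply_of_subset hT, hP.symm R x, hP.idem,
      ← hP.symm R x, hP.symm (R \ T), hP.apply_of_subset Finset.sdiff_subset]
  have h3 : swapForm T (P R x) (P R y) Δz (P R v) = 0 := by
    have hΔ : P T Δz = 0 := by rw [hΔz, map_sub, hRT, hP.apply_of_subset hT, sub_self]
    rw [← hP.apply_of_subset hT v, ← swapForm_siteProj_right]
    change swapForm T (P R x) (P R y) (P T Δz) (P R v) = 0
    rw [hΔ]
    simp [swapForm, show tens (0 : Hil ι D κ) (P R y) = 0 by ext ⟨a, b⟩; simp [tens_apply]]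
  have h4 : swapForm T (P R x) (P R y) (P (R \ T) z) (P (R \ T) v) =
      swapForm T (P R x) (P R y) (P R z) (P (R \ T) v) +
        swapForm T (P R x) (P R y) Δz (P R v) + swapForm T (P R x) (P R y) Δz Δv := by
    have e1 : P (R \ T) z = P R z + Δz := by simp [hΔz]
    have e2 : contract T Δz (P (R \ T) v) = contract T Δz (P R v) + contract T Δz Δv := by
      rw [← contract_add_right]; simp [hΔv]
    simp only [swapForm_eq_inner]
    rw [e1, contract_add_left, inner_add_left, e2, inner_add_left, add_assoc]
  rw [h1, h4, h2, h3, add_zero, add_sub_cancel_left]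
  exact norm_swapForm_le _ _ _ _ _

theorem norm_swapForm_siteProj_sub_le_of_gain_le (hα : IsUnitFamily α) {T A R : Finset ι}
    (hT : T ⊆ A) (hA : A ⊆ R) {x y z v : Hil ι D κ} {δ : ℝ} (hx : ‖x‖ ≤ 1) (hy : ‖y‖ ≤ 1)
    (hz : gain (siteProj α) R A z ≤ δ) (hv : gain (siteProj α) R A v ≤ δ) :
    ‖swapForm T (siteProj α R x) (siteProj α R y) z v -
        inner ℂ (siteProj α R x) z * inner ℂ v (siteProj α R y)‖ ≤ δ := by
  have hP : IsProjFamily (siteProj (κ := κ) α) := isProjFamily_siteProj hα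
  refine (norm_swapForm_siteProj_sub_le hα (hT.trans hA) x y z v).trans ?_
  have hz' := (hP.gain_mono hT z).trans hz
  have hv' := (hP.gain_mono hT v).trans hv
  rw [hP.gain_eq] at hz' hv'
  have hx' := (hP.norm_le R x).trans hx
  have hy' := (hP.norm_le R y).trans hy
  set a := ‖siteProj α (R \ T) z - siteProj α R z‖
  set b := ‖siteProj α (R \ T) v - siteProj α R v‖
  have hab : a * b ≤ δ := by nlinarith [sq_nonneg (a - b)]
  have h1 : ‖siteProj α R x‖ * ‖siteProj α R y‖ ≤ 1 := mul_le_one₀ hx' (norm_nonneg _) hy'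
  have h0 : 0 ≤ a * b := mul_nonneg (norm_nonneg _) (norm_nonneg _)
  nlinarith

/-- Splitting `ψ` into its part in a product state and the rest, the overlap of `ψ ⊗ ψ` with its
partial swap is almost the sum of the overlaps of the two parts. -/
theorem norm_contract_sq_le_of_gain_le (hα : IsUnitFamily α) {T A R : Finset ι}
    (hT : T ⊆ A) (hA : A ⊆ R) {ψ : Hil ι D κ} {δ k : ℝ} (hψ : ‖ψ‖ = 1) (hk : 0 ≤ k)
    (hδ : gain (siteProj α) R A ψ ≤ δ)
    (hκ : ‖siteProj α T ψ‖ ^ 2 - ‖siteProj α R ψ‖ ^ 2 ≤ k ^ 2) :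
    ‖contract T ψ ψ‖ ^ 2 ≤ (‖siteProj α R ψ‖ ^ 2) ^ 2 +
      ‖contract T (ψ - siteProj α R ψ) (ψ - siteProj α R ψ)‖ ^ 2 + 2 * δ + 4 * k + 4 * k ^ 2 := by
  have hP : IsProjFamily (siteProj (κ := κ) α) := isProjFamily_siteProj hα
  set P := siteProj (κ := κ) α
  set ψ0 := P R ψ with hψ0
  set ψ1 := ψ - ψ0 with hψ1
  have hTR := hT.trans hA
  have hsum : ψ = ψ0 + ψ1 := by simp [hψ1]
  have hn : ‖ψ0‖ ^ 2 + ‖ψ1‖ ^ 2 = 1 := by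
    rw [hψ1, hψ0, ← hP.norm_sq_add_self R ψ, hψ, one_pow]
  have hn0 : ‖ψ0‖ ≤ 1 := by nlinarith [norm_nonneg ψ0, sq_nonneg ‖ψ1‖]
  have hP1 : ‖P T ψ1‖ ≤ k := by
    have h := hP.norm_sq_add hTR ψ
    have e : P T ψ1 = P T ψ - P R ψ := by rw [hψ1, map_sub, hψ0, hP.apply_of_subset hTR]
    rw [e]
    refine (sq_le_sq₀ (norm_nonneg _) hk).1 (by linarith)
  have hP0 : P T ψ0 = ψ0 := hP.apply_of_subset hTR ψ
  have c01 : ‖contract T ψ0 ψ1‖ ≤ k := by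
    have := norm_contract_siteProj_left_le hα T ψ0 ψ1
    change ‖contract T (P T ψ0) ψ1‖ ≤ ‖P T ψ0‖ * ‖P T ψ1‖ at this
    rw [hP0] at this
    refine this.trans ((mul_le_mul hn0 hP1 (norm_nonneg _) zero_le_one).trans_eq (one_mul k))
  have c10 : ‖contract T ψ1 ψ0‖ ≤ k := by
    have := norm_contract_siteProj_right_le hα T ψ1 ψ0
    change ‖contract T ψ1 (P T ψ0)‖ ≤ ‖P T ψ1‖ * ‖P T ψ0‖ at this
    rw [hP0] at this
    refine this.trans ((mul_le_mul hP1 hn0 (norm_nonneg _) hk).trans_eq (mul_one k))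
  have c00 : ‖contract T ψ0 ψ0‖ ≤ ‖ψ0‖ ^ 2 := (norm_contract_le T ψ0 ψ0).trans_eq (sq _).symm
  have c11 : ‖contract T ψ1 ψ1‖ ≤ ‖ψ1‖ ^ 2 := (norm_contract_le T ψ1 ψ1).trans_eq (sq _).symm
  have hgain : gain P R A ψ1 ≤ δ := by
    rw [hP.gain_eq] at hδ ⊢
    rw [hψ1, hψ0, map_sub, map_sub, hP.idem, hP.apply_of_subset Finset.sdiff_subset]
    simpa using hδ
  have hcross : ‖inner ℂ (contract T ψ1 ψ1) (contract T ψ0 ψ0)‖ ≤ δ := by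
    have h := norm_swapForm_siteProj_sub_le_of_gain_le hα hT hA hψ.le hψ.le hgain hgain
    change ‖swapForm T ψ0 ψ0 ψ1 ψ1 - inner ℂ ψ0 ψ1 * inner ℂ ψ1 ψ0‖ ≤ δ at h
    have horth : inner ℂ ψ0 ψ1 = 0 := by
      rw [hψ1, inner_sub_right, hψ0, hP.symm, hP.symm, hP.idem, sub_self]
    rwa [horth, zero_mul, sub_zero, swapForm_eq_inner] at h
  set s := ‖contract T ψ0 ψ0 + contract T ψ1 ψ1‖ with hs
  have hs1 : s ≤ 1 := by
    have := norm_add_le (contract T ψ0 ψ0) (contract T ψ1 ψ1)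
    linarith
  have hs2 : s ^ 2 ≤ (‖ψ0‖ ^ 2) ^ 2 + ‖contract T ψ1 ψ1‖ ^ 2 + 2 * δ := by
    rw [hs, norm_add_sq (𝕜 := ℂ)]
    have h1 : RCLike.re (inner ℂ (contract T ψ0 ψ0) (contract T ψ1 ψ1)) ≤ δ := by
      refine (RCLike.re_le_norm _).trans ?_
      rwa [norm_inner_symm]
    have h2 := norm_nonneg (contract T ψ0 ψ0)
    have h3 : ‖contract T ψ0 ψ0‖ ^ 2 ≤ (‖ψ0‖ ^ 2) ^ 2 := by gcongr
    linarith
  have htot : ‖contract T ψ ψ‖ ≤ s + 2 * k := by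
    have e : contract T ψ ψ = (contract T ψ0 ψ0 + contract T ψ1 ψ1) +
        (contract T ψ0 ψ1 + contract T ψ1 ψ0) := by
      conv_lhs => rw [hsum]
      rw [contract_add_left, contract_add_right, contract_add_right]
      abel
    rw [e]
    refine (norm_add_le _ _).trans ?_
    have := norm_add_le (contract T ψ0 ψ1) (contract T ψ1 ψ0)
    linarith
  have h0 := norm_nonneg (contract T ψ ψ)
  have hs0 : 0 ≤ s := norm_nonneg _
  nlinarith

theorem inner_sub_inner_le {E F : Type*} [NormedAddCommGroup E] [InnerProductSpace ℂ E]
    [NormedAddCommGroup F] [InnerProductSpace ℂ F] {a a0 b b0 : E} {n n0 m m0 : F} {δ : ℝ}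
    (h1 : ‖(inner ℂ b a0 : ℂ) - inner ℂ m n0‖ ≤ δ) (h2 : ‖(inner ℂ b0 a : ℂ) - inner ℂ m0 n‖ ≤ δ)
    (h3 : ‖(inner ℂ b0 a0 : ℂ) - inner ℂ m0 n0‖ ≤ δ) :
    ‖(inner ℂ b a : ℂ) - inner ℂ m n‖ ≤
      ‖a - a0‖ * ‖b - b0‖ + ‖n - n0‖ * ‖m - m0‖ + 3 * δ := by
  have e : (inner ℂ b a : ℂ) - inner ℂ m n =
      (inner ℂ (b - b0) (a - a0) - inner ℂ (m - m0) (n - n0)) +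
      ((inner ℂ b a0 - inner ℂ m n0) + (inner ℂ b0 a - inner ℂ m0 n) -
        (inner ℂ b0 a0 - inner ℂ m0 n0)) := by
    simp only [inner_sub_left, inner_sub_right]
    ring
  rw [e]
  have g1 := norm_inner_le_norm (𝕜 := ℂ) (b - b0) (a - a0)
  have g2 := norm_inner_le_norm (𝕜 := ℂ) (m - m0) (n - n0)
  have g3 := norm_add_le ((inner ℂ (b - b0) (a - a0) : ℂ) - inner ℂ (m - m0) (n - n0))
    ((inner ℂ b a0 - inner ℂ m n0) + (inner ℂ b0 a - inner ℂ m0 n) -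
        (inner ℂ b0 a0 - inner ℂ m0 n0))
  have g4 := norm_sub_le (inner ℂ (b - b0) (a - a0) : ℂ) (inner ℂ (m - m0) (n - n0))
  have g5 := norm_sub_le ((inner ℂ b a0 - inner ℂ m n0 : ℂ) + (inner ℂ b0 a - inner ℂ m0 n))
    (inner ℂ b0 a0 - inner ℂ m0 n0)
  have g6 := norm_add_le (inner ℂ b a0 - inner ℂ m n0 : ℂ) (inner ℂ b0 a - inner ℂ m0 n)
  linarith

theorem swapForm_empty_contract (x y z v : Hil ι D κ) :
    inner ℂ (contract ∅ z v) (contract ∅ x y) = inner ℂ x z * inner ℂ v y := by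
  rw [← swapForm_eq_inner, swapForm_empty]

theorem norm_contract_empty_sub_sq (hα : IsUnitFamily α) (R : Finset ι) {x y : Hil ι D κ}
    (hx : ‖x‖ = 1) (hy : ‖y‖ = 1) :
    ‖contract ∅ x y - contract ∅ (siteProj α R x) (siteProj α R y)‖ ^ 2 =
      1 - ‖siteProj α R x‖ ^ 2 * ‖siteProj α R y‖ ^ 2 := by
  have hP : IsProjFamily (siteProj (κ := κ) α) := isProjFamily_siteProj hα
  have h : (‖contract ∅ x y - contract ∅ (siteProj α R x) (siteProj α R y)‖ ^ 2 : ℂ) =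
      1 - ‖siteProj α R x‖ ^ 2 * ‖siteProj α R y‖ ^ 2 := by
    have := inner_self_eq_norm_sq_to_K (𝕜 := ℂ)
      (contract ∅ x y - contract ∅ (siteProj α R x) (siteProj α R y))
    refine Eq.trans this.symm ?_
    have e : ∀ w : Hil ι D κ, inner ℂ (siteProj α R w) w = (‖siteProj α R w‖ : ℂ) ^ 2 := fun w => by
      rw [hP.symm, hP.inner_apply_self]
    rw [inner_sub_left, inner_sub_right, inner_sub_right]
    simp only [swapForm_empty_contract, hP.inner_apply_self, e]
    simp only [inner_self_eq_norm_sq_to_K, hx, hy]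
    simp
  exact_mod_cast h

theorem norm_contract_sub_le (hα : IsUnitFamily α) {T R : Finset ι} (hT : T ⊆ R) {x y : Hil ι D κ}
    {k : ℝ} (hk : 0 ≤ k) (hx : ‖x‖ = 1) (hy : ‖y‖ = 1)
    (hκ : ‖siteProj α T x‖ ^ 2 - ‖siteProj α R x‖ ^ 2 +
      (‖siteProj α T y‖ ^ 2 - ‖siteProj α R y‖ ^ 2) ≤ 2 * k ^ 2) :
    ‖contract T x y - contract T (siteProj α R x) (siteProj α R y)‖ ≤
      ‖x - siteProj α R x‖ * ‖y - siteProj α R y‖ + 2 * k := by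
  have hP : IsProjFamily (siteProj (κ := κ) α) := isProjFamily_siteProj hα
  set P := siteProj (κ := κ) α
  have e : contract T x y - contract T (P R x) (P R y) =
      contract T (x - P R x) (y - P R y) + (contract T (P R x) (y - P R y) +
        contract T (x - P R x) (P R y)) := by
    conv_lhs => rw [← sub_add_cancel x (P R x), ← sub_add_cancel y (P R y), contract_add_left,
      contract_add_right, contract_add_right, sub_add_cancel, sub_add_cancel]
    abel
  have h1 := norm_contract_siteProj_left_le hα T (P R x) (y - P R y)
  have h2 := norm_contract_siteProj_right_le hα T (x - P R x) (P R y)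
  change ‖contract T (P T (P R x)) (y - P R y)‖ ≤ ‖P T (P R x)‖ * ‖P T (y - P R y)‖ at h1
  change ‖contract T (x - P R x) (P T (P R y))‖ ≤ ‖P T (x - P R x)‖ * ‖P T (P R y)‖ at h2
  rw [map_sub, hP.apply_of_subset hT, hP.apply_of_subset hT] at h1 h2
  have nx := (hP.norm_le R x).trans_eq hx
  have ny := (hP.norm_le R y).trans_eq hy
  have kx := hP.norm_sq_add hT x
  have ky := hP.norm_sq_add hT y
  have h3 := norm_contract_le T (x - P R x) (y - P R y)
  set a := ‖P T x - P R x‖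
  set b := ‖P T y - P R y‖
  have ha : 0 ≤ a := norm_nonneg _
  have hb : 0 ≤ b := norm_nonneg _
  have hab : a + b ≤ 2 * k := by
    refine (sq_le_sq₀ (by positivity) (by positivity)).1 ?_
    nlinarith [sq_nonneg (a - b)]
  rw [e]
  refine (norm_add_le _ _).trans ?_
  have h4 := norm_add_le (contract T (P R x) (y - P R y)) (contract T (x - P R x) (P R y))
  nlinarith [norm_nonneg (P R x), norm_nonneg (P R y)]

theorem mul_add_mul_le_two_mul_sqrt {pu pw tu tw n m eu ew k : ℝ} (hk : 0 ≤ k) (htu0 : 0 ≤ tu)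
    (htw0 : 0 ≤ tw) (htu1 : tu ≤ 1) (htw1 : tw ≤ 1) (hn : 0 ≤ n) (hm : 0 ≤ m)
    (b1 : n ≤ tu + 2 * k) (b2 : m ≤ tw + 2 * k) (hu : pu ^ 2 + tu ^ 2 = 2 * eu)
    (hw : pw ^ 2 + tw ^ 2 = 2 * ew) :
    pu * pw + n * m ≤ 2 * √(eu * ew) + 4 * k + 4 * k ^ 2 := by
  have hcs : pu * pw + tu * tw ≤ 2 * √(eu * ew) := by
    have h : (pu * pw + tu * tw) / 2 ≤ √(eu * ew) := by
      refine Real.le_sqrt_of_sq_le ?_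
      have e : eu * ew = (pu ^ 2 + tu ^ 2) * (pw ^ 2 + tw ^ 2) / 4 := by rw [hu, hw]; ring
      rw [e]
      nlinarith [sq_nonneg (pu * tw - tu * pw)]
    linarith
  have hb := mul_le_mul b1 b2 hm (by positivity)
  nlinarith [mul_nonneg hk (sub_nonneg.2 htu1), mul_nonneg hk (sub_nonneg.2 htw1)]

/-- Comparison of `⟨x ⊗ v, (1 - F_T) (z ⊗ y)⟩` with the distances of the pairs `(x, y)` and
`(z, v)` from the product states `α` and `γ` on `R`. -/
theorem norm_inner_mul_inner_sub_swapForm_le {γ : ι → D → ℂ} (hα : IsUnitFamily α)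
    (hγ : IsUnitFamily γ) {T A R : Finset ι} (hT : T ⊆ A) (hA : A ⊆ R) {x y z v : Hil ι D κ}
    {δ k : ℝ} (hk : 0 ≤ k) (hx : ‖x‖ = 1) (hy : ‖y‖ = 1) (hz : ‖z‖ = 1) (hv : ‖v‖ = 1)
    (hκ : ‖siteProj α T x‖ ^ 2 - ‖siteProj α R x‖ ^ 2 +
      (‖siteProj α T y‖ ^ 2 - ‖siteProj α R y‖ ^ 2) ≤ 2 * k ^ 2)
    (hκ' : ‖siteProj γ T z‖ ^ 2 - ‖siteProj γ R z‖ ^ 2 +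
      (‖siteProj γ T v‖ ^ 2 - ‖siteProj γ R v‖ ^ 2) ≤ 2 * k ^ 2)
    (hδz : gain (siteProj α) R A z ≤ δ) (hδv : gain (siteProj α) R A v ≤ δ)
    (hδz0 : gain (siteProj α) R A (siteProj γ R z) ≤ δ)
    (hδv0 : gain (siteProj α) R A (siteProj γ R v) ≤ δ)
    (hδx : gain (siteProj γ) R A x ≤ δ) (hδy : gain (siteProj γ) R A y ≤ δ) :
    ‖inner ℂ x z * inner ℂ v y - swapForm T x y z v‖ ≤
      2 * √((1 - (‖siteProj α R x‖ ^ 2 + ‖siteProj α R y‖ ^ 2) / 2) *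
        (1 - (‖siteProj γ R z‖ ^ 2 + ‖siteProj γ R v‖ ^ 2) / 2)) + 4 * k + 4 * k ^ 2 + 3 * δ := by
  have hP : IsProjFamily (siteProj (κ := κ) α) := isProjFamily_siteProj hα
  have hP' : IsProjFamily (siteProj (κ := κ) γ) := isProjFamily_siteProj hγ
  have key := inner_sub_inner_le (a := contract ∅ x y)
    (a0 := contract ∅ (siteProj α R x) (siteProj α R y)) (b := contract ∅ z v)
    (b0 := contract ∅ (siteProj γ R z) (siteProj γ R v)) (n := contract T x y)
    (n0 := contract T (siteProj α R x) (siteProj α R y)) (m := contract T z v)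
    (m0 := contract T (siteProj γ R z) (siteProj γ R v)) (δ := δ)
    (by
      rw [swapForm_empty_contract, ← swapForm_eq_inner, norm_sub_rev]
      exact norm_swapForm_siteProj_sub_le_of_gain_le hα hT hA hx.le hy.le hδz hδv)
    (by
      rw [← inner_conj_symm, ← inner_conj_symm (contract T _ _), ← map_sub, RCLike.norm_conj,
        swapForm_empty_contract, ← swapForm_eq_inner, norm_sub_rev]
      exact norm_swapForm_siteProj_sub_le_of_gain_le hγ hT hA hz.le hv.le hδx hδy)
    (by
      rw [swapForm_empty_contract, ← swapForm_eq_inner, norm_sub_rev]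
      exact norm_swapForm_siteProj_sub_le_of_gain_le hα hT hA hx.le hy.le hδz0 hδv0)
  rw [swapForm_empty_contract, ← swapForm_eq_inner] at key
  refine key.trans ?_
  have a1 := norm_contract_empty_sub_sq hα R hx hy
  have a2 := norm_contract_empty_sub_sq hγ R hz hv
  have b1 := norm_contract_sub_le hα (hT.trans hA) hk hx hy hκ
  have b2 := norm_contract_sub_le hγ (hT.trans hA) hk hz hv hκ'
  have sx := hP.norm_sq_add_self R x
  have sy := hP.norm_sq_add_self R y
  have sz := hP'.norm_sq_add_self R z
  have sv := hP'.norm_sq_add_self R v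
  rw [hx] at sx
  rw [hy] at sy
  rw [hz] at sz
  rw [hv] at sv
  have tx := hP.norm_sub_le R x
  have ty := hP.norm_sub_le R y
  have tz := hP'.norm_sub_le R z
  have tv := hP'.norm_sub_le R v
  rw [hx] at tx
  rw [hy] at ty
  rw [hz] at tz
  rw [hv] at tv
  set pu := ‖contract ∅ x y - contract ∅ (siteProj α R x) (siteProj α R y)‖
  set pw := ‖contract ∅ z v - contract ∅ (siteProj γ R z) (siteProj γ R v)‖
  set tu := ‖x - siteProj α R x‖ * ‖y - siteProj α R y‖ with htu
  set tw := ‖z - siteProj γ R z‖ * ‖v - siteProj γ R v‖ with htw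
  have htu0 : 0 ≤ tu := by positivity
  have htw0 : 0 ≤ tw := by positivity
  have htu1 : tu ≤ 1 := mul_le_one₀ tx (norm_nonneg _) ty
  have htw1 : tw ≤ 1 := mul_le_one₀ tz (norm_nonneg _) tv
  set eu := 1 - (‖siteProj α R x‖ ^ 2 + ‖siteProj α R y‖ ^ 2) / 2 with heu
  set ew := 1 - (‖siteProj γ R z‖ ^ 2 + ‖siteProj γ R v‖ ^ 2) / 2 with hew
  have hu : pu ^ 2 + tu ^ 2 = 2 * eu := by
    rw [a1, htu, mul_pow, heu, show ‖x - siteProj α R x‖ ^ 2 = 1 - ‖siteProj α R x‖ ^ 2 by linarith,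
      show ‖y - siteProj α R y‖ ^ 2 = 1 - ‖siteProj α R y‖ ^ 2 by linarith]
    ring
  have hw : pw ^ 2 + tw ^ 2 = 2 * ew := by
    rw [a2, htw, mul_pow, hew, show ‖z - siteProj γ R z‖ ^ 2 = 1 - ‖siteProj γ R z‖ ^ 2 by linarith,
      show ‖v - siteProj γ R v‖ ^ 2 = 1 - ‖siteProj γ R v‖ ^ 2 by linarith]
    ring
  have := mul_add_mul_le_two_mul_sqrt hk htu0 htw0 htu1 htw1 (norm_nonneg _) (norm_nonneg _) b1 b2
    hu hw
  linarith

end ProductState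

/-! ### The symmetrised weight of a vector far from product states -/

section SymWeight

variable {ι D κ : Type*} [Fintype ι] [DecidableEq ι] [Fintype D] [DecidableEq D] [Fintype κ]
  [DecidableEq κ]

/-- The family of local operators that is `M` at the site `i` and trivial elsewhere. -/
abbrev atSite (i : ι) (M : Matrix D D ℂ) : ι → Matrix D D ℂ := Function.update (fun _ => 1) i M

theorem atSite_mul (i : ι) (M N : Matrix D D ℂ) :
    (fun j => atSite i M j * atSite i N j) = atSite i (M * N) := by
  funext j
  by_cases h : j = i
  · subst h; simp
  · simp [h]

theorem atSite_conjTranspose (i : ι) (M : Matrix D D ℂ) :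
    (fun j => (atSite i M j).conjTranspose) = atSite i M.conjTranspose := by
  funext j
  by_cases h : j = i
  · subst h; simp
  · simp [h]

/-- The operator `M` acting on the site `i`, as a linear function of `M`. -/
def siteOp (i : ι) : Matrix D D ℂ →ₗ[ℂ] Hil ι D κ →L[ℂ] Hil ι D κ where
  toFun M := prodOp (atSite i M)
  map_add' M N := by
    ext x a
    simp only [prodOp_apply, add_apply, PiLp.add_apply, ← Finset.sum_add_distrib, ← add_mul]
    refine Finset.sum_congr rfl fun c _ => ?_
    simp only [← Finset.mul_prod_erase _ _ (Finset.mem_univ i), Function.update_self,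
      Matrix.add_apply]
    rw [add_mul]
    congr 2 <;> congr 1 <;> refine Finset.prod_congr rfl fun j hj => ?_ <;>
      simp [Finset.ne_of_mem_erase hj]
  map_smul' r M := by
    ext x a
    simp only [prodOp_apply, smul_apply, PiLp.smul_apply, Finset.smul_sum, RingHom.id_apply]
    refine Finset.sum_congr rfl fun c _ => ?_
    simp only [← Finset.mul_prod_erase _ _ (Finset.mem_univ i), Function.update_self,
      Matrix.smul_apply, smul_eq_mul, mul_assoc]
    congr 3
    refine Finset.prod_congr rfl fun j hj => ?_
    simp [Finset.ne_of_mem_erase hj]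

theorem siteOp_def (i : ι) (M : Matrix D D ℂ) (x : Hil ι D κ) :
    siteOp i M x = prodOp (atSite i M) x := rfl

theorem siteOp_siteOp (i : ι) (M N : Matrix D D ℂ) (x : Hil ι D κ) :
    siteOp i M (siteOp i N x) = siteOp i (M * N) x := by
  rw [siteOp_def, siteOp_def, prodOp_prodOp, atSite_mul, siteOp_def]

theorem siteOp_one (i : ι) (x : Hil ι D κ) : siteOp i (1 : Matrix D D ℂ) x = x := by
  rw [siteOp_def, atSite, Function.update_eq_self i (fun _ : ι => (1 : Matrix D D ℂ)), prodOp_one]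
  rfl

theorem inner_siteOp (i : ι) (M : Matrix D D ℂ) (x y : Hil ι D κ) :
    inner ℂ (siteOp i M x) y = inner ℂ x (siteOp i M.conjTranspose y) := by
  rw [siteOp_def, inner_prodOp, atSite_conjTranspose, siteOp_def]

theorem exists_diagonalizing_basis {ρ : Matrix D D ℂ} (hρ : ρ.IsHermitian) :
    ∃ e : D → D → ℂ, (∀ a b, star (e a) ⬝ᵥ e b = if a = b then 1 else 0) ∧
      ∑ a, ketBra (e a) (e a) = 1 ∧ ∀ a b, a ≠ b → star (e a) ⬝ᵥ (ρ.mulVec (e b)) = 0 := by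
  have h1 : ∀ a b, star ((hρ.eigenvectorBasis a).ofLp) ⬝ᵥ (hρ.eigenvectorBasis b).ofLp =
      if a = b then (1 : ℂ) else 0 := fun a b => by
    rw [← orthonormal_iff_ite.1 hρ.eigenvectorBasis.orthonormal a b,
      EuclideanSpace.inner_eq_star_dotProduct, dotProduct_comm]
  refine ⟨fun a => (hρ.eigenvectorBasis a).ofLp, h1, ?_, fun a b hab => ?_⟩
  · have h := Unitary.coe_mul_star_self hρ.eigenvectorUnitary
    rw [← h]
    ext x y
    simp [Matrix.sum_apply, ketBra, Matrix.vecMulVec_apply, Matrix.mul_apply,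
      Matrix.IsHermitian.eigenvectorUnitary_apply]
  · rw [hρ.mulVec_eigenvectorBasis, dotProduct_smul, h1, if_neg hab, smul_zero]

/-- There is a basis at the site `i` in which the reduced state of `ψ` is diagonal. -/
theorem exists_schmidt_basis (i : ι) (ψ : Hil ι D κ) :
    ∃ e : D → D → ℂ, (∀ a b, star (e a) ⬝ᵥ e b = if a = b then 1 else 0) ∧
      ∑ a, ketBra (e a) (e a) = 1 ∧
      ∀ a b, a ≠ b → inner ℂ ψ (siteOp i (ketBra (e a) (e b)) ψ) = 0 := by
  let ρ : Matrix D D ℂ := Matrix.of fun y x => inner ℂ ψ (siteOp i (Matrix.single x y 1) ψ)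
  have hρ : ρ.IsHermitian := by
    ext y x
    simp only [ρ, Matrix.conjTranspose_apply, Matrix.of_apply]
    rw [RCLike.star_def, inner_conj_symm, inner_siteOp, Matrix.conjTranspose_single, star_one]
  obtain ⟨e, h1, h2, h3⟩ := exists_diagonalizing_basis hρ
  refine ⟨e, h1, h2, fun a b hab => ?_⟩
  rw [← h3 b a hab.symm]
  have e1 : ketBra (e a) (e b) =
      ∑ x, ∑ y, (e a x * star (e b y)) • Matrix.single x y (1 : ℂ) := by
    rw [Matrix.matrix_eq_sum_single (ketBra (e a) (e b))]
    simp [ketBra, Matrix.vecMulVec_apply, Matrix.smul_single]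
  rw [e1]
  simp only [map_sum, map_smul, sum_apply, smul_apply, inner_sum, inner_smul_right, ρ,
    dotProduct, Matrix.mulVec, Finset.mul_sum, Matrix.of_apply, Pi.star_apply]
  rw [Finset.sum_comm]
  exact Finset.sum_congr rfl fun x _ => Finset.sum_congr rfl fun y _ => by ring

theorem siteProj_siteOp {A : Finset ι} {i : ι} (hi : i ∉ A) (γ : ι → D → ℂ) (a : D → ℂ)
    (ψ : Hil ι D κ) :
    siteProj γ A (siteOp i (ketBra a a) ψ) =
      siteProj (Function.update γ i a) (insert i A) ψ := by
  rw [siteProj, siteOp_def, prodOp_prodOp, siteProj]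
  congr 2
  funext j
  by_cases h : j = i
  · subst h; simp [hi]
  · by_cases h' : j ∈ A <;> simp [h, h']

/-- The commutation of a local operator on both copies with a symmetrisation elsewhere. -/
theorem symProj_pairOp_atSite {A : Finset ι} {i : ι} (hi : i ∉ A) (M N : Matrix D D ℂ)
    (w : Hil₂ ι D κ) :
    symProj A (pairOp (atSite i M) (atSite i N) w) =
      pairOp (atSite i M) (atSite i N) (symProj A w) := by
  rw [symProj_apply, symProj_apply]
  have hmap : ∀ (L : Hil₂ ι D κ →L[ℂ] Hil₂ ι D κ) (f : Finset ι → Hil₂ ι D κ),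
      L (subsetAvg (1 / 2) A f) = subsetAvg (1 / 2) A fun T => L (f T) := fun L f => by
    simp only [subsetAvg, map_sum, ContinuousLinearMap.map_smul_of_tower]
  rw [hmap]
  refine subsetAvg_congr fun T hT => ?_
  rw [swapOp_pairOp]
  have h : ∀ M N : Matrix D D ℂ, (fun j => if j ∈ T then atSite i N j else atSite i M j) =
      atSite i M := fun M N => by
    funext j
    by_cases h : j = i
    · subst h; simp [show j ∉ T from fun h => hi (hT h)]
    · simp [h]
  rw [h, h]

theorem swapOp_pairOp_atSite (i : ι) (M N : Matrix D D ℂ) (w : Hil₂ ι D κ) :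
    swapOp {i} (pairOp (atSite i M) (atSite i N) w) =
      pairOp (atSite i N) (atSite i M) (swapOp {i} w) := by
  rw [swapOp_pairOp]
  have h : ∀ M N : Matrix D D ℂ, (fun j => if j ∈ ({i} : Finset ι) then atSite i N j
      else atSite i M j) = atSite i N := fun M N => by
    funext j
    by_cases h : j = i
    · subst h; simp
    · simp [h]
  rw [h, h]

theorem swapOp_tens_ketBra (i : ι) (a b : D → ℂ) (x y : Hil ι D κ) :
    swapOp {i} (tens (siteOp i (ketBra b b) x) (siteOp i (ketBra a a) y)) =
      tens (siteOp i (ketBra a b) x) (siteOp i (ketBra b a) y) := by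
  refine swapOp_tens_prodOp {i} _ _ _ _ (fun j hj p q c e => ?_) (fun j hj p q c e => ?_) x y
  · obtain rfl := Finset.mem_singleton.1 hj
    simp [ketBra, Matrix.vecMulVec_apply]
    ring
  · have : j ≠ i := fun h => hj (Finset.mem_singleton.2 h)
    simp [this]

theorem norm_symProj_sq (A : Finset ι) (w : Hil₂ ι D κ) :
    ‖symProj A w‖ ^ 2 = (inner ℂ w (symProj A w)).re := by
  rw [isProjFamily_symProj.inner_apply_self, ← Complex.ofReal_pow, Complex.ofReal_re]

/-- The bound `‖P (v + G v)‖² ≤ ‖v + G v‖²` for the projection `P = symProj A` and the involution `G`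
that exchanges the two copies and then swaps the site `i`, which commutes with `P`. -/
theorem re_inner_symProj_add_le (A : Finset ι) (i : ι) (v : Hil₂ ι D κ) :
    (inner ℂ v (symProj A v)).re + (inner ℂ v (swapOp {i} (symProj A (flipAll v)))).re ≤
      ‖v‖ ^ 2 + (inner ℂ v (swapOp {i} (flipAll v))).re := by
  set g := swapOp {i} (flipAll v) with hg
  have hS : swapOp {i} (symProj A (flipAll v)) = symProj A g := by rw [hg, symProj_swapOp]
  have hgn : ‖g‖ = ‖v‖ := by rw [hg, LinearIsometryEquiv.norm_map, LinearIsometryEquiv.norm_map]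
  have hgg : (inner ℂ g (symProj A g)).re = (inner ℂ v (symProj A v)).re := by
    rw [← norm_symProj_sq, ← norm_symProj_sq, hg, symProj_swapOp, symProj_flipAll,
      LinearIsometryEquiv.norm_map, LinearIsometryEquiv.norm_map]
  have hgv : (inner ℂ g (symProj A v)).re = (inner ℂ v (symProj A g)).re := by
    rw [← isProjFamily_symProj.symm, ← inner_conj_symm, Complex.conj_re]
  have h1 := isProjFamily_symProj.norm_le A (v + g)
  have h2 : ‖symProj A (v + g)‖ ^ 2 =
      2 * ((inner ℂ v (symProj A v)).re + (inner ℂ v (symProj A g)).re) := by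
    rw [norm_symProj_sq, map_add, inner_add_left, inner_add_right, inner_add_right]
    simp only [Complex.add_re, hgg, hgv]
    ring
  have h3 := norm_add_sq (𝕜 := ℂ) v g
  have h3' : RCLike.re (inner ℂ v g) = (inner ℂ v g).re := rfl
  rw [hgn, h3'] at h3
  rw [hS]
  nlinarith [norm_nonneg (symProj A (v + g)), norm_nonneg (v + g)]

/-- The symmetrised weight of `ψ ⊗ ψ` is controlled by the largest overlap of `ψ` with a product
state. The sites are added one at a time, in a basis that diagonalises the reduced state of `ψ`. -/
theorem norm_symProj_tens_sq_le [Nonempty D] (A : Finset ι) (ψ : Hil ι D κ) (ω : ℝ)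
    (h : ∀ γ, IsUnitFamily γ → ‖siteProj γ A ψ‖ ^ 2 ≤ ω) :
    ‖symProj A (tens ψ ψ)‖ ^ 2 ≤ ‖ψ‖ ^ 2 * (‖ψ‖ ^ 2 + ω) / 2 := by
  induction A using Finset.induction_on generalizing ψ with
  | empty =>
    have h1 := h (fun _ => Pi.single (Classical.arbitrary D) 1) fun i => by simp
    rw [siteProj] at h1
    simp only [Finset.notMem_empty, if_false, prodOp_one, one_apply_eq_self] at h1
    rw [isProjFamily_symProj.empty, one_apply_eq_self, norm_tens]
    nlinarith [sq_nonneg ‖ψ‖]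
  | insert i A hi ih =>
    obtain ⟨e, he, he1, hsch⟩ := exists_schmidt_basis i ψ
    set q : D → Matrix D D ℂ := fun a => ketBra (e a) (e a) with hq
    set f : D → Hil ι D κ := fun a => siteOp i (q a) ψ with hf
    have hqq : ∀ a, q a * q a = q a := fun a => by
      rw [hq, ketBra_mul_ketBra, he]; simp
    have hqh : ∀ a, (q a).conjTranspose = q a := fun a => conjTranspose_ketBra _ _
    have hsum : ψ = ∑ a, f a := by
      rw [hf, ← sum_apply, ← map_sum, he1, siteOp_one]
    have hnorm : ‖ψ‖ ^ 2 = ∑ a, ‖f a‖ ^ 2 := by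
      have h1 : ∀ a, ‖f a‖ ^ 2 = (inner ℂ ψ (f a)).re := fun a => by
        have : inner ℂ ψ (f a) = inner ℂ (f a) (f a) := by
          rw [hf, inner_siteOp, siteOp_siteOp, hqh, hqq]
        rw [this, inner_self_eq_norm_sq_to_K]
        norm_cast
      simp only [h1]
      rw [← Complex.re_sum, ← inner_sum, ← hsum, inner_self_eq_norm_sq_to_K]
      norm_cast
    set Ψ := tens ψ ψ with hΨ
    have hpair : ∀ a b, pairOp (atSite i (q a)) (atSite i (q b)) Ψ = tens (f a) (f b) :=
      fun a b => pairOp_tens _ _ _ _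
    have hΨsum : Ψ = ∑ a, ∑ b, tens (f a) (f b) := by
      rw [← tens_sum, ← hsum]
    have hidem : ∀ a b, pairOp (atSite i (q a)) (atSite i (q b)) (tens (f a) (f b)) =
        tens (f a) (f b) := fun a b => by
      rw [pairOp_tens]
      change tens (siteOp i (q a) (siteOp i (q a) ψ)) (siteOp i (q b) (siteOp i (q b) ψ)) = _
      rw [siteOp_siteOp, siteOp_siteOp, hqq, hqq]
    have hadj : ∀ a b w, inner ℂ Ψ (pairOp (atSite i (q a)) (atSite i (q b)) w) =
        inner ℂ (tens (f a) (f b)) w := fun a b w => by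
      rw [← hpair, inner_pairOp, atSite_conjTranspose, atSite_conjTranspose, hqh, hqh]
    have e1 : inner ℂ Ψ (symProj A Ψ) =
        ∑ a, ∑ b, inner ℂ (tens (f a) (f b)) (symProj A (tens (f a) (f b))) := by
      conv_lhs => rw [hΨsum, map_sum, inner_sum]
      refine Finset.sum_congr rfl fun a _ => ?_
      rw [map_sum, inner_sum]
      refine Finset.sum_congr rfl fun b _ => ?_
      rw [← hΨsum, ← hadj, ← symProj_pairOp_atSite hi, hidem]
    have e2 : inner ℂ Ψ (swapOp {i} (symProj A Ψ)) =
        ∑ a, ∑ b, inner ℂ (tens (f a) (f b)) (swapOp {i} (symProj A (tens (f b) (f a)))) := by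
      conv_lhs => rw [hΨsum, map_sum, map_sum, inner_sum, ← hΨsum]
      rw [Finset.sum_comm]
      refine Finset.sum_congr rfl fun a _ => ?_
      rw [map_sum, map_sum, inner_sum]
      refine Finset.sum_congr rfl fun b _ => ?_
      rw [← hadj, ← swapOp_pairOp_atSite, ← symProj_pairOp_atSite hi, hidem]
    -- For `a ≠ b` the overlap vanishes by the choice of basis; for `a = b` the induction hypothesis
    -- applies to `f a`.
    have hterm : ∀ a b, (inner ℂ (tens (f a) (f b)) (symProj A (tens (f a) (f b)))).re +
        (inner ℂ (tens (f a) (f b)) (swapOp {i} (symProj A (tens (f b) (f a))))).re ≤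
        ‖f a‖ ^ 2 * ‖f b‖ ^ 2 + if a = b then ω * ‖f a‖ ^ 2 else 0 := by
      intro a b
      by_cases hab : a = b
      · subst hab
        have hfix : swapOp {i} (tens (f a) (f a)) = tens (f a) (f a) :=
          swapOp_tens_ketBra i (e a) (e a) ψ ψ
        have hih := ih (f a) fun γ hγ => by
          rw [hf, siteProj_siteOp hi]
          refine h _ fun j => ?_
          by_cases hj : j = i
          · subst hj; simp [he]
          · simp [hj, hγ j]
        rw [← inner_swapOp, hfix, ← norm_symProj_sq, if_pos rfl]
        nlinarith
      · rw [if_neg hab, add_zero, ← flipAll_tens (f a) (f b)]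
        refine (re_inner_symProj_add_le A i _).trans_eq ?_
        rw [flipAll_tens, norm_tens, hf, swapOp_tens_ketBra, inner_tens, inner_siteOp, hqh,
          siteOp_siteOp, ketBra_mul_ketBra, he, if_pos rfl, one_smul, hsch a b hab]
        simp [mul_pow]
    have hfin : 2 * ‖symProj (insert i A) Ψ‖ ^ 2 =
        (inner ℂ Ψ (symProj A Ψ)).re + (inner ℂ Ψ (swapOp {i} (symProj A Ψ))).re := by
      rw [norm_symProj_sq, symProj_insert hi, inner_smul_right_eq_smul, inner_add_right]
      simp
      ring
    have hbound : 2 * ‖symProj (insert i A) Ψ‖ ^ 2 ≤ ‖ψ‖ ^ 2 * (‖ψ‖ ^ 2 + ω) := by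
      rw [hfin, e1, e2]
      simp only [Complex.re_sum, ← Finset.sum_add_distrib]
      refine (Finset.sum_le_sum fun a _ => Finset.sum_le_sum fun b _ => hterm a b).trans_eq ?_
      simp only [Finset.sum_add_distrib, Finset.sum_ite_eq, Finset.mem_univ, if_true,
        ← Finset.mul_sum, ← Finset.sum_mul, ← hnorm]
      ring
    linarith

end SymWeight

/-! ### Pairs of vectors and their largest overlap with product states -/

section Pair

variable {ι D κ : Type*} [Fintype ι] [DecidableEq ι] [Fintype D] [DecidableEq D] [Fintype κ]
  [DecidableEq κ]

/-- The vector `(x ⊗ |1⟩ + y ⊗ |0⟩) / √2` with an additional register qubit. -/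
def pairVec (x y : Hil ι D κ) : Hil ι D (κ × Bool) :=
  WithLp.toLp 2 fun a => ((√2)⁻¹ : ℝ) * bif a.2.2 then x (a.1, a.2.1) else y (a.1, a.2.1)

theorem norm_pairVec_sq (x y : Hil ι D κ) :
    ‖pairVec x y‖ ^ 2 = (‖x‖ ^ 2 + ‖y‖ ^ 2) / 2 := by
  have h2 : ((√2)⁻¹ : ℝ) ^ 2 = 1 / 2 := by rw [inv_pow, Real.sq_sqrt (by norm_num)]; norm_num
  simp only [EuclideanSpace.norm_sq_eq, pairVec, Fintype.sum_prod_type, Fintype.sum_bool, norm_mul,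
    mul_pow, Complex.norm_real, Real.norm_eq_abs, sq_abs, h2, cond_true, cond_false,
    Finset.sum_add_distrib, ← Finset.mul_sum]
  ring

theorem prodOp_pairVec (A : ι → Matrix D D ℂ) (x y : Hil ι D κ) :
    prodOp A (pairVec x y) = pairVec (prodOp A x) (prodOp A y) := by
  ext ⟨a, k, r⟩
  cases r <;> simp only [prodOp_apply, pairVec, cond_true, cond_false, Finset.mul_sum] <;>
    exact Finset.sum_congr rfl fun c _ => by ring

theorem norm_siteProj_pairVec_sq (γ : ι → D → ℂ) (T : Finset ι) (x y : Hil ι D κ) :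
    ‖siteProj γ T (pairVec x y)‖ ^ 2 = (‖siteProj γ T x‖ ^ 2 + ‖siteProj γ T y‖ ^ 2) / 2 := by
  rw [siteProj, prodOp_pairVec, norm_pairVec_sq]; rfl

theorem norm_contract_comm (T : Finset ι) (x y : Hil ι D κ) :
    ‖contract T y x‖ ^ 2 = ‖contract T x y‖ ^ 2 := by
  simp only [EuclideanSpace.norm_sq_eq]
  rw [← Equiv.sum_comp (Equiv.prodComm _ _)]
  refine Finset.sum_congr rfl fun t _ => ?_
  rw [← RCLike.norm_conj]
  simp [contract, map_sum, mul_comm]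

theorem norm_contract_le_pairVec (T : Finset ι) (x y : Hil ι D κ) :
    ‖contract T x y‖ ^ 2 ≤ ‖contract T (pairVec x y) (pairVec x y)‖ ^ 2 := by
  have h2 : ((√2)⁻¹ : ℝ) * ((√2)⁻¹ : ℝ) = 1 / 2 := by
    rw [← mul_inv, Real.mul_self_sqrt (by norm_num)]; norm_num
  have hc : ∀ t k r t' k' r', ‖contract T (pairVec x y) (pairVec x y) ((t, k, r), (t', k', r'))‖ ^ 2
      = ‖contract T (bif r then x else y) (bif r' then x else y) ((t, k), (t', k'))‖ ^ 2 / 4 := by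
    intro t k r t' k' r'
    have e : contract T (pairVec x y) (pairVec x y) ((t, k, r), (t', k', r')) =
        ((1 / 2 : ℝ) : ℂ) *
          contract T (bif r then x else y) (bif r' then x else y) ((t, k), (t', k')) := by
      simp only [contract, pairVec, glue, Finset.mul_sum, map_mul, Complex.conj_ofReal]
      refine Finset.sum_congr rfl fun s _ => ?_
      rw [← h2]
      push_cast
      cases r <;> cases r' <;> simp only [cond_true, cond_false] <;> ring
    rw [e, norm_mul, mul_pow]
    norm_num
    ring
  have hsum : ‖contract T (pairVec x y) (pairVec x y)‖ ^ 2 =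
      (‖contract T x x‖ ^ 2 + ‖contract T x y‖ ^ 2 + ‖contract T y x‖ ^ 2 +
        ‖contract T y y‖ ^ 2) / 4 := by
    simp only [EuclideanSpace.norm_sq_eq, Fintype.sum_prod_type, Fintype.sum_bool, hc, cond_true,
      cond_false, Finset.sum_add_distrib, ← Finset.sum_div]
    ring
  have h := two_mul_norm_contract_sq_le T x y
  rw [hsum, norm_contract_comm T x y]
  linarith

theorem norm_symProj_tens_sq (A : Finset ι) (x y : Hil ι D κ) :
    ‖symProj A (tens x y)‖ ^ 2 = subsetAvg (1 / 2) A fun T => ‖contract T x y‖ ^ 2 := by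
  rw [norm_symProj_sq, inner_symProj]
  refine (subsetAvg_map Complex.reLm _ _ _).symm.trans (subsetAvg_congr fun T _ => ?_)
  have h := norm_contract_sq T x y
  rw [swapForm] at h
  rw [h, ← Complex.ofReal_pow]
  rfl

theorem norm_symProj_tens_le_pairVec (A : Finset ι) (x y : Hil ι D κ) :
    ‖symProj A (tens x y)‖ ^ 2 ≤ ‖symProj A (tens (pairVec x y) (pairVec x y))‖ ^ 2 := by
  rw [norm_symProj_tens_sq, norm_symProj_tens_sq]
  exact subsetAvg_mono (by norm_num) (by norm_num) fun T _ => norm_contract_le_pairVec T x y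

/-- The largest weight of `ψ` in a product state on the sites in `T`. -/
def maxOverlap (ψ : Hil ι D κ) (T : Finset ι) : ℝ :=
  ⨆ γ : {γ : ι → D → ℂ // IsUnitFamily γ}, ‖siteProj γ.1 T ψ‖ ^ 2

theorem norm_siteProj_sq_le {γ : ι → D → ℂ} (hγ : IsUnitFamily γ) (ψ : Hil ι D κ) (T : Finset ι) :
    ‖siteProj γ T ψ‖ ^ 2 ≤ ‖ψ‖ ^ 2 := by
  have := (isProjFamily_siteProj (κ := κ) hγ).norm_le T ψ
  gcongr

theorem le_maxOverlap {γ : ι → D → ℂ} (hγ : IsUnitFamily γ) (ψ : Hil ι D κ) (T : Finset ι) :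
    ‖siteProj γ T ψ‖ ^ 2 ≤ maxOverlap ψ T :=
  le_ciSup (f := fun γ : {γ : ι → D → ℂ // IsUnitFamily γ} => ‖siteProj γ.1 T ψ‖ ^ 2)
    ⟨‖ψ‖ ^ 2, by rintro _ ⟨γ, rfl⟩; exact norm_siteProj_sq_le γ.2 ψ T⟩ ⟨γ, hγ⟩

theorem exists_isUnitFamily [Nonempty D] : ∃ γ : ι → D → ℂ, IsUnitFamily γ :=
  ⟨fun _ => Pi.single (Classical.arbitrary D) 1, fun i => by simp⟩

theorem maxOverlap_nonneg (ψ : Hil ι D κ) (T : Finset ι) : 0 ≤ maxOverlap ψ T :=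
  Real.iSup_nonneg fun _ => by positivity

theorem maxOverlap_le [Nonempty D] (ψ : Hil ι D κ) (T : Finset ι) : maxOverlap ψ T ≤ ‖ψ‖ ^ 2 := by
  obtain ⟨γ, hγ⟩ := exists_isUnitFamily (ι := ι) (D := D)
  have : Nonempty {γ : ι → D → ℂ // IsUnitFamily γ} := ⟨⟨γ, hγ⟩⟩
  exact ciSup_le fun γ => norm_siteProj_sq_le γ.2 ψ T

theorem maxOverlap_anti [Nonempty D] (ψ : Hil ι D κ) {S T : Finset ι} (h : S ⊆ T) :
    maxOverlap ψ T ≤ maxOverlap ψ S := by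
  obtain ⟨γ, hγ⟩ := exists_isUnitFamily (ι := ι) (D := D)
  have : Nonempty {γ : ι → D → ℂ // IsUnitFamily γ} := ⟨⟨γ, hγ⟩⟩
  refine ciSup_le fun γ => le_trans ?_ (le_maxOverlap γ.2 ψ S)
  have := (isProjFamily_siteProj (κ := κ) γ.2).norm_le_of_subset h ψ
  gcongr

theorem exists_near_maxOverlap [Nonempty D] (ψ : Hil ι D κ) (T : Finset ι) {ν : ℝ} (hν : 0 < ν) :
    ∃ γ, IsUnitFamily γ ∧ maxOverlap ψ T - ν ≤ ‖siteProj γ T ψ‖ ^ 2 := by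
  obtain ⟨γ, hγ⟩ := exists_isUnitFamily (ι := ι) (D := D)
  have : Nonempty {γ : ι → D → ℂ // IsUnitFamily γ} := ⟨⟨γ, hγ⟩⟩
  obtain ⟨γ, h⟩ := exists_lt_of_lt_ciSup (sub_lt_self (maxOverlap ψ T) hν)
  exact ⟨γ.1, γ.2, h.le⟩

/-- The expected deficit of the overlap of `ψ` with `γ` on `R` when only a uniformly random subset
of `A` has to be matched. -/
def deficit (ψ : Hil ι D κ) (γ : ι → D → ℂ) (R A : Finset ι) : ℝ :=
  subsetAvg (1 / 2) A fun T => maxOverlap ψ T - ‖siteProj γ R ψ‖ ^ 2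

theorem norm_siteProj_sq_le_maxOverlap {γ : ι → D → ℂ} (hγ : IsUnitFamily γ) (ψ : Hil ι D κ)
    {T R : Finset ι} (h : T ⊆ R) : ‖siteProj γ R ψ‖ ^ 2 ≤ maxOverlap ψ T := by
  refine le_trans ?_ (le_maxOverlap hγ ψ T)
  have := (isProjFamily_siteProj (κ := κ) hγ).norm_le_of_subset h ψ
  gcongr

theorem deficit_nonneg {γ : ι → D → ℂ} (hγ : IsUnitFamily γ) (ψ : Hil ι D κ) {A R : Finset ι}
    (h : A ⊆ R) : 0 ≤ deficit ψ γ R A :=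
  subsetAvg_nonneg (by norm_num) (by norm_num) fun _ hT =>
    sub_nonneg.2 (norm_siteProj_sq_le_maxOverlap hγ ψ (hT.trans h))

theorem subsetAvg_sqrt_le {A : Finset ι} {f : Finset ι → ℝ} {c : ℝ} (hc : 0 < c)
    (hf : ∀ T ⊆ A, 0 ≤ f T) (h : subsetAvg (1 / 2) A f ≤ c ^ 2) :
    subsetAvg (1 / 2) A (fun T => √(f T)) ≤ c := by
  have h1 : subsetAvg (1 / 2) A (fun T => √(f T)) ≤
      subsetAvg (1 / 2) A (fun T => (2 * c)⁻¹ • f T + c / 2) :=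
    subsetAvg_mono (by norm_num) (by norm_num) fun T hT => by
      have h2 := Real.sq_sqrt (hf T hT)
      rw [smul_eq_mul, ← sub_nonneg]
      have : (2 * c)⁻¹ * f T + c / 2 - √(f T) = (2 * c)⁻¹ * (√(f T) - c) ^ 2 := by
        field_simp
        rw [sub_sq, h2]
        ring
      rw [this]
      positivity
  rw [subsetAvg_add, subsetAvg_smul, subsetAvg_const, smul_eq_mul] at h1
  refine h1.trans ?_
  have : (2 * c)⁻¹ * subsetAvg (1 / 2) A f ≤ (2 * c)⁻¹ * c ^ 2 := by gcongr
  have e : (2 * c)⁻¹ * c ^ 2 = c / 2 := by field_simp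
  linarith

theorem subsetAvg_add_sqrt_le {A : Finset ι} {f g : Finset ι → ℝ} {c C : ℝ} (hc : 0 < c)
    (hg : ∀ T ⊆ A, 0 ≤ g T) (h : subsetAvg (1 / 2) A g ≤ c ^ 2) :
    subsetAvg (1 / 2) A (fun T => f T + C + 4 * √(g T) + 4 * √(g T) ^ 2) ≤
      subsetAvg (1 / 2) A f + C + 4 * c + 4 * c ^ 2 := by
  have h1 := subsetAvg_sqrt_le hc hg h
  have e : subsetAvg (1 / 2) A (fun T => f T + C + 4 * √(g T) + 4 * √(g T) ^ 2) =
      subsetAvg (1 / 2) A (fun T => f T + C + (4 : ℝ) • √(g T) + (4 : ℝ) • g T) :=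
    subsetAvg_congr fun T hT => by rw [Real.sq_sqrt (hg T hT)]; rfl
  rw [e, subsetAvg_add, subsetAvg_add, subsetAvg_add, subsetAvg_smul, subsetAvg_smul,
    subsetAvg_const, smul_eq_mul, smul_eq_mul]
  linarith

/-- The symmetrised weight of a unit vector `ψ` with weight `λ` in a product state that is almost
optimal and almost insensitive to the sites in `A` is at most about `λ² + min (t², t / 2)`, where
`t = 1 - λ`. -/
theorem norm_symProj_tens_sq_le_of_deficit_le [Nonempty D] {α : ι → D → ℂ} (hα : IsUnitFamily α)
    {A R : Finset ι} (hA : A ⊆ R) {ψ : Hil ι D κ} (hψ : ‖ψ‖ = 1) {c : ℝ} (hc : 0 < c) (hc1 : c ≤ 1)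
    (hδ : gain (siteProj α) R A ψ ≤ c ^ 2) (hκ : deficit ψ α R A ≤ c ^ 2) :
    ‖symProj A (tens ψ ψ)‖ ^ 2 ≤ (‖siteProj α R ψ‖ ^ 2) ^ 2 +
      min ((1 - ‖siteProj α R ψ‖ ^ 2) ^ 2) ((1 - ‖siteProj α R ψ‖ ^ 2) / 2) + 12 * c := by
  have hP : IsProjFamily (siteProj (κ := κ) α) := isProjFamily_siteProj hα
  set lam := ‖siteProj α R ψ‖ ^ 2 with hlam
  set ψ1 := ψ - siteProj α R ψ with hψ1
  have hn1 : ‖ψ1‖ ^ 2 = 1 - lam := by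
    have := hP.norm_sq_add_self R ψ
    rw [hψ] at this
    rw [hψ1, hlam]
    linarith
  have hlam0 : 0 ≤ lam := by positivity
  have ht0 : 0 ≤ 1 - lam := by rw [← hn1]; positivity
  have h1 : ‖symProj A (tens ψ ψ)‖ ^ 2 ≤
      ‖symProj A (tens ψ1 ψ1)‖ ^ 2 + (lam ^ 2 + 2 * c ^ 2) + 4 * c + 4 * c ^ 2 := by
    rw [norm_symProj_tens_sq, norm_symProj_tens_sq]
    refine le_trans (subsetAvg_mono (by norm_num) (by norm_num) fun T hT => ?_)
      (subsetAvg_add_sqrt_le hc (fun T hT => sub_nonneg.2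
        (norm_siteProj_sq_le_maxOverlap hα ψ (hT.trans hA))) hκ)
    have h0 := sub_nonneg.2 (norm_siteProj_sq_le_maxOverlap hα ψ (hT.trans hA))
    have := norm_contract_sq_le_of_gain_le hα hT hA hψ
      (Real.sqrt_nonneg (maxOverlap ψ T - ‖siteProj α R ψ‖ ^ 2)) hδ
      (by rw [Real.sq_sqrt h0]; linarith [le_maxOverlap hα ψ T])
    refine this.trans (le_of_eq ?_)
    ring
  have hov : maxOverlap ψ A ≤ lam + c ^ 2 := by
    have : subsetAvg (1 / 2) A (fun _ => maxOverlap ψ A - lam) ≤ deficit ψ α R A :=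
      subsetAvg_mono (by norm_num) (by norm_num) fun T hT =>
        sub_le_sub_right (maxOverlap_anti ψ hT) _
    rw [subsetAvg_const] at this
    linarith
  have hov1 := maxOverlap_le ψ A
  rw [hψ, one_pow] at hov1
  have h2 : ∀ γ, IsUnitFamily γ → ‖siteProj γ A ψ1‖ ^ 2 ≤ lam + 2 * c + 2 * c ^ 2 := by
    intro γ hγ
    have hP' : IsProjFamily (siteProj (κ := κ) γ) := isProjFamily_siteProj hγ
    have e : siteProj γ A ψ1 = (siteProj γ A ψ - siteProj α (R \ A) (siteProj γ A ψ)) +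
        siteProj γ A (siteProj α (R \ A) ψ - siteProj α R ψ) := by
      rw [siteProj_comm α γ Finset.sdiff_disjoint, hψ1, map_sub, map_sub]
      abel
    have n1 : ‖siteProj γ A ψ - siteProj α (R \ A) (siteProj γ A ψ)‖ ≤ √(maxOverlap ψ A) :=
      (hP.norm_sub_le _ _).trans (Real.le_sqrt_of_sq_le (le_maxOverlap hγ ψ A))
    have n2 : ‖siteProj γ A (siteProj α (R \ A) ψ - siteProj α R ψ)‖ ≤ c := by
      refine (hP'.norm_le _ _).trans ?_
      rw [hP.gain_eq] at hδ
      exact (sq_le_sq₀ (norm_nonneg _) hc.le).1 hδ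
    have n3 : ‖siteProj γ A ψ1‖ ≤ √(maxOverlap ψ A) + c := by
      rw [e]
      exact (norm_add_le _ _).trans (add_le_add n1 n2)
    have n4 := Real.sq_sqrt (maxOverlap_nonneg ψ A)
    have n5 : √(maxOverlap ψ A) ≤ 1 := Real.sqrt_le_one.2 hov1
    nlinarith [norm_nonneg (siteProj γ A ψ1), Real.sqrt_nonneg (maxOverlap ψ A)]
  have h3 := norm_symProj_tens_sq_le A ψ1 _ h2
  have h4 : ‖symProj A (tens ψ1 ψ1)‖ ^ 2 ≤ (1 - lam) ^ 2 := by
    rw [← hn1, ← pow_mul]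
    have := isProjFamily_symProj.norm_le A (tens ψ1 ψ1)
    rw [norm_tens, ← sq] at this
    calc ‖symProj A (tens ψ1 ψ1)‖ ^ 2 ≤ (‖ψ1‖ ^ 2) ^ 2 := by gcongr
      _ = _ := by ring
  rw [hn1] at h3
  have h5 : c ^ 2 ≤ c := by nlinarith
  have h6 : ‖symProj A (tens ψ1 ψ1)‖ ^ 2 ≤
      min ((1 - lam) ^ 2) ((1 - lam) / 2) + (c + c ^ 2) := by
    rcases min_cases ((1 - lam) ^ 2) ((1 - lam) / 2) with ⟨h, _⟩ | ⟨h, _⟩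
    · rw [h]; nlinarith
    · rw [h]; nlinarith
  linarith

end Pair

/-! ### The core inequality -/

section Core

/-- The constant `2.4` is what the two lower bounds on `q` and `q'` give; the worst case is
`s = 1 / 4`, `s' = 1`. -/
theorem sq_le_of_le_two_mul_sqrt {s s' b q q' : ℝ} (hs0 : 0 ≤ s) (hs1 : s ≤ 1) (hs0' : 0 ≤ s')
    (hs1' : s' ≤ 1) (hb1 : b ^ 2 ≤ 1) (hb : b ^ 2 ≤ 4 * (s * s'))
    (hq : 2 * s * (1 - s) ≤ q) (hq2 : s * (3 / 2 - s) ≤ q)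
    (hq' : 2 * s' * (1 - s') ≤ q') (hq2' : s' * (3 / 2 - s') ≤ q') :
    b ^ 2 ≤ 2.4 ^ 2 * (q * q') := by
  have mixed : ∀ {s s' q q' : ℝ}, 0 ≤ s → s ≤ 1 / 2 → 1 / 2 ≤ s' → s' ≤ 1 →
      b ^ 2 ≤ 4 * (s * s') → 2 * s * (1 - s) ≤ q → s' * (3 / 2 - s') ≤ q' →
      b ^ 2 ≤ 2.4 ^ 2 * (q * q') := by
    intro s s' q q' h0 h1 h2 h3 hb hq hq'
    have hqq : 2 * s * (1 - s) * (s' * (3 / 2 - s')) ≤ q * q' :=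
      mul_le_mul hq hq' (mul_nonneg (by linarith) (by linarith))
        ((mul_nonneg (by linarith) (by linarith)).trans hq)
    have hr : 3 / 8 * s' ≤ (s' - 1 / 4) * (3 / 2 - s') := by nlinarith
    rcases le_total (4 * (s * s')) 1 with h | h
    · have h4 : 3 / 8 * s' ≤ s' * (1 - s) * (3 / 2 - s') :=
        hr.trans (mul_le_mul_of_nonneg_right (by linarith) (by linarith))
      nlinarith [mul_nonneg h0 (sub_nonneg.2 h4)]
    · -- `s (1 - s)` increases on `[0, 1 / 2]`, and here `s ≥ 1 / (4 s')`.
      have h5 : s' - 1 / 4 ≤ 4 * s * (1 - s) * s' ^ 2 := by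
        have : 0 ≤ (4 * s * s' - 1) * (4 * s' * (1 - s) - 1) :=
          mul_nonneg (by linarith) (by nlinarith)
        nlinarith
      have h6 : 3 / 8 * s' ≤ 4 * s * (1 - s) * s' ^ 2 * (3 / 2 - s') :=
        hr.trans (mul_le_mul_of_nonneg_right h5 (by linarith))
      have h7 : 3 / 8 ≤ 4 * s * (1 - s) * s' * (3 / 2 - s') := by
        refine le_of_mul_le_mul_right ?_ (show 0 < s' by linarith)
        linarith [h6, show 4 * s * (1 - s) * s' ^ 2 * (3 / 2 - s') =
          4 * s * (1 - s) * s' * (3 / 2 - s') * s' by ring]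
      nlinarith
  rcases le_total s (1 / 2) with h | h <;> rcases le_total s' (1 / 2) with h' | h'
  · have e1 : s ≤ q := by nlinarith
    have e2 : s' ≤ q' := by nlinarith
    have := mul_le_mul e1 e2 hs0' (hs0.trans e1)
    nlinarith [mul_nonneg hs0 hs0']
  · exact mixed hs0 h h' hs1' hb hq hq2'
  · rw [mul_comm q]
    exact mixed hs0' h' h hs1 (by linarith) hq' hq2
  · have e1 : 1 / 2 ≤ q := by nlinarith
    have e2 : 1 / 2 ≤ q' := by nlinarith
    nlinarith

theorem le_add_of_approx {b s s' q q' c θ : ℝ} (hθ : 0 < θ) (hθ1 : θ ≤ 1) (hc : c = θ ^ 2 / 10000)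
    (hs0 : 0 ≤ s) (hs1 : s ≤ 1) (hs0' : 0 ≤ s') (hs1' : s' ≤ 1) (hb1 : b ≤ 1)
    (hb : b ≤ 2 * √(s * s') + 12 * c)
    (hq0 : 0 ≤ q) (hq1 : q ≤ 1) (hq0' : 0 ≤ q') (hq1' : q' ≤ 1)
    (hq : 2 * s * (1 - s) ≤ q + 12 * c) (hq2 : s * (3 / 2 - s) ≤ q + 12 * c)
    (hq' : 2 * s' * (1 - s') ≤ q' + 12 * c) (hq2' : s' * (3 / 2 - s') ≤ q' + 12 * c) :
    b ≤ 2.4 * √(q * q') + θ / 2 := by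
  have hc0 : 0 < c := by rw [hc]; positivity
  have hc1 : 12 * c ≤ θ / 100 := by rw [hc]; nlinarith
  have hr0 := Real.sqrt_nonneg (q * q')
  rcases le_total b (12 * c) with h | h
  · linarith
  have hsq := Real.sq_sqrt (mul_nonneg hs0 hs0')
  have hs := Real.sqrt_nonneg (s * s')
  have h1 := sq_le_of_le_two_mul_sqrt (b := b - 12 * c) hs0 hs1 hs0' hs1' (by nlinarith)
    (by nlinarith) hq hq2 hq' hq2'
  have hrq := Real.sq_sqrt (mul_nonneg hq0 hq0')
  have h2 : (q + 12 * c) * (q' + 12 * c) ≤ (√(q * q') + θ / 5) ^ 2 := by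
    have : 24 * c + 144 * c ^ 2 ≤ (θ / 5) ^ 2 := by
      have : c ≤ 1 := by nlinarith
      have : 144 * c ^ 2 ≤ 144 * c := by nlinarith
      rw [hc] at *
      nlinarith
    nlinarith [mul_nonneg hr0 hθ.le]
  have h3 : b - 12 * c ≤ 2.4 * (√(q * q') + θ / 5) := by
    refine (sq_le_sq₀ (by linarith) (by positivity)).1 ?_
    rw [mul_pow]
    exact h1.trans (by gcongr)
  linarith

variable {ι D κ : Type*} [Fintype ι] [DecidableEq ι] [Fintype D] [DecidableEq D] [Fintype κ]
  [DecidableEq κ]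

/-- The weight of `x ⊗ y` outside the fully symmetric subspace. -/
def asymWeight (x y : Hil ι D κ) : ℝ := (‖x‖ * ‖y‖) ^ 2 - ‖symProj Finset.univ (tens x y)‖ ^ 2

theorem asymWeight_nonneg (x y : Hil ι D κ) : 0 ≤ asymWeight x y := by
  have := isProjFamily_symProj.norm_le Finset.univ (tens x y)
  rw [norm_tens] at this
  exact sub_nonneg.2 (by gcongr)

theorem asymWeight_le_one {x y : Hil ι D κ} (hx : ‖x‖ = 1) (hy : ‖y‖ = 1) :
    asymWeight x y ≤ 1 := by
  rw [asymWeight, hx, hy]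
  linarith [sq_nonneg ‖symProj Finset.univ (tens x y)‖]

theorem le_of_one_sub_sq_sub_min_le {e q : ℝ}
    (h : 1 - (1 - e) ^ 2 - min (e ^ 2) (e / 2) ≤ q) :
    2 * e * (1 - e) ≤ q ∧ e * (3 / 2 - e) ≤ q := by
  have h1 := min_le_left (e ^ 2) (e / 2)
  have h2 := min_le_right (e ^ 2) (e / 2)
  constructor <;> nlinarith

theorem le_asymWeight [Nonempty D] {α : ι → D → ℂ} (hα : IsUnitFamily α)
    {A R : Finset ι} (hA : A ⊆ R) {x y : Hil ι D κ} (hx : ‖x‖ = 1) (hy : ‖y‖ = 1) {c : ℝ}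
    (hc : 0 < c) (hc1 : c ≤ 1) (hδ : gain (siteProj α) R A (pairVec x y) ≤ c ^ 2)
    (hκ : deficit (pairVec x y) α R A ≤ c ^ 2) :
    1 - (‖siteProj α R (pairVec x y)‖ ^ 2) ^ 2 -
      min ((1 - ‖siteProj α R (pairVec x y)‖ ^ 2) ^ 2)
        ((1 - ‖siteProj α R (pairVec x y)‖ ^ 2) / 2) ≤ asymWeight x y + 12 * c := by
  have hψ : ‖pairVec x y‖ = 1 := by
    have := norm_pairVec_sq x y
    rw [hx, hy] at this
    nlinarith [norm_nonneg (pairVec x y)]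
  have h1 := norm_symProj_tens_sq_le_of_deficit_le hα hA hψ hc hc1 hδ hκ
  have h2 := norm_symProj_tens_le_pairVec A x y
  have h3 := isProjFamily_symProj.norm_le_of_subset (Finset.subset_univ A) (tens x y)
  have h4 : ‖symProj Finset.univ (tens x y)‖ ^ 2 ≤ ‖symProj A (tens x y)‖ ^ 2 := by gcongr
  rw [asymWeight, hx, hy]
  linarith

theorem subsetAvg_swapForm (A : Finset ι) (x y z v : Hil ι D κ) :
    subsetAvg (1 / 2) A (fun T => inner ℂ x z * inner ℂ v y - swapForm T x y z v) =
      inner ℂ (tens x v) (tens z y - symProj A (tens z y)) := by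
  rw [subsetAvg_sub, subsetAvg_const, inner_sub_right, inner_symProj, inner_tens]
  rfl

theorem norm_subsetAvg_swapForm_le_one {A : Finset ι} {x y z v : Hil ι D κ} (hx : ‖x‖ = 1)
    (hy : ‖y‖ = 1) (hz : ‖z‖ = 1) (hv : ‖v‖ = 1) :
    ‖subsetAvg (1 / 2) A (fun T => inner ℂ x z * inner ℂ v y - swapForm T x y z v)‖ ≤ 1 := by
  rw [subsetAvg_swapForm]
  refine (norm_inner_le_norm _ _).trans ?_
  have := isProjFamily_symProj.norm_sub_le A (tens z y)
  rw [norm_tens, hx, hv, one_mul, one_mul]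
  rw [norm_tens, hz, hy, one_mul] at this
  exact this

/-- The core inequality for a fixed pair of nested sets `A ⊆ R`, when nearly optimal product states
on `R` are insensitive to dropping `A`. -/
theorem norm_subsetAvg_swapForm_le [Nonempty D] {α γ : ι → D → ℂ} (hα : IsUnitFamily α)
    (hγ : IsUnitFamily γ) {A R : Finset ι} (hA : A ⊆ R) {x y z v : Hil ι D κ} (hx : ‖x‖ = 1)
    (hy : ‖y‖ = 1) (hz : ‖z‖ = 1) (hv : ‖v‖ = 1) {c θ : ℝ} (hθ : 0 < θ) (hθ1 : θ ≤ 1)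
    (hc : c = θ ^ 2 / 10000)
    (hκ : deficit (pairVec x y) α R A + deficit (pairVec z v) γ R A ≤ c ^ 2)
    (hδu : gain (siteProj α) R A (pairVec x y) ≤ c ^ 2)
    (hδw : gain (siteProj γ) R A (pairVec z v) ≤ c ^ 2)
    (hδz : gain (siteProj α) R A z ≤ c ^ 2) (hδv : gain (siteProj α) R A v ≤ c ^ 2)
    (hδz0 : gain (siteProj α) R A (siteProj γ R z) ≤ c ^ 2)
    (hδv0 : gain (siteProj α) R A (siteProj γ R v) ≤ c ^ 2)
    (hδx : gain (siteProj γ) R A x ≤ c ^ 2) (hδy : gain (siteProj γ) R A y ≤ c ^ 2) :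
    ‖subsetAvg (1 / 2) A (fun T => inner ℂ x z * inner ℂ v y - swapForm T x y z v)‖ ≤
      2.4 * √(asymWeight x y * asymWeight z v) + θ / 2 := by
  have hc0 : 0 < c := by rw [hc]; positivity
  have hc1 : c ≤ 1 := by rw [hc]; nlinarith
  have hK1 := deficit_nonneg hα (pairVec x y) hA
  have hK2 := deficit_nonneg hγ (pairVec z v) hA
  have hqu := le_asymWeight hα hA hx hy hc0 hc1 hδu (by linarith)
  have hqw := le_asymWeight hγ hA hz hv hc0 hc1 hδw (by linarith)
  have nu : ‖siteProj α R (pairVec x y)‖ ^ 2 ≤ 1 := by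
    refine (norm_siteProj_sq_le hα _ R).trans_eq ?_
    rw [norm_pairVec_sq, hx, hy]; norm_num
  have nw : ‖siteProj γ R (pairVec z v)‖ ^ 2 ≤ 1 := by
    refine (norm_siteProj_sq_le hγ _ R).trans_eq ?_
    rw [norm_pairVec_sq, hz, hv]; norm_num
  have nu0 : 0 ≤ ‖siteProj α R (pairVec x y)‖ ^ 2 := by positivity
  have nw0 : 0 ≤ ‖siteProj γ R (pairVec z v)‖ ^ 2 := by positivity
  set g : Finset ι → ℝ := fun T => (maxOverlap (pairVec x y) T - ‖siteProj α R (pairVec x y)‖ ^ 2) +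
    (maxOverlap (pairVec z v) T - ‖siteProj γ R (pairVec z v)‖ ^ 2) with hg
  have hgu : ∀ T ⊆ A, 0 ≤ maxOverlap (pairVec x y) T - ‖siteProj α R (pairVec x y)‖ ^ 2 :=
    fun T hT => sub_nonneg.2 (norm_siteProj_sq_le_maxOverlap hα _ (hT.trans hA))
  have hgw : ∀ T ⊆ A, 0 ≤ maxOverlap (pairVec z v) T - ‖siteProj γ R (pairVec z v)‖ ^ 2 :=
    fun T hT => sub_nonneg.2 (norm_siteProj_sq_le_maxOverlap hγ _ (hT.trans hA))
  have hg0 : ∀ T ⊆ A, 0 ≤ g T := fun T hT => add_nonneg (hgu T hT) (hgw T hT)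
  have hgavg : subsetAvg (1 / 2) A g ≤ c ^ 2 := by rw [hg, subsetAvg_add]; exact hκ
  set eu := 1 - ‖siteProj α R (pairVec x y)‖ ^ 2 with heu
  set ew := 1 - ‖siteProj γ R (pairVec z v)‖ ^ 2 with hew
  have hb : ‖subsetAvg (1 / 2) A (fun T => inner ℂ x z * inner ℂ v y - swapForm T x y z v)‖ ≤
      2 * √(eu * ew) + 12 * c := by
    refine (norm_subsetAvg_le (by norm_num) (by norm_num) _ _).trans ?_
    refine (subsetAvg_mono (by norm_num) (by norm_num) fun T hT => ?_).trans
      ((subsetAvg_add_sqrt_le (f := fun _ => 2 * √(eu * ew)) (C := 3 * c ^ 2) hc0 hg0 hgavg).trans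
        ?_)
    · have h1 := Real.sq_sqrt (hg0 T hT)
      have h := norm_inner_mul_inner_sub_swapForm_le hα hγ hT hA (Real.sqrt_nonneg (g T)) hx hy hz hv
        (by
          have h2 := le_maxOverlap hα (pairVec x y) T
          have h3 := norm_siteProj_pairVec_sq α T x y
          have h4 := norm_siteProj_pairVec_sq α R x y
          rw [h1]
          linarith [hgw T hT])
        (by
          have h2 := le_maxOverlap hγ (pairVec z v) T
          have h3 := norm_siteProj_pairVec_sq γ T z v
          have h4 := norm_siteProj_pairVec_sq γ R z v
          rw [h1]
          linarith [hgu T hT]) hδz hδv hδz0 hδv0 hδx hδy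
      rw [← norm_siteProj_pairVec_sq, ← norm_siteProj_pairVec_sq] at h
      linarith
    · rw [subsetAvg_const]
      have : c ^ 2 ≤ c := by nlinarith
      linarith
  have su : ‖siteProj α R (pairVec x y)‖ ^ 2 = 1 - eu := by rw [heu]; ring
  have sw : ‖siteProj γ R (pairVec z v)‖ ^ 2 = 1 - ew := by rw [hew]; ring
  rw [su] at hqu
  rw [sw] at hqw
  obtain ⟨u1, u2⟩ := le_of_one_sub_sq_sub_min_le hqu
  obtain ⟨w1, w2⟩ := le_of_one_sub_sq_sub_min_le hqw
  exact le_add_of_approx hθ hθ1 hc (by linarith) (by linarith) (by linarith) (by linarith)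
    (norm_subsetAvg_swapForm_le_one hx hy hz hv) hb (asymWeight_nonneg x y)
    (asymWeight_le_one hx hy) (asymWeight_nonneg z v) (asymWeight_le_one hz hv) u1 u2 w1 w2

/-- The average of the deficit over random nested sets is the difference of two averages of the
largest overlap, at consecutive scales. -/
theorem subsetAvg_deficit_le {ψ : Hil ι D κ} {α : Finset ι → ι → D → ℂ}
    {ν : ℝ} (hα : ∀ R, maxOverlap ψ R - ν ≤ ‖siteProj (α R) R ψ‖ ^ 2) {r τ : ℝ} (hr0 : 0 ≤ r)
    (hr1 : r ≤ 1) :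
    subsetAvg r Finset.univ (fun R => subsetAvg τ R fun A => deficit ψ (α R) R A) ≤
      subsetAvg (r * (τ / 2)) Finset.univ (maxOverlap ψ) -
        subsetAvg r Finset.univ (maxOverlap ψ) + ν := by
  have h : ∀ R, subsetAvg τ R (fun A => deficit ψ (α R) R A) ≤
      subsetAvg (τ / 2) R (maxOverlap ψ) - maxOverlap ψ R + ν := by
    intro R
    have : (fun A => deficit ψ (α R) R A) = fun A =>
        subsetAvg (1 / 2) A (maxOverlap ψ) - ‖siteProj (α R) R ψ‖ ^ 2 := by
      funext A
      rw [deficit, subsetAvg_sub, subsetAvg_const]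
    rw [this, subsetAvg_sub, subsetAvg_comp, subsetAvg_const, mul_one_div]
    linarith [hα R]
  refine (subsetAvg_mono hr0 hr1 fun R _ => h R).trans_eq ?_
  rw [subsetAvg_add, subsetAvg_sub, subsetAvg_comp, subsetAvg_const]

/-- All the weights that must be small for the comparison at the sets `A ⊆ R` to be accurate. -/
def slack (x y z v : Hil ι D κ) (α γ : ι → D → ℂ) (R A : Finset ι) : ℝ :=
  deficit (pairVec x y) α R A + deficit (pairVec z v) γ R A +
    (gain (siteProj α) R A (pairVec x y) + gain (siteProj γ) R A (pairVec z v) +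
      gain (siteProj α) R A z + gain (siteProj α) R A v +
      gain (siteProj α) R A (siteProj γ R z) + gain (siteProj α) R A (siteProj γ R v) +
      gain (siteProj γ) R A x + gain (siteProj γ) R A y)

theorem norm_subsetAvg_swapForm_le_slack [Nonempty D] {α γ : ι → D → ℂ} (hα : IsUnitFamily α)
    (hγ : IsUnitFamily γ) {A R : Finset ι} (hA : A ⊆ R) {x y z v : Hil ι D κ} (hx : ‖x‖ = 1)
    (hy : ‖y‖ = 1) (hz : ‖z‖ = 1) (hv : ‖v‖ = 1) {c θ : ℝ} (hθ : 0 < θ) (hθ1 : θ ≤ 1)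
    (hc : c = θ ^ 2 / 10000) :
    ‖subsetAvg (1 / 2) A (fun T => inner ℂ x z * inner ℂ v y - swapForm T x y z v)‖ ≤
      2.4 * √(asymWeight x y * asymWeight z v) + θ / 2 + (c ^ 2)⁻¹ * slack x y z v α γ R A := by
  have hc0 : 0 < c := by rw [hc]; positivity
  have hP : IsProjFamily (siteProj (κ := κ) α) := isProjFamily_siteProj hα
  have hP' : IsProjFamily (siteProj (κ := κ) γ) := isProjFamily_siteProj hγ
  have d1 := deficit_nonneg hα (pairVec x y) hA
  have d2 := deficit_nonneg hγ (pairVec z v) hA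
  have g1 := (isProjFamily_siteProj (κ := κ × Bool) hα).gain_nonneg R A (pairVec x y)
  have g2 := (isProjFamily_siteProj (κ := κ × Bool) hγ).gain_nonneg R A (pairVec z v)
  have g3 := hP.gain_nonneg R A z
  have g4 := hP.gain_nonneg R A v
  have g5 := hP.gain_nonneg R A (siteProj γ R z)
  have g6 := hP.gain_nonneg R A (siteProj γ R v)
  have g7 := hP'.gain_nonneg R A x
  have g8 := hP'.gain_nonneg R A y
  have hs0 : 0 ≤ slack x y z v α γ R A := by unfold slack; linarith
  rcases le_total (slack x y z v α γ R A) (c ^ 2) with h | h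
  · have h0 : 0 ≤ (c ^ 2)⁻¹ * slack x y z v α γ R A := by positivity
    unfold slack at h
    have := norm_subsetAvg_swapForm_le hα hγ hA hx hy hz hv hθ hθ1 hc (by linarith) (by linarith)
      (by linarith) (by linarith) (by linarith) (by linarith) (by linarith) (by linarith)
      (by linarith)
    linarith
  · have h1 : 1 ≤ (c ^ 2)⁻¹ * slack x y z v α γ R A := by
      rw [← div_eq_inv_mul, one_le_div (by positivity)]
      exact h
    have h2 := norm_subsetAvg_swapForm_le_one (A := A) hx hy hz hv
    have h3 := Real.sqrt_nonneg (asymWeight x y * asymWeight z v)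
    linarith

theorem subsetAvg_gain_le_of_norm_le {P : Finset ι → Hil ι D κ →L[ℂ] Hil ι D κ}
    (hP : IsProjFamily P) {τ : ℝ} (h0 : 0 ≤ τ) (h1 : τ ≤ 1) (R : Finset ι) {x : Hil ι D κ}
    (hx : ‖x‖ ≤ 1) : subsetAvg τ R (fun A => gain P R A x) ≤ τ := by
  refine (hP.subsetAvg_gain_le h0 h1 R x).trans ?_
  have : ‖x‖ ^ 2 ≤ 1 := pow_le_one₀ (norm_nonneg _) hx
  nlinarith

theorem subsetAvg_slack_le {x y z v : Hil ι D κ} {α γ : Finset ι → ι → D → ℂ}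
    (hα : ∀ R, IsUnitFamily (α R)) (hγ : ∀ R, IsUnitFamily (γ R)) (hx : ‖x‖ = 1)
    (hy : ‖y‖ = 1) (hz : ‖z‖ = 1) (hv : ‖v‖ = 1) {r τ ν : ℝ} (hr0 : 0 ≤ r) (hr1 : r ≤ 1)
    (hτ0 : 0 ≤ τ) (hτ1 : τ ≤ 1)
    (hα' : ∀ R, maxOverlap (pairVec x y) R - ν ≤ ‖siteProj (α R) R (pairVec x y)‖ ^ 2)
    (hγ' : ∀ R, maxOverlap (pairVec z v) R - ν ≤ ‖siteProj (γ R) R (pairVec z v)‖ ^ 2) :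
    subsetAvg r Finset.univ (fun R => subsetAvg τ R fun A => slack x y z v (α R) (γ R) R A) ≤
      (subsetAvg (r * (τ / 2)) Finset.univ (maxOverlap (pairVec x y)) -
        subsetAvg r Finset.univ (maxOverlap (pairVec x y)) + ν) +
      (subsetAvg (r * (τ / 2)) Finset.univ (maxOverlap (pairVec z v)) -
        subsetAvg r Finset.univ (maxOverlap (pairVec z v)) + ν) + 8 * τ := by
  have h1 := subsetAvg_deficit_le hα' hr0 hr1 (τ := τ)
  have h2 := subsetAvg_deficit_le hγ' hr0 hr1 (τ := τ)
  have hpu : ‖pairVec x y‖ ≤ 1 := by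
    have := norm_pairVec_sq x y
    rw [hx, hy] at this
    nlinarith [norm_nonneg (pairVec x y)]
  have hpw : ‖pairVec z v‖ ≤ 1 := by
    have := norm_pairVec_sq z v
    rw [hz, hv] at this
    nlinarith [norm_nonneg (pairVec z v)]
  have h3 : ∀ R, subsetAvg τ R (fun A => slack x y z v (α R) (γ R) R A) ≤
      subsetAvg τ R (fun A => deficit (pairVec x y) (α R) R A) +
      subsetAvg τ R (fun A => deficit (pairVec z v) (γ R) R A) + 8 * τ := by
    intro R
    have hP := isProjFamily_siteProj (κ := κ) (hα R)
    have hP' := isProjFamily_siteProj (κ := κ) (hγ R)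
    have g1 := subsetAvg_gain_le_of_norm_le (isProjFamily_siteProj (hα R)) hτ0 hτ1 R hpu
    have g2 := subsetAvg_gain_le_of_norm_le (isProjFamily_siteProj (hγ R)) hτ0 hτ1 R hpw
    have g3 := subsetAvg_gain_le_of_norm_le hP hτ0 hτ1 R hz.le
    have g4 := subsetAvg_gain_le_of_norm_le hP hτ0 hτ1 R hv.le
    have g5 := subsetAvg_gain_le_of_norm_le hP hτ0 hτ1 R ((hP'.norm_le R z).trans hz.le)
    have g6 := subsetAvg_gain_le_of_norm_le hP hτ0 hτ1 R ((hP'.norm_le R v).trans hv.le)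
    have g7 := subsetAvg_gain_le_of_norm_le hP' hτ0 hτ1 R hx.le
    have g8 := subsetAvg_gain_le_of_norm_le hP' hτ0 hτ1 R hy.le
    simp only [slack, subsetAvg_add]
    linarith
  refine (subsetAvg_mono hr0 hr1 fun R _ => h3 R).trans ?_
  rw [subsetAvg_add, subsetAvg_add, subsetAvg_const]
  linarith

/-- The core inequality. Averaging over many scales `σ, σ², …` makes the largest overlap with a
product state stable from one scale to the next, for most scales. -/
theorem exists_norm_avg_swapForm_le {θ : ℝ} (hθ : 0 < θ) (hθ1 : θ ≤ 1) :
    ∃ σ : ℝ, 0 < σ ∧ σ ≤ 1 / 2 ∧ ∃ L : ℕ, 0 < L ∧ ∀ (ι D κ : Type) [Fintype ι] [DecidableEq ι]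
      [Fintype D] [DecidableEq D] [Fintype κ] [DecidableEq κ] [Nonempty D] (x y z v : Hil ι D κ),
      ‖x‖ = 1 → ‖y‖ = 1 → ‖z‖ = 1 → ‖v‖ = 1 →
      ‖∑ l ∈ Finset.range L, subsetAvg (σ ^ (l + 1)) Finset.univ
          (fun T => inner ℂ x z * inner ℂ v y - swapForm T x y z v)‖ ≤
        L * (2.4 * √(asymWeight x y * asymWeight z v) + θ) := by
  -- The slack costs `c⁻²` times its average, which is at most `8 τ` for the gains and, after
  -- summation over the `L` scales, `O(1)` for the deficits.
  obtain ⟨c, hc⟩ : ∃ c, c = θ ^ 2 / 10000 := ⟨_, rfl⟩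
  have hc0 : 0 < c := by rw [hc]; positivity
  have hc1 : c ≤ 1 := by rw [hc]; nlinarith
  obtain ⟨τ, hτ⟩ : ∃ τ, τ = c ^ 2 * θ / 32 := ⟨_, rfl⟩
  have hτ0 : 0 < τ := by rw [hτ]; positivity
  have hτ1 : τ ≤ 1 := by
    have : c ^ 2 * θ ≤ 1 := mul_le_one₀ (pow_le_one₀ hc0.le hc1) hθ.le hθ1
    rw [hτ]; linarith
  obtain ⟨L, hL⟩ := exists_nat_gt (16 / (c ^ 2 * θ))
  have hL0 : (0 : ℝ) < L := lt_trans (by positivity) hL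
  refine ⟨τ / 2, by positivity, by linarith, L, by exact_mod_cast hL0, ?_⟩
  intro ι D κ _ _ _ _ _ _ _ x y z v hx hy hz hv
  have hν : (0 : ℝ) < 1 / L := by positivity
  choose α hα hα' using fun R => exists_near_maxOverlap (pairVec x y) R hν
  choose γ hγ hγ' using fun R => exists_near_maxOverlap (pairVec z v) R hν
  set M := 2.4 * √(asymWeight x y * asymWeight z v) + θ / 2 with hM
  set a : ℕ → ℝ := fun l => subsetAvg ((τ / 2) ^ l) Finset.univ (maxOverlap (pairVec x y)) with ha
  set b : ℕ → ℝ := fun l => subsetAvg ((τ / 2) ^ l) Finset.univ (maxOverlap (pairVec z v)) with hb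
  have hstep : ∀ l, ‖subsetAvg ((τ / 2) ^ (l + 1)) Finset.univ
      (fun T => inner ℂ x z * inner ℂ v y - swapForm T x y z v)‖ ≤
      M + (c ^ 2)⁻¹ * ((a (l + 1) - a l + 1 / L) + (b (l + 1) - b l + 1 / L) + 8 * τ) := by
    intro l
    have hr0 : 0 ≤ (τ / 2) ^ l := by positivity
    have hr1 : (τ / 2) ^ l ≤ 1 := pow_le_one₀ (by positivity) (by linarith)
    have e : ∀ f : Finset ι → ℂ, subsetAvg ((τ / 2) ^ (l + 1)) Finset.univ f =
        subsetAvg ((τ / 2) ^ l) Finset.univ fun R => subsetAvg τ R fun A =>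
          subsetAvg (1 / 2) A f := fun f => by
      simp only [subsetAvg_comp]
      rw [pow_succ, mul_one_div]
    rw [e]
    refine (norm_subsetAvg_le hr0 hr1 _ _).trans ?_
    have h1 : ∀ R ⊆ Finset.univ, ‖subsetAvg τ R fun A => subsetAvg (1 / 2) A
        fun T => inner ℂ x z * inner ℂ v y - swapForm T x y z v‖ ≤
        M + (c ^ 2)⁻¹ • subsetAvg τ R fun A => slack x y z v (α R) (γ R) R A := by
      intro R _
      refine (norm_subsetAvg_le hτ0.le hτ1 _ _).trans ?_
      refine (subsetAvg_mono hτ0.le hτ1 fun A hA => norm_subsetAvg_swapForm_le_slack (hα R) (hγ R)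
        hA hx hy hz hv hθ hθ1 hc).trans_eq ?_
      rw [subsetAvg_add, subsetAvg_const, ← subsetAvg_smul]
      rfl
    refine (subsetAvg_mono hr0 hr1 h1).trans ?_
    rw [subsetAvg_add, subsetAvg_const, subsetAvg_smul, smul_eq_mul]
    have h2 := subsetAvg_slack_le hα hγ hx hy hz hv hr0 hr1 hτ0.le hτ1 hα' hγ'
    rw [← pow_succ] at h2
    gcongr
  refine (norm_sum_le _ _).trans ((Finset.sum_le_sum fun l _ => hstep l).trans ?_)
  have hbd : ∀ (ψ : Hil ι D (κ × Bool)), ‖ψ‖ ^ 2 = 1 →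
      subsetAvg ((τ / 2) ^ L) Finset.univ (maxOverlap ψ) -
        subsetAvg ((τ / 2) ^ 0) Finset.univ (maxOverlap ψ) ≤ 1 := by
    intro ψ hψ
    have h1 : subsetAvg ((τ / 2) ^ L) Finset.univ (maxOverlap ψ) ≤ 1 :=
      subsetAvg_le (by positivity) (pow_le_one₀ (by positivity) (by linarith)) fun T _ =>
        (maxOverlap_le ψ T).trans_eq hψ
    have h2 : 0 ≤ subsetAvg ((τ / 2) ^ 0) Finset.univ (maxOverlap ψ) :=
      subsetAvg_nonneg (by positivity) (pow_le_one₀ (by positivity) (by linarith)) fun T _ =>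
        maxOverlap_nonneg ψ T
    linarith
  have hA := hbd (pairVec x y) (by rw [norm_pairVec_sq, hx, hy]; norm_num)
  have hB := hbd (pairVec z v) (by rw [norm_pairVec_sq, hz, hv]; norm_num)
  change a L - a 0 ≤ 1 at hA
  change b L - b 0 ≤ 1 at hB
  -- The deficits telescope over the scales.
  simp only [Finset.sum_add_distrib, ← Finset.mul_sum]
  rw [Finset.sum_range_sub a, Finset.sum_range_sub b]
  simp only [Finset.sum_const, Finset.card_range, nsmul_eq_mul]
  have hLL : (L : ℝ) * (1 / L) = 1 := by field_simp
  rw [hLL]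
  have h16 : 16 ≤ L * (c ^ 2 * θ) := by
    rw [div_lt_iff₀ (by positivity)] at hL
    exact hL.le
  have hcθ : (c ^ 2)⁻¹ * (a L - a 0 + 1 + (b L - b 0 + 1) + L * (8 * τ)) ≤ L * (θ / 2) := by
    rw [inv_mul_le_iff₀ (by positivity), hτ]
    nlinarith
  have e1 : (L : ℝ) * (2.4 * √(asymWeight x y * asymWeight z v) + θ) = L * M + L * (θ / 2) := by
    rw [hM]; ring
  have e2 : 8 * ((L : ℝ) * τ) = L * (8 * τ) := by ring
  rw [e1, e2]
  exact add_le_add_right hcθ _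

end Core

/-! ### Trace norm and trace distance -/

section TraceNorm

open Polynomial in
/-- For a Hermitian matrix, the eigenvalues of `Yᴴ Y = Y²` are the squares of those of `Y`, as
multisets. -/
theorem traceNorm_eq_sum_abs {ι : Type*} [Fintype ι] [DecidableEq ι] {Y : Matrix ι ι ℂ}
    (hY : Y.IsHermitian) : traceNorm Y = ∑ i, |hY.eigenvalues i| := by
  have hH := Matrix.isHermitian_conjTranspose_mul_self Y
  have h1 : (Y.conjTranspose * Y).charpoly =
      ∏ i, (X - C (((hY.eigenvalues i ^ 2 : ℝ) : ℂ)) : ℂ[X]) := by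
    rw [hY.eq]
    conv_lhs => rw [hY.spectral_theorem, Unitary.conjStarAlgAut_apply]
    have : ∀ (U D V : Matrix ι ι ℂ), V * U = 1 → U * D * V * (U * D * V) = U * (D * D) * V :=
      fun U D V h => by
        calc U * D * V * (U * D * V) = U * D * (V * U) * (D * V) := by noncomm_ring
          _ = U * (D * D) * V := by rw [h]; noncomm_ring
    rw [this _ _ _ (Unitary.coe_star_mul_self _), Matrix.charpoly_mul_comm, ← mul_assoc,
      Unitary.coe_star_mul_self, one_mul, Matrix.diagonal_mul_diagonal, Matrix.charpoly_diagonal]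
    simp [sq]
  have h2 := hH.roots_charpoly_eq_eigenvalues
  rw [h1, Polynomial.roots_prod _ _ (Finset.prod_ne_zero_iff.2 fun i _ => X_sub_C_ne_zero _)] at h2
  simp only [roots_X_sub_C, Multiset.bind_singleton] at h2
  have h3 := congrArg (fun s : Multiset ℂ => (s.map fun z => √z.re).sum) h2
  simp only [Multiset.map_map, Function.comp_def, Complex.ofReal_re, Real.sqrt_sq_eq_abs] at h3
  rw [traceNorm]
  exact h3.symm

variable {ι : Type*} [Fintype ι] [DecidableEq ι]

/-- The real part of the quadratic form `⟨v, M v⟩`. -/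
def quad (M : Matrix ι ι ℂ) (v : ι → ℂ) : ℝ := (star v ⬝ᵥ M.mulVec v).re

theorem quad_one (v : ι → ℂ) : quad 1 v = ∑ i, ‖v i‖ ^ 2 := by
  simp only [quad, Matrix.one_mulVec, dotProduct, Complex.re_sum, Pi.star_apply, RCLike.star_def]
  exact Finset.sum_congr rfl fun i _ => by
    rw [mul_comm, Complex.mul_conj, Complex.ofReal_re, Complex.normSq_eq_norm_sq]

theorem quad_add (M N : Matrix ι ι ℂ) (v : ι → ℂ) : quad (M + N) v = quad M v + quad N v := by
  simp [quad, Matrix.add_mulVec, dotProduct_add]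

theorem quad_sub (M N : Matrix ι ι ℂ) (v : ι → ℂ) : quad (M - N) v = quad M v - quad N v := by
  simp [quad, Matrix.sub_mulVec, dotProduct_sub]

theorem quad_smul (r : ℝ) (M : Matrix ι ι ℂ) (v : ι → ℂ) :
    quad ((r : ℂ) • M) v = r * quad M v := by
  simp [quad, Matrix.smul_mulVec, dotProduct_smul]

theorem quad_nonneg {M : Matrix ι ι ℂ} (hM : M.PosSemidef) (v : ι → ℂ) : 0 ≤ quad M v :=
  hM.re_dotProduct_nonneg v

variable {Y : Matrix ι ι ℂ} (hY : Y.IsHermitian)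

theorem quad_one_eigenvector (j : ι) : quad 1 (hY.eigenvectorBasis j).ofLp = 1 := by
  rw [quad_one, ← EuclideanSpace.norm_sq_eq, hY.eigenvectorBasis.orthonormal.1 j, one_pow]

theorem re_trace_mul_eq_sum (M : Matrix ι ι ℂ) :
    (M * Y).trace.re = ∑ j, hY.eigenvalues j * quad M (hY.eigenvectorBasis j).ofLp := by
  conv_lhs => rw [hY.spectral_theorem, Unitary.conjStarAlgAut_apply]
  rw [← mul_assoc, Matrix.trace_mul_comm, ← mul_assoc, ← mul_assoc, Matrix.trace, Complex.re_sum]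
  refine Finset.sum_congr rfl fun j _ => ?_
  rw [Matrix.diag_apply, Matrix.mul_diagonal, mul_comm, Function.comp_apply]
  have : (star (hY.eigenvectorUnitary : Matrix ι ι ℂ) * M *
      (hY.eigenvectorUnitary : Matrix ι ι ℂ)) j j =
      star (hY.eigenvectorBasis j).ofLp ⬝ᵥ M.mulVec (hY.eigenvectorBasis j).ofLp := by
    rw [mul_assoc]
    simp only [Matrix.mul_apply, Matrix.star_apply, Matrix.IsHermitian.eigenvectorUnitary_apply,
      dotProduct, Matrix.mulVec, Pi.star_apply]
  rw [this]
  exact Complex.re_ofReal_mul _ _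

/-- Hölder's inequality for a traceless matrix `Y`: the observable `M` may be centred, so only half
the length of its spectrum enters. -/
theorem re_trace_mul_le_traceNorm {Y : Matrix ι ι ℂ} (hY : Y.IsHermitian) (htr : Y.trace = 0)
    {M : Matrix ι ι ℂ} {lo hi : ℝ}
    (hlo : ∀ v, lo * quad 1 v ≤ quad M v) (hhi : ∀ v, quad M v ≤ hi * quad 1 v) :
    (M * Y).trace.re ≤ (hi - lo) / 2 * traceNorm Y := by
  have h0 : ∑ j, hY.eigenvalues j = 0 := by
    have := hY.trace_eq_sum_eigenvalues
    rw [htr] at this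
    exact Complex.ofReal_injective (by simpa using this.symm)
  have h1 : ∑ j, hY.eigenvalues j * ((hi + lo) / 2) = 0 := by rw [← Finset.sum_mul, h0, zero_mul]
  rw [re_trace_mul_eq_sum hY, traceNorm_eq_sum_abs hY, Finset.mul_sum,
    ← sub_zero (∑ j, hY.eigenvalues j * _), ← h1, ← Finset.sum_sub_distrib]
  refine Finset.sum_le_sum fun j _ => ?_
  have a1 := hlo (hY.eigenvectorBasis j).ofLp
  have a2 := hhi (hY.eigenvectorBasis j).ofLp
  rw [quad_one_eigenvector] at a1 a2
  rw [← mul_sub]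
  have a3 : |quad M (hY.eigenvectorBasis j).ofLp - (hi + lo) / 2| ≤ (hi - lo) / 2 := by
    rw [abs_le]; constructor <;> linarith
  calc _ ≤ |hY.eigenvalues j * (quad M (hY.eigenvectorBasis j).ofLp - (hi + lo) / 2)| :=
        le_abs_self _
    _ = |quad M (hY.eigenvectorBasis j).ofLp - (hi + lo) / 2| * |hY.eigenvalues j| := by
        rw [abs_mul, mul_comm]
    _ ≤ _ := by gcongr

theorem sum_quad_eigenvector {M : Matrix ι ι ℂ} :
    ∑ j, quad M (hY.eigenvectorBasis j).ofLp = M.trace.re := by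
  have e : ∀ j, quad M (hY.eigenvectorBasis j).ofLp =
      ((star (hY.eigenvectorUnitary : Matrix ι ι ℂ) * M *
      (hY.eigenvectorUnitary : Matrix ι ι ℂ)) j j).re := fun j => by
    rw [mul_assoc]
    simp only [Matrix.mul_apply, Matrix.star_apply, Matrix.IsHermitian.eigenvectorUnitary_apply,
      dotProduct, Matrix.mulVec, Pi.star_apply, quad]
  simp only [e, ← Complex.re_sum]
  change (Matrix.trace (star (hY.eigenvectorUnitary : Matrix ι ι ℂ) * M *
      (hY.eigenvectorUnitary : Matrix ι ι ℂ))).re = _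
  rw [Matrix.trace_mul_comm, ← mul_assoc]
  have := Unitary.coe_mul_star_self hY.eigenvectorUnitary
  rw [Unitary.coe_star] at this
  rw [this, one_mul]

theorem traceNorm_sub_le_two {ρ σ : Matrix ι ι ℂ} (hρ : IsDensity ρ) (hσ : IsDensity σ) :
    traceNorm (ρ - σ) ≤ 2 := by
  have hX := hρ.1.isHermitian.sub hσ.1.isHermitian
  rw [traceNorm_eq_sum_abs hX]
  have h : ∀ j, |hX.eigenvalues j| ≤ quad ρ (hX.eigenvectorBasis j).ofLp +
      quad σ (hX.eigenvectorBasis j).ofLp := fun j => by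
    have e : hX.eigenvalues j = quad (ρ - σ) (hX.eigenvectorBasis j).ofLp := hX.eigenvalues_eq j
    have a1 := quad_nonneg hρ.1 (hX.eigenvectorBasis j).ofLp
    have a2 := quad_nonneg hσ.1 (hX.eigenvectorBasis j).ofLp
    rw [e, quad_sub, abs_le]
    constructor <;> linarith
  refine (Finset.sum_le_sum fun j _ => h j).trans_eq ?_
  rw [Finset.sum_add_distrib, sum_quad_eigenvector, sum_quad_eigenvector, hρ.2, hσ.2]
  norm_num

end TraceNorm

/-! ### Separable states -/

section Separable

variable {A B : Type*} [Fintype A] [Fintype B] [DecidableEq A] [DecidableEq B]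

/-- The product vector `a ⊗ b`. -/
def prodVec (a : A → ℂ) (b : B → ℂ) : A × B → ℂ := fun x => a x.1 * b x.2

open scoped MatrixOrder in
theorem exists_eq_conjTranspose_mul_self {ι : Type*} [Fintype ι] [DecidableEq ι]
    {M : Matrix ι ι ℂ} (hM : M.PosSemidef) : ∃ C : Matrix ι ι ℂ, M = C.conjTranspose * C :=
  CStarAlgebra.nonneg_iff_eq_star_mul_self.1 hM.nonneg

theorem convex_isDensity {ι : Type*} [Fintype ι] : Convex ℝ {ρ : Matrix ι ι ℂ | IsDensity ρ} := by
  intro ρ hρ σ hσ s t hs ht hst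
  refine ⟨(hρ.1.smul hs).add (hσ.1.smul ht), ?_⟩
  rw [Matrix.trace_add, Matrix.trace_smul, Matrix.trace_smul, hρ.2, hσ.2, ← add_smul, hst, one_smul]

theorem isDensity_of_mem_separableStates {σ : Matrix (A × B) (A × B) ℂ}
    (h : σ ∈ separableStates A B) : IsDensity σ := by
  refine convexHull_min ?_ convex_isDensity h
  rintro _ ⟨σ, τ, hσ, hτ, rfl⟩
  refine ⟨hσ.1.kronecker hτ.1, ?_⟩
  rw [Matrix.trace_kronecker, hσ.2, hτ.2, one_mul]

theorem exists_isDensity {ι : Type*} [Fintype ι] [DecidableEq ι] [Nonempty ι] :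
    ∃ ρ : Matrix ι ι ℂ, IsDensity ρ := by
  let i := Classical.arbitrary ι
  refine ⟨Matrix.vecMulVec (Pi.single i 1) (star (Pi.single i 1)),
    Matrix.posSemidef_vecMulVec_self_star _, ?_⟩
  rw [Matrix.trace_vecMulVec]
  simp

theorem separableStates_nonempty [Nonempty A] [Nonempty B] : (separableStates A B).Nonempty := by
  obtain ⟨σ, hσ⟩ := exists_isDensity (ι := A)
  obtain ⟨τ, hτ⟩ := exists_isDensity (ι := B)
  exact ⟨σ ⊗ₖ τ, subset_convexHull _ _ ⟨σ, τ, hσ, hτ, rfl⟩⟩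

theorem re_trace_mul_conjTranspose_mul_self {ι κ : Type*} [Fintype ι] [Fintype κ] [DecidableEq ι]
    (M : Matrix ι ι ℂ) (C : Matrix κ ι ℂ) :
    (M * (C.conjTranspose * C)).trace.re = ∑ k, quad M (fun i => star (C k i)) := by
  rw [← Matrix.mul_assoc, Matrix.trace_mul_comm, ← Matrix.mul_assoc, Matrix.trace, Complex.re_sum]
  refine Finset.sum_congr rfl fun k _ => ?_
  rw [Matrix.diag_apply, Matrix.mul_assoc]
  simp only [quad, Matrix.mul_apply, dotProduct, Matrix.mulVec, Matrix.conjTranspose_apply,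
    Pi.star_apply, star_star]

/-- A bound of a quadratic form on product vectors is a bound of its expectation on all separable
states. -/
theorem re_trace_mul_le_of_mem_separableStates {M : Matrix (A × B) (A × B) ℂ} {K : ℝ}
    (h : ∀ a b, quad M (prodVec a b) ≤ K * (quad 1 a * quad 1 b)) {σ : Matrix (A × B) (A × B) ℂ}
    (hσ : σ ∈ separableStates A B) : (M * σ).trace.re ≤ K := by
  have hconv : Convex ℝ {σ : Matrix (A × B) (A × B) ℂ | (M * σ).trace.re ≤ K} := by
    intro ρ hρ σ hσ s t hs ht hst
    have e : (M * (s • ρ + t • σ)).trace.re = s * (M * ρ).trace.re + t * (M * σ).trace.re := by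
      rw [mul_add, Matrix.mul_smul, Matrix.mul_smul, Matrix.trace_add, Matrix.trace_smul,
        Matrix.trace_smul, Complex.add_re, Complex.smul_re, Complex.smul_re]
      rfl
    change (M * (s • ρ + t • σ)).trace.re ≤ K
    rw [e]
    calc _ ≤ s * K + t * K := by
          gcongr
          · exact hρ
          · exact hσ
      _ = K := by rw [← add_mul, hst, one_mul]
  refine convexHull_min ?_ hconv hσ
  rintro _ ⟨σ, τ, hσ, hτ, rfl⟩
  obtain ⟨C, hC⟩ := exists_eq_conjTranspose_mul_self hσ.1
  obtain ⟨E, hE⟩ := exists_eq_conjTranspose_mul_self hτ.1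
  have hk : (C ⊗ₖ E).conjTranspose * (C ⊗ₖ E) = σ ⊗ₖ τ := by
    rw [Matrix.conjTranspose_kronecker, ← Matrix.mul_kronecker_mul, ← hC, ← hE]
  change (M * (σ ⊗ₖ τ)).trace.re ≤ K
  rw [← hk, re_trace_mul_conjTranspose_mul_self, Fintype.sum_prod_type]
  have hv : ∀ k l, (fun x : A × B => star ((C ⊗ₖ E) (k, l) x)) =
      prodVec (fun i => star (C k i)) (fun i => star (E l i)) := fun k l => by
    funext x
    simp [prodVec, Matrix.kroneckerMap_apply]
  simp only [hv]
  refine (Finset.sum_le_sum fun k _ => Finset.sum_le_sum fun l _ => h _ _).trans_eq ?_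
  simp only [← Finset.mul_sum, ← Finset.sum_mul]
  rw [← re_trace_mul_conjTranspose_mul_self, ← re_trace_mul_conjTranspose_mul_self, ← hC, ← hE,
    one_mul, one_mul, hσ.2, hτ.2, Complex.one_re, mul_one, mul_one]

theorem sepDist_le_one {ρ : Matrix (A × B) (A × B) ℂ} (hρ : IsDensity ρ) : sepDist ρ ≤ 1 := by
  by_cases h : (separableStates A B).Nonempty
  · obtain ⟨σ, hσ⟩ := h
    refine (csInf_le ⟨0, ?_⟩ (Set.mem_image_of_mem _ hσ)).trans ?_
    · rintro _ ⟨σ, _, rfl⟩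
      exact div_nonneg (Finset.sum_nonneg fun _ _ => Real.sqrt_nonneg _) zero_le_two
    · rw [traceDist]
      linarith [traceNorm_sub_le_two hρ (isDensity_of_mem_separableStates hσ)]
  · rw [Set.not_nonempty_iff_eq_empty] at h
    rw [sepDist, h, Set.image_empty, Real.sInf_empty]
    exact zero_le_one

/-- An entanglement witness bounds the distance to the separable states from below. -/
theorem le_sepDist [Nonempty A] [Nonempty B] {ρ M : Matrix (A × B) (A × B) ℂ} (hρ : IsDensity ρ)
    {K lo hi : ℝ} (hlohi : lo < hi) (hlo : ∀ v, lo * quad 1 v ≤ quad M v)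
    (hhi : ∀ v, quad M v ≤ hi * quad 1 v)
    (h : ∀ a b, quad M (prodVec a b) ≤ K * (quad 1 a * quad 1 b)) :
    ((M * ρ).trace.re - K) / (hi - lo) ≤ sepDist ρ := by
  refine le_csInf (separableStates_nonempty.image _) ?_
  rintro _ ⟨σ, hσ, rfl⟩
  have hd := isDensity_of_mem_separableStates hσ
  have h1 := re_trace_mul_le_of_mem_separableStates h hσ
  have h2 := re_trace_mul_le_traceNorm (hρ.1.isHermitian.sub hd.1.isHermitian)
    (by rw [Matrix.trace_sub, hρ.2, hd.2, sub_self]) hlo hhi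
  rw [mul_sub, Matrix.trace_sub, Complex.sub_re] at h2
  rw [div_le_iff₀ (sub_pos.2 hlohi), traceDist]
  linarith

end Separable

/-! ### Tensor powers and bipartite products of matrices -/

section TensorPow

theorem sum_prod_pair {A B R : Type*} [Fintype A] [Fintype B] [CommSemiring R] {n : ℕ}
    (g : Fin n → A × B → R) :
    ∑ z : (Fin n → A) × (Fin n → B), ∏ i, g i (z.1 i, z.2 i) = ∏ i, ∑ k, g i k := by
  rw [Finset.prod_univ_sum, Fintype.piFinset_univ,
    ← Equiv.sum_comp (Equiv.arrowProdEquivProdArrow (Fin n) (fun _ => A) fun _ => B)]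
  rfl

variable {A B A' B' : Type*} [Fintype A] [Fintype B] [Fintype A'] [Fintype B'] {n : ℕ}

theorem tensorPow_mul (ρ σ : Matrix (A × B) (A × B) ℂ) :
    tensorPow n ρ * tensorPow n σ = tensorPow n (ρ * σ) := by
  ext x y
  simp only [Matrix.mul_apply, tensorPow, Matrix.of_apply, ← Finset.prod_mul_distrib]
  exact sum_prod_pair fun i k => ρ (x.1 i, x.2 i) k * σ k (y.1 i, y.2 i)

theorem trace_tensorPow (ρ : Matrix (A × B) (A × B) ℂ) :
    (tensorPow n ρ).trace = ρ.trace ^ n := by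
  refine (sum_prod_pair fun _ k => ρ k k).trans ?_
  simp [Matrix.trace]

theorem conjTranspose_tensorPow (ρ : Matrix (A × B) (A × B) ℂ) :
    (tensorPow n ρ).conjTranspose = tensorPow n ρ.conjTranspose := by
  ext x y
  simp [tensorPow]

theorem tensorPow_one [DecidableEq A] [DecidableEq B] :
    tensorPow n (1 : Matrix (A × B) (A × B) ℂ) = 1 := by
  ext x y
  have h : x = y ↔ ∀ i, (x.1 i, x.2 i) = (y.1 i, y.2 i) := by
    simp [Prod.ext_iff, funext_iff, forall_and]
  simp only [tensorPow, Matrix.of_apply, Matrix.one_apply, Finset.prod_ite_zero,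
    Finset.mem_univ, true_imp_iff, h, Finset.prod_const_one]

theorem posSemidef_tensorPow {ρ : Matrix (A × B) (A × B) ℂ}
    (hρ : ρ.PosSemidef) : (tensorPow n ρ).PosSemidef := by
  classical
  obtain ⟨C, rfl⟩ := exists_eq_conjTranspose_mul_self hρ
  rw [← tensorPow_mul, ← conjTranspose_tensorPow]
  exact Matrix.posSemidef_conjTranspose_mul_self _

theorem isDensity_tensorPow {ρ : Matrix (A × B) (A × B) ℂ} (hρ : IsDensity ρ) :
    IsDensity (tensorPow n ρ) :=
  ⟨posSemidef_tensorPow hρ.1, by rw [trace_tensorPow, hρ.2, one_pow]⟩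

theorem combine_mul (K K' : Matrix (A × B) (A × B) ℂ) (S S' : Matrix (A' × B') (A' × B') ℂ) :
    combine K S * combine K' S' = combine (K * K') (S * S') := by
  ext x y
  simp only [combine, Matrix.mul_apply, Matrix.of_apply, Finset.sum_mul_sum,
    Fintype.sum_prod_type]
  exact Finset.sum_congr rfl fun a _ => Finset.sum_congr rfl fun a' _ =>
    Finset.sum_congr rfl fun b _ => Finset.sum_congr rfl fun b' _ => by ring

theorem trace_combine (K : Matrix (A × B) (A × B) ℂ) (S : Matrix (A' × B') (A' × B') ℂ) :
    (combine K S).trace = K.trace * S.trace := by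
  simp only [combine, Matrix.trace, Matrix.diag_apply, Matrix.of_apply, Finset.sum_mul_sum,
    Fintype.sum_prod_type]

theorem conjTranspose_combine (K : Matrix (A × B) (A × B) ℂ) (S : Matrix (A' × B') (A' × B') ℂ) :
    (combine K S).conjTranspose = combine K.conjTranspose S.conjTranspose := by
  ext x y
  simp [combine]

theorem combine_add (K K' : Matrix (A × B) (A × B) ℂ) (S : Matrix (A' × B') (A' × B') ℂ) :
    combine (K + K') S = combine K S + combine K' S := by
  ext x y
  simp [combine, add_mul]

theorem combine_smul (c : ℂ) (K : Matrix (A × B) (A × B) ℂ) (S : Matrix (A' × B') (A' × B') ℂ) :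
    combine (c • K) S = c • combine K S := by
  ext x y
  simp [combine, mul_assoc]

theorem posSemidef_combine {K : Matrix (A × B) (A × B) ℂ} {S : Matrix (A' × B') (A' × B') ℂ}
    (hK : K.PosSemidef) (hS : S.PosSemidef) : (combine K S).PosSemidef := by
  classical
  obtain ⟨C, rfl⟩ := exists_eq_conjTranspose_mul_self hK
  obtain ⟨E, rfl⟩ := exists_eq_conjTranspose_mul_self hS
  rw [← combine_mul, ← conjTranspose_combine]
  exact Matrix.posSemidef_conjTranspose_mul_self _

end TensorPow

/-! ### The flip operator and the hiding states -/

section Hiding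

theorem flipOp_mul_self (d : ℕ) : flipOp d * flipOp d = 1 := by
  ext x y
  simp only [flipOp, Matrix.mul_apply, Matrix.of_apply, Matrix.one_apply, Fintype.sum_prod_type]
  rw [Finset.sum_eq_single x.2, Finset.sum_eq_single x.1]
  · simp [Prod.ext_iff, and_comm]
  · intro b _ hb; simp [hb.symm]
  · simp
  · intro b _ hb; simp [hb.symm]
  · simp

theorem conjTranspose_flipOp (d : ℕ) : (flipOp d).conjTranspose = flipOp d := by
  ext x y
  simp only [flipOp, Matrix.conjTranspose_apply, Matrix.of_apply, apply_ite star, star_one,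
    star_zero]
  exact if_congr (by constructor <;> rintro ⟨h1, h2⟩ <;> exact ⟨h2.symm, h1.symm⟩) rfl rfl

theorem trace_flipOp (d : ℕ) : (flipOp d).trace = d := by
  simp only [flipOp, Matrix.trace, Matrix.diag_apply, Matrix.of_apply, Fintype.sum_prod_type]
  have : ∀ x y : Fin d, (if x = y ∧ y = x then (1 : ℂ) else 0) = if x = y then 1 else 0 :=
    fun x y => if_congr ⟨fun h => h.1, fun h => ⟨h, h.symm⟩⟩ rfl rfl
  simp [this]

theorem flipOp_mul_rhoSym (d : ℕ) : flipOp d * rhoSym d = rhoSym d := by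
  rw [rhoSym, Matrix.mul_smul, Matrix.mul_smul, mul_add, mul_one, flipOp_mul_self,
    add_comm (flipOp d)]

theorem flipOp_mul_rhoAnti (d : ℕ) : flipOp d * rhoAnti d = -rhoAnti d := by
  rw [rhoAnti, Matrix.mul_smul, Matrix.mul_smul, mul_sub, mul_one, flipOp_mul_self, ← smul_neg,
    ← smul_neg, neg_sub]

theorem trace_rhoSym {d : ℕ} (hd : 2 ≤ d) : (rhoSym d).trace = 1 := by
  have h : (d : ℂ) ^ 2 + d ≠ 0 := by
    have : d ^ 2 + d ≠ 0 := by positivity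
    exact_mod_cast this
  rw [rhoSym, Matrix.trace_smul, Matrix.trace_smul, Matrix.trace_add, trace_flipOp,
    Matrix.trace_one, Fintype.card_prod, Fintype.card_fin, smul_eq_mul, smul_eq_mul,
    Nat.cast_mul, ← sq, one_div, div_mul_eq_mul_div, div_eq_one_iff_eq h]
  ring

theorem trace_rhoAnti {d : ℕ} (hd : 2 ≤ d) : (rhoAnti d).trace = 1 := by
  have h : (d : ℂ) ^ 2 - d ≠ 0 := by
    have h1 : (d : ℝ) ^ 2 - d ≠ 0 := by
      have : (2 : ℝ) ≤ d := by exact_mod_cast hd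
      nlinarith
    exact_mod_cast h1
  rw [rhoAnti, Matrix.trace_smul, Matrix.trace_smul, Matrix.trace_sub, trace_flipOp,
    Matrix.trace_one, Fintype.card_prod, Fintype.card_fin, smul_eq_mul, smul_eq_mul,
    Nat.cast_mul, ← sq, one_div, div_mul_eq_mul_div, div_eq_one_iff_eq h]
  ring

theorem posSemidef_half_smul {ι : Type*} [Fintype ι] [DecidableEq ι] {P : Matrix ι ι ℂ}
    (h : P.conjTranspose = P) (h2 : P * P = 1) : ((1 / 2 : ℂ) • (1 + P)).PosSemidef := by
  have e : (1 / 2 : ℂ) • (1 + P) =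
      ((1 / 2 : ℂ) • (1 + P)).conjTranspose * ((1 / 2 : ℂ) • (1 + P)) := by
    rw [Matrix.conjTranspose_smul, Matrix.conjTranspose_add, h, Matrix.conjTranspose_one,
      Matrix.smul_mul, Matrix.mul_smul, mul_add, add_mul, add_mul, h2, smul_smul]
    simp only [one_mul, mul_one]
    rw [show (1 + P + (P + 1)) = (2 : ℂ) • (1 + P) by rw [two_smul]; abel, smul_smul]
    norm_num
  rw [e]
  exact Matrix.posSemidef_conjTranspose_mul_self _

theorem posSemidef_rhoSym (d : ℕ) : (rhoSym d).PosSemidef := by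
  have h := (posSemidef_half_smul (conjTranspose_flipOp d) (flipOp_mul_self d)).smul
    (show (0 : ℝ) ≤ 2 / ((d : ℝ) ^ 2 + d) by positivity)
  convert h using 1
  rw [rhoSym]
  ext i j
  simp [mul_add]

theorem posSemidef_rhoAnti (d : ℕ) : (rhoAnti d).PosSemidef := by
  have h0 : (0 : ℝ) ≤ (d : ℝ) ^ 2 - d := by
    have : d ≤ d ^ 2 := Nat.le_self_pow two_ne_zero d
    have : (d : ℝ) ≤ d ^ 2 := by exact_mod_cast this
    linarith
  have h := (posSemidef_half_smul (P := -flipOp d)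
    (by rw [Matrix.conjTranspose_neg, conjTranspose_flipOp])
    (by rw [neg_mul_neg, flipOp_mul_self])).smul
    (show (0 : ℝ) ≤ 2 / ((d : ℝ) ^ 2 - d) by positivity)
  convert h using 1
  rw [rhoAnti, ← sub_eq_add_neg]
  ext i j
  simp

theorem isDensity_tau₂ {d : ℕ} (hd : 2 ≤ d) (m : ℕ) : IsDensity (tau₂ d m) :=
  isDensity_tensorPow ⟨posSemidef_rhoSym d, trace_rhoSym hd⟩

theorem isDensity_tau₁ {d : ℕ} (hd : 2 ≤ d) (m : ℕ) : IsDensity (tau₁ d m) := by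
  constructor
  · have h := (posSemidef_tensorPow (n := m) ((posSemidef_rhoSym d).add (posSemidef_rhoAnti d))).smul
      (show (0 : ℝ) ≤ 1 / 2 ^ m by positivity)
    convert h using 1
    rw [tau₁]
    ext i j
    simp
  · rw [tau₁, Matrix.trace_smul, trace_tensorPow, Matrix.trace_add, trace_rhoSym hd,
      trace_rhoAnti hd, smul_eq_mul, one_add_one_eq_two, one_div, inv_mul_cancel₀ (by positivity)]

/-- The operator `(1 - s) + s F`, the average of `1` and `F` over a biased coin. -/
def mixFlip (d : ℕ) (s : ℝ) : Matrix (Fin d × Fin d) (Fin d × Fin d) ℂ :=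
  ((1 - s : ℝ) : ℂ) • 1 + (s : ℂ) • flipOp d

theorem conjTranspose_mixFlip (d : ℕ) (s : ℝ) : (mixFlip d s).conjTranspose = mixFlip d s := by
  simp only [mixFlip, Matrix.conjTranspose_add, Matrix.conjTranspose_smul, conjTranspose_flipOp,
    Matrix.conjTranspose_one, RCLike.star_def, Complex.conj_ofReal]

theorem trace_tensorPow_mixFlip_mul_tau₂ {d : ℕ} (hd : 2 ≤ d) (m : ℕ) (s : ℝ) :
    (tensorPow m (mixFlip d s) * tau₂ d m).trace = 1 := by
  rw [tau₂, tensorPow_mul, trace_tensorPow, mixFlip, add_mul, Matrix.smul_mul, Matrix.smul_mul,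
    flipOp_mul_rhoSym, one_mul, Matrix.trace_add, Matrix.trace_smul, Matrix.trace_smul,
    trace_rhoSym hd]
  simp

theorem trace_tensorPow_mixFlip_mul_tau₁ {d : ℕ} (hd : 2 ≤ d) (m : ℕ) (s : ℝ) :
    (tensorPow m (mixFlip d s) * tau₁ d m).trace = (1 - s) ^ m := by
  rw [tau₁, Matrix.mul_smul, Matrix.trace_smul, tensorPow_mul, trace_tensorPow, mixFlip, add_mul,
    Matrix.smul_mul, Matrix.smul_mul, mul_add (flipOp d), flipOp_mul_rhoSym, flipOp_mul_rhoAnti,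
    one_mul, Matrix.trace_add, Matrix.trace_smul, Matrix.trace_smul, Matrix.trace_add,
    Matrix.trace_add, Matrix.trace_neg, trace_rhoSym hd, trace_rhoAnti hd, smul_eq_mul,
    one_div, ← inv_pow, ← mul_pow]
  congr 1
  push_cast
  simp only [smul_eq_mul]
  ring

end Hiding

/-! ### The shield operators of the witness -/

section Shield

variable {d m : ℕ}

/-- A vector of a shield, as a vector of `Hil` with trivial register. -/
def toHil (a : Shield d m → ℂ) : Hil (Fin m) (Fin d) Unit := WithLp.toLp 2 fun x => a x.1

/-- A vector of two shields, as a vector of `Hil₂` with trivial registers. -/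
def toHil₂ (v : Shield d m × Shield d m → ℂ) : Hil₂ (Fin m) (Fin d) Unit :=
  WithLp.toLp 2 fun x => v (x.1.1, x.2.1)

theorem toHil₂_prodVec (a b : Shield d m → ℂ) :
    toHil₂ (prodVec a b) = tens (toHil a) (toHil b) := rfl

theorem norm_toHil_sq (a : Shield d m → ℂ) : ‖toHil a‖ ^ 2 = quad 1 a := by
  rw [quad_one, EuclideanSpace.norm_sq_eq, Fintype.sum_prod_type]
  simp [toHil]

theorem inner_toHil₂ (u v : Shield d m × Shield d m → ℂ) :
    inner ℂ (toHil₂ u) (toHil₂ v) = star u ⬝ᵥ v := by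
  simp only [PiLp.inner_apply, RCLike.inner_apply, Fintype.sum_prod_type, toHil₂, dotProduct,
    Pi.star_apply, RCLike.star_def, Finset.univ_unique, Finset.sum_singleton, mul_comm]

theorem norm_toHil₂_sq (v : Shield d m × Shield d m → ℂ) : ‖toHil₂ v‖ ^ 2 = quad 1 v := by
  have h := inner_self_eq_norm_sq_to_K (𝕜 := ℂ) (toHil₂ v)
  rw [inner_toHil₂] at h
  rw [quad, Matrix.one_mulVec, h]
  norm_cast

/-- Expanding the tensor power of `(1 - s) + s F` yields the partial swaps of random sets of
sites. -/
theorem toHil₂_mulVec_tensorPow (s : ℝ) (v : Shield d m × Shield d m → ℂ) :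
    toHil₂ ((tensorPow m (mixFlip d s)).mulVec v) =
      subsetAvg s Finset.univ fun T => swapOp T (toHil₂ v) := by
  have hker : ∀ x y : Shield d m × Shield d m, tensorPow m (mixFlip d s) x y =
      ∑ T ∈ Finset.univ.powerset, ((s ^ T.card * (1 - s) ^ (Finset.univ \ T).card : ℝ) : ℂ) *
        if y = (T.piecewise x.2 x.1, T.piecewise x.1 x.2) then 1 else 0 := by
    intro x y
    have e : ∀ i, mixFlip d s (x.1 i, x.2 i) (y.1 i, y.2 i) =
        (s : ℂ) * (if x.1 i = y.2 i ∧ x.2 i = y.1 i then 1 else 0) +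
          ((1 - s : ℝ) : ℂ) * (if x.1 i = y.1 i ∧ x.2 i = y.2 i then 1 else 0) := fun i => by
      simp only [mixFlip, flipOp, Matrix.add_apply, Matrix.smul_apply, Matrix.one_apply,
        Matrix.of_apply, smul_eq_mul, Prod.mk.injEq]
      ring
    simp only [tensorPow, Matrix.of_apply, e]
    rw [Finset.prod_add]
    refine Finset.sum_congr rfl fun T _ => ?_
    rw [Finset.prod_mul_distrib, Finset.prod_mul_distrib, Finset.prod_const, Finset.prod_const,
      Finset.prod_ite_zero, Finset.prod_ite_zero]
    simp only [Finset.prod_const_one]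
    have hiff : y = (T.piecewise x.2 x.1, T.piecewise x.1 x.2) ↔
        (∀ i ∈ T, x.1 i = y.2 i ∧ x.2 i = y.1 i) ∧
          ∀ i ∈ Finset.univ \ T, x.1 i = y.1 i ∧ x.2 i = y.2 i := by
      constructor
      · rintro rfl
        exact ⟨fun i hi => by simp [hi], fun i hi => by simp [(Finset.mem_sdiff.1 hi).2]⟩
      · rintro ⟨h1, h2⟩
        refine Prod.ext (funext fun i => ?_) (funext fun i => ?_) <;> by_cases hi : i ∈ T
        · simp [hi, (h1 i hi).2]
        · simp [hi, (h2 i (by simp [hi])).1]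
        · simp [hi, (h1 i hi).1]
        · simp [hi, (h2 i (by simp [hi])).2]
    push_cast
    by_cases h1 : ∀ i ∈ T, x.1 i = y.2 i ∧ x.2 i = y.1 i <;>
      by_cases h2 : ∀ i ∈ Finset.univ \ T, x.1 i = y.1 i ∧ x.2 i = y.2 i
    · rw [if_pos h1, if_pos h2, if_pos (hiff.2 ⟨h1, h2⟩)]; ring
    · rw [if_neg h2, if_neg fun h => h2 (hiff.1 h).2]; ring
    · rw [if_neg h1, if_neg fun h => h1 (hiff.1 h).1]; ring
    · rw [if_neg h1, if_neg fun h => h1 (hiff.1 h).1]; ring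
  ext ⟨⟨a, u⟩, ⟨b, w⟩⟩
  simp only [toHil₂, Matrix.mulVec, dotProduct, hker, subsetAvg, Finset.sum_mul, WithLp.ofLp_sum,
    Finset.sum_apply, WithLp.ofLp_smul, Pi.smul_apply]
  rw [Finset.sum_comm]
  refine Finset.sum_congr rfl fun T _ => ?_
  simp only [mul_ite, mul_one, mul_zero, ite_mul, zero_mul, Finset.sum_ite_eq', Finset.mem_univ,
    if_true]
  rw [swapOp_apply, Complex.real_smul]
  rfl

end Shield

section ShieldOps

variable {d m : ℕ}

/-- The projection onto the complement of the fully symmetric subspace of the shield. -/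
def opQ (d m : ℕ) : Matrix (Shield d m × Shield d m) (Shield d m × Shield d m) ℂ :=
  1 - tensorPow m (mixFlip d (1 / 2))

/-- The operator `1 - L⁻¹ ∑_{l < L} ((1 - σ^{l+1}) + σ^{l+1} F)^{⊗ m}`. It annihilates `τ₂` and is
close to `1` on `τ₁`. -/
def opO (d m : ℕ) (σ : ℝ) (L : ℕ) :
    Matrix (Shield d m × Shield d m) (Shield d m × Shield d m) ℂ :=
  1 - (L : ℂ)⁻¹ • ∑ l ∈ Finset.range L, tensorPow m (mixFlip d (σ ^ (l + 1)))

theorem conjTranspose_opQ (d m : ℕ) : (opQ d m).conjTranspose = opQ d m := by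
  rw [opQ, Matrix.conjTranspose_sub, Matrix.conjTranspose_one, conjTranspose_tensorPow,
    conjTranspose_mixFlip]

theorem conjTranspose_opO (d m : ℕ) (σ : ℝ) (L : ℕ) :
    (opO d m σ L).conjTranspose = opO d m σ L := by
  simp [opO, Matrix.conjTranspose_sum, conjTranspose_tensorPow, conjTranspose_mixFlip]

theorem trace_opQ_mul_tau₂ {d : ℕ} (hd : 2 ≤ d) (m : ℕ) : (opQ d m * tau₂ d m).trace = 0 := by
  rw [opQ, sub_mul, one_mul, Matrix.trace_sub, trace_tensorPow_mixFlip_mul_tau₂ hd,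
    (isDensity_tau₂ hd m).2, sub_self]

theorem trace_opO_mul {d m : ℕ} (σ : ℝ) (L : ℕ)
    {τ : Matrix (Shield d m × Shield d m) (Shield d m × Shield d m) ℂ} (hτ : τ.trace = 1) :
    (opO d m σ L * τ).trace =
      1 - (L : ℂ)⁻¹ * ∑ l ∈ Finset.range L, (tensorPow m (mixFlip d (σ ^ (l + 1))) * τ).trace := by
  rw [opO, sub_mul, one_mul, Matrix.trace_sub, hτ, Matrix.smul_mul, Matrix.trace_smul,
    Finset.sum_mul, Matrix.trace_sum, smul_eq_mul]

theorem trace_opO_mul_tau₂ {d : ℕ} (hd : 2 ≤ d) (m : ℕ) (σ : ℝ) {L : ℕ} (hL : 0 < L) :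
    (opO d m σ L * tau₂ d m).trace = 0 := by
  rw [trace_opO_mul σ L (isDensity_tau₂ hd m).2]
  simp only [trace_tensorPow_mixFlip_mul_tau₂ hd, Finset.sum_const, Finset.card_range,
    nsmul_eq_mul, mul_one]
  rw [inv_mul_cancel₀ (by exact_mod_cast hL.ne'), sub_self]

theorem trace_opO_mul_tau₁ {d : ℕ} (hd : 2 ≤ d) (m : ℕ) (σ : ℝ) (L : ℕ) :
    (opO d m σ L * tau₁ d m).trace =
      ((1 - (L : ℝ)⁻¹ * ∑ l ∈ Finset.range L, (1 - σ ^ (l + 1)) ^ m : ℝ) : ℂ) := by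
  rw [trace_opO_mul σ L (isDensity_tau₁ hd m).2]
  simp only [trace_tensorPow_mixFlip_mul_tau₁ hd]
  push_cast
  rfl

theorem dotProduct_tensorPow_mulVec (s : ℝ) (u v : Shield d m × Shield d m → ℂ) :
    star u ⬝ᵥ (tensorPow m (mixFlip d s)).mulVec v =
      subsetAvg s Finset.univ fun T => inner ℂ (toHil₂ u) (swapOp T (toHil₂ v)) := by
  rw [← inner_toHil₂, toHil₂_mulVec_tensorPow, inner_subsetAvg]

theorem dotProduct_opO_mulVec (σ : ℝ) {L : ℕ} (hL : 0 < L) (u v : Shield d m × Shield d m → ℂ) :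
    star u ⬝ᵥ (opO d m σ L).mulVec v =
      (L : ℂ)⁻¹ * ∑ l ∈ Finset.range L, subsetAvg (σ ^ (l + 1)) Finset.univ fun T =>
        inner ℂ (toHil₂ u) (toHil₂ v) - inner ℂ (toHil₂ u) (swapOp T (toHil₂ v)) := by
  have hL' : (L : ℂ) ≠ 0 := by exact_mod_cast hL.ne'
  simp only [subsetAvg_sub, subsetAvg_const, Finset.sum_sub_distrib, Finset.sum_const,
    Finset.card_range, nsmul_eq_mul, ← dotProduct_tensorPow_mulVec, mul_sub]
  rw [inv_mul_cancel_left₀ hL', opO, Matrix.sub_mulVec, Matrix.one_mulVec, Matrix.smul_mulVec,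
    Matrix.sum_mulVec, dotProduct_sub, dotProduct_smul, dotProduct_sum, smul_eq_mul, inner_toHil₂]

/-- `O` is a contraction: a random set of density `s ≤ 1 / 2` is a uniformly random subset of a
random set of density `2 s`, so `O` is an average of the projections `1 - symProj A`. -/
theorem norm_dotProduct_opO_mulVec_le {σ : ℝ} (hσ0 : 0 < σ) (hσ : σ ≤ 1 / 2) {L : ℕ} (hL : 0 < L)
    (u v : Shield d m × Shield d m → ℂ) :
    ‖star u ⬝ᵥ (opO d m σ L).mulVec v‖ ≤ ‖toHil₂ u‖ * ‖toHil₂ v‖ := by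
  rw [dotProduct_opO_mulVec σ hL]
  have hstep : ∀ l, ‖subsetAvg (σ ^ (l + 1)) Finset.univ fun T =>
      inner ℂ (toHil₂ u) (toHil₂ v) - inner ℂ (toHil₂ u) (swapOp T (toHil₂ v))‖ ≤
      ‖toHil₂ u‖ * ‖toHil₂ v‖ := by
    intro l
    have h0 : 0 ≤ 2 * σ ^ (l + 1) := by positivity
    have h1 : 2 * σ ^ (l + 1) ≤ 1 := by
      have : σ ^ l ≤ 1 := pow_le_one₀ hσ0.le (by linarith)
      rw [pow_succ]
      nlinarith
    have e : σ ^ (l + 1) = 2 * σ ^ (l + 1) * (1 / 2) := by ring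
    rw [e, ← subsetAvg_comp]
    refine (norm_subsetAvg_le h0 h1 _ _).trans (subsetAvg_le h0 h1 fun A _ => ?_)
    rw [subsetAvg_sub, subsetAvg_const, ← inner_symProj, ← inner_sub_right]
    refine (norm_inner_le_norm _ _).trans ?_
    gcongr
    exact isProjFamily_symProj.norm_sub_le A _
  rw [norm_mul, norm_inv, Complex.norm_natCast, inv_mul_le_iff₀ (by exact_mod_cast hL)]
  refine (norm_sum_le _ _).trans ((Finset.sum_le_sum fun l _ => hstep l).trans_eq ?_)
  simp

theorem quad_opQ (v : Shield d m × Shield d m → ℂ) :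
    quad (opQ d m) v = ‖toHil₂ v‖ ^ 2 - ‖symProj Finset.univ (toHil₂ v)‖ ^ 2 := by
  rw [opQ, quad_sub, norm_toHil₂_sq, quad, quad, dotProduct_tensorPow_mulVec, ← inner_symProj,
    norm_symProj_sq]

theorem quad_opQ_nonneg (v : Shield d m × Shield d m → ℂ) : 0 ≤ quad (opQ d m) v := by
  rw [quad_opQ]
  have := isProjFamily_symProj.norm_le Finset.univ (toHil₂ v)
  exact sub_nonneg.2 (by gcongr)

theorem quad_opQ_le (v : Shield d m × Shield d m → ℂ) : quad (opQ d m) v ≤ quad 1 v := by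
  rw [quad_opQ, ← norm_toHil₂_sq]
  linarith [sq_nonneg ‖symProj Finset.univ (toHil₂ v)‖]

theorem quad_opQ_prodVec (a b : Shield d m → ℂ) :
    quad (opQ d m) (prodVec a b) = asymWeight (toHil a) (toHil b) := by
  rw [quad_opQ, toHil₂_prodVec, norm_tens, asymWeight]

theorem quad_smul_vec {ι : Type*} [Fintype ι] [DecidableEq ι] (M : Matrix ι ι ℂ) (r : ℝ)
    (v : ι → ℂ) : quad M ((r : ℂ) • v) = r ^ 2 * quad M v := by
  rw [quad, Matrix.mulVec_smul, dotProduct_smul, star_smul, smul_dotProduct, quad, smul_smul,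
    RCLike.star_def, Complex.conj_ofReal, smul_eq_mul, ← Complex.ofReal_mul, Complex.re_ofReal_mul,
    sq]

/-- The property of the averaged operator `O` that makes the witness nonpositive on product
vectors. -/
def CoreBound (d m : ℕ) (σ : ℝ) (L : ℕ) (θ : ℝ) : Prop :=
  ∀ a b c e : Shield d m → ℂ, 2 * ‖star (prodVec a b) ⬝ᵥ (opO d m σ L).mulVec (prodVec c e)‖ ≤
    2.4 * (quad (opQ d m) (prodVec a e) + quad (opQ d m) (prodVec c b)) +
      θ * (quad 1 a * quad 1 e + quad 1 c * quad 1 b)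

theorem toHil_smul (r : ℝ) (a : Shield d m → ℂ) : toHil ((r : ℂ) • a) = (r : ℂ) • toHil a := rfl

theorem exists_eq_smul_unit {a : Shield d m → ℂ} (ha : toHil a ≠ 0) :
    ∃ a' : Shield d m → ℂ, ‖toHil a'‖ = 1 ∧ a = ((‖toHil a‖ : ℝ) : ℂ) • a' := by
  have h : ‖toHil a‖ ≠ 0 := norm_ne_zero_iff.2 ha
  refine ⟨((‖toHil a‖⁻¹ : ℝ) : ℂ) • a, ?_, ?_⟩
  · rw [toHil_smul, norm_smul, Complex.norm_real, Real.norm_of_nonneg (by positivity),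
      inv_mul_cancel₀ h]
  · rw [smul_smul, ← Complex.ofReal_mul, mul_inv_cancel₀ h, Complex.ofReal_one, one_smul]

theorem prodVec_smul (r s : ℝ) (a b : Shield d m → ℂ) :
    prodVec ((r : ℂ) • a) ((s : ℂ) • b) = ((r * s : ℝ) : ℂ) • prodVec a b := by
  funext x
  simp [prodVec]
  ring

/-- The core inequality for vectors of arbitrary length, with the geometric mean replaced by the
arithmetic one. -/
theorem exists_coreBound {θ : ℝ} (hθ : 0 < θ) (hθ1 : θ ≤ 1) :
    ∃ σ : ℝ, 0 < σ ∧ σ ≤ 1 / 2 ∧ ∃ L : ℕ, 0 < L ∧ ∀ d m : ℕ, 2 ≤ d → CoreBound d m σ L θ := by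
  obtain ⟨σ, hσ0, hσ1, L, hL, hcore⟩ := exists_norm_avg_swapForm_le hθ hθ1
  refine ⟨σ, hσ0, hσ1, L, hL, fun d m hd a b c e => ?_⟩
  have : Nonempty (Fin d) := ⟨⟨0, by omega⟩⟩
  have hunit : ∀ a b c e : Shield d m → ℂ, ‖toHil a‖ = 1 → ‖toHil b‖ = 1 → ‖toHil c‖ = 1 →
      ‖toHil e‖ = 1 → ‖star (prodVec a b) ⬝ᵥ (opO d m σ L).mulVec (prodVec c e)‖ ≤
      2.4 * √(quad (opQ d m) (prodVec a e) * quad (opQ d m) (prodVec c b)) + θ := by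
    intro a b c e ha hb hc he
    have h := hcore (Fin m) (Fin d) Unit (toHil a) (toHil e) (toHil c) (toHil b) ha he hc hb
    rw [dotProduct_opO_mulVec σ hL, quad_opQ_prodVec, quad_opQ_prodVec, norm_mul, norm_inv,
      Complex.norm_natCast, inv_mul_le_iff₀ (by exact_mod_cast hL)]
    simp only [toHil₂_prodVec, inner_tens]
    exact h
  have hq : ∀ a b : Shield d m → ℂ, 0 ≤ quad 1 a * quad 1 b := fun a b => by
    rw [← norm_toHil_sq, ← norm_toHil_sq]; positivity
  have hrhs : 0 ≤ 2.4 * (quad (opQ d m) (prodVec a e) + quad (opQ d m) (prodVec c b)) +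
      θ * (quad 1 a * quad 1 e + quad 1 c * quad 1 b) := by
    have h1 := quad_opQ_nonneg (prodVec a e)
    have h2 := quad_opQ_nonneg (prodVec c b)
    have h3 := hq a e
    have h4 := hq c b
    positivity
  by_cases h0 : toHil a = 0 ∨ toHil b = 0 ∨ toHil c = 0 ∨ toHil e = 0
  · have h := norm_dotProduct_opO_mulVec_le hσ0 hσ1 hL (prodVec a b) (prodVec c e)
    rw [toHil₂_prodVec, toHil₂_prodVec, norm_tens, norm_tens] at h
    have hz : ‖toHil a‖ * ‖toHil b‖ * (‖toHil c‖ * ‖toHil e‖) = 0 := by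
      rcases h0 with h | h | h | h <;> simp [h]
    rw [hz] at h
    linarith
  · push Not at h0
    obtain ⟨ha, hb, hc, he⟩ := h0
    obtain ⟨a', ha', hA⟩ := exists_eq_smul_unit ha
    obtain ⟨b', hb', hB⟩ := exists_eq_smul_unit hb
    obtain ⟨c', hc', hC⟩ := exists_eq_smul_unit hc
    obtain ⟨e', he', hE⟩ := exists_eq_smul_unit he
    have h := hunit a' b' c' e' ha' hb' hc' he'
    rw [← norm_toHil_sq, ← norm_toHil_sq, ← norm_toHil_sq, ← norm_toHil_sq]
    set na := ‖toHil a‖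
    set nb := ‖toHil b‖
    set nc := ‖toHil c‖
    set ne := ‖toHil e‖
    have n0a : 0 ≤ na := norm_nonneg _
    have n0b : 0 ≤ nb := norm_nonneg _
    have n0c : 0 ≤ nc := norm_nonneg _
    have n0e : 0 ≤ ne := norm_nonneg _
    rw [hA, hB, hC, hE, prodVec_smul, prodVec_smul, prodVec_smul, prodVec_smul, quad_smul_vec,
      quad_smul_vec, Matrix.mulVec_smul, dotProduct_smul, star_smul, smul_dotProduct, norm_smul,
      norm_smul, norm_star, Complex.norm_real, Complex.norm_real,
      Real.norm_of_nonneg (by positivity), Real.norm_of_nonneg (by positivity)]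
    have q1 := quad_opQ_nonneg (prodVec a' e')
    have q2 := quad_opQ_nonneg (prodVec c' b')
    rw [Real.sqrt_mul q1] at h
    have s1 := Real.sq_sqrt q1
    have s2 := Real.sq_sqrt q2
    set r1 := √(quad (opQ d m) (prodVec a' e'))
    set r2 := √(quad (opQ d m) (prodVec c' b'))
    rw [← s1, ← s2]
    have hp : 0 ≤ na * ne * (nc * nb) := by positivity
    have h5 := mul_le_mul_of_nonneg_left h hp
    have h6 := sq_nonneg (na * ne * r1 - nc * nb * r2)
    have h7 := mul_nonneg hθ.le (sq_nonneg (na * ne - nc * nb))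
    nlinarith

end ShieldOps

/-! ### The entanglement witness -/

section Witness

variable {d m : ℕ}

/-- The operator `|k⟩⟨k'|` on the key systems. -/
abbrev keyUnit (k k' : Fin 2 × Option (Fin 2)) :
    Matrix (Fin 2 × Option (Fin 2)) (Fin 2 × Option (Fin 2)) ℂ := Matrix.single k k' 1

/-- The entanglement witness
`(|00⟩⟨11| + |11⟩⟨00|) ⊗ O - (|01⟩⟨01| + |10⟩⟨10|) ⊗ (2.4 Q + θ)`. -/
def witness (d m : ℕ) (σ : ℝ) (L : ℕ) (θ : ℝ) :
    Matrix (Alice d m × Bob d m) (Alice d m × Bob d m) ℂ :=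
  combine (keyUnit (0, some 0) (1, some 1)) (opO d m σ L) +
    combine (keyUnit (1, some 1) (0, some 0)) (opO d m σ L) -
    combine (keyUnit (0, some 1) (0, some 1)) (((2.4 : ℝ) : ℂ) • opQ d m + (θ : ℂ) • 1) -
    combine (keyUnit (1, some 0) (1, some 0)) (((2.4 : ℝ) : ℂ) • opQ d m + (θ : ℂ) • 1)

theorem isHermitian_witness (σ : ℝ) (L : ℕ) (θ : ℝ) : (witness d m σ L θ).IsHermitian := by
  rw [Matrix.IsHermitian, witness]
  simp only [Matrix.conjTranspose_add, Matrix.conjTranspose_sub, conjTranspose_combine,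
    Matrix.conjTranspose_single, star_one, conjTranspose_opO, Matrix.conjTranspose_smul,
    conjTranspose_opQ, Matrix.conjTranspose_one, RCLike.star_def, Complex.conj_ofReal]
  abel

/-- The component of `w` at the key basis vector `k`. -/
def block (w : Alice d m × Bob d m → ℂ) (k : Fin 2 × Option (Fin 2)) :
    Shield d m × Shield d m → ℂ := fun x => w ((k.1, x.1), (k.2, x.2))

theorem sum_alice_bob {M : Type*} [AddCommMonoid M] (f : Alice d m × Bob d m → M) :
    ∑ x, f x =
      ∑ k : Fin 2 × Option (Fin 2), ∑ x : Shield d m × Shield d m, f ((k.1, x.1), (k.2, x.2)) := by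
  rw [← Fintype.sum_prod_type', ← (Equiv.prodProdProdComm _ _ _ _).sum_comp]
  rfl

theorem quad_combine_keyUnit (k k' : Fin 2 × Option (Fin 2))
    (M : Matrix (Shield d m × Shield d m) (Shield d m × Shield d m) ℂ)
    (w : Alice d m × Bob d m → ℂ) :
    quad (combine (keyUnit k k') M) w = (star (block w k) ⬝ᵥ M.mulVec (block w k')).re := by
  simp only [quad, dotProduct, Matrix.mulVec, sum_alice_bob, combine, Matrix.of_apply,
    Matrix.single_apply, Pi.star_apply, block, Prod.mk.eta]
  rw [Finset.sum_eq_single k]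
  · congr 1
    refine Finset.sum_congr rfl fun x _ => ?_
    rw [Finset.sum_eq_single k']
    · simp
    · intro j _ hj
      simp [hj.symm]
    · simp
  · intro j _ hj
    simp [hj.symm]
  · simp

theorem quad_one_eq_sum_block (w : Alice d m × Bob d m → ℂ) :
    quad 1 w = ∑ k, quad 1 (block w k) := by
  simp only [quad_one, sum_alice_bob]
  rfl

theorem quad_one_vec_nonneg {ι : Type*} [Fintype ι] [DecidableEq ι] (v : ι → ℂ) : 0 ≤ quad 1 v :=
  quad_nonneg Matrix.PosSemidef.one v

theorem quad_witness (σ : ℝ) (L : ℕ) (θ : ℝ) (w : Alice d m × Bob d m → ℂ) :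
    quad (witness d m σ L θ) w =
      (star (block w (0, some 0)) ⬝ᵥ (opO d m σ L).mulVec (block w (1, some 1))).re +
      (star (block w (1, some 1)) ⬝ᵥ (opO d m σ L).mulVec (block w (0, some 0))).re -
      (2.4 * quad (opQ d m) (block w (0, some 1)) + θ * quad 1 (block w (0, some 1))) -
      (2.4 * quad (opQ d m) (block w (1, some 0)) + θ * quad 1 (block w (1, some 0))) := by
  have h : ∀ v, (star v ⬝ᵥ (((2.4 : ℝ) : ℂ) • opQ d m + (θ : ℂ) • 1).mulVec v).re =
      2.4 * quad (opQ d m) v + θ * quad 1 v := fun v => by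
    rw [← quad_smul, ← quad_smul, ← quad_add, quad]
  rw [witness, quad_sub, quad_sub, quad_add, quad_combine_keyUnit, quad_combine_keyUnit,
    quad_combine_keyUnit, quad_combine_keyUnit, h, h]

theorem abs_re_dotProduct_opO_mulVec_le {σ : ℝ} (hσ0 : 0 < σ) (hσ : σ ≤ 1 / 2) {L : ℕ}
    (hL : 0 < L) (u v : Shield d m × Shield d m → ℂ) :
    |(star u ⬝ᵥ (opO d m σ L).mulVec v).re| ≤ (quad 1 u + quad 1 v) / 2 := by
  have h := (Complex.abs_re_le_norm _).trans (norm_dotProduct_opO_mulVec_le hσ0 hσ hL u v)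
  rw [← norm_toHil₂_sq, ← norm_toHil₂_sq]
  nlinarith [sq_nonneg (‖toHil₂ u‖ - ‖toHil₂ v‖)]

theorem quad_one_eq_six (w : Alice d m × Bob d m → ℂ) :
    quad 1 w = quad 1 (block w (0, none)) + quad 1 (block w (0, some 0)) +
      quad 1 (block w (0, some 1)) + (quad 1 (block w (1, none)) +
      quad 1 (block w (1, some 0)) + quad 1 (block w (1, some 1))) := by
  rw [quad_one_eq_sum_block, Fintype.sum_prod_type]
  simp only [Fin.sum_univ_two, Fintype.sum_option, add_assoc]

theorem quad_witness_le {σ : ℝ} (hσ0 : 0 < σ) (hσ : σ ≤ 1 / 2) {L : ℕ} (hL : 0 < L) {θ : ℝ}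
    (hθ : 0 ≤ θ) (w : Alice d m × Bob d m → ℂ) : quad (witness d m σ L θ) w ≤ 1 * quad 1 w := by
  have h1 := (abs_le.1 (abs_re_dotProduct_opO_mulVec_le hσ0 hσ hL (block w (0, some 0))
    (block w (1, some 1)))).2
  have h2 := (abs_le.1 (abs_re_dotProduct_opO_mulVec_le hσ0 hσ hL (block w (1, some 1))
    (block w (0, some 0)))).2
  have q := fun k => quad_opQ_nonneg (block w k)
  have o := fun k => quad_one_vec_nonneg (block w k)
  rw [quad_witness, quad_one_eq_six]
  linarith [q (0, some 1), q (1, some 0), o (0, none), o (1, none), o (0, some 1), o (1, some 0),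
    mul_nonneg hθ (o (0, some 1)), mul_nonneg hθ (o (1, some 0))]

theorem le_quad_witness {σ : ℝ} (hσ0 : 0 < σ) (hσ : σ ≤ 1 / 2) {L : ℕ} (hL : 0 < L) {θ : ℝ}
    (hθ : 0 ≤ θ) (w : Alice d m × Bob d m → ℂ) :
    -(2.4 + θ) * quad 1 w ≤ quad (witness d m σ L θ) w := by
  have h1 := (abs_le.1 (abs_re_dotProduct_opO_mulVec_le hσ0 hσ hL (block w (0, some 0))
    (block w (1, some 1)))).1
  have h2 := (abs_le.1 (abs_re_dotProduct_opO_mulVec_le hσ0 hσ hL (block w (1, some 1))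
    (block w (0, some 0)))).1
  have q := fun k => quad_opQ_le (block w k)
  have o := fun k => quad_one_vec_nonneg (block w k)
  have t := fun k => mul_nonneg hθ (o k)
  rw [quad_witness, quad_one_eq_six]
  linarith [q (0, some 1), q (1, some 0), o (0, none), o (1, none), o (0, some 0), o (1, some 1),
    t (0, none), t (1, none), t (0, some 0), t (1, some 1)]

theorem quad_one_prodVec {A B : Type*} [Fintype A] [Fintype B] [DecidableEq A] [DecidableEq B]
    (a : A → ℂ) (b : B → ℂ) : quad 1 (prodVec a b) = quad 1 a * quad 1 b := by
  simp only [quad_one, prodVec, norm_mul, mul_pow, Fintype.sum_prod_type, Finset.sum_mul_sum]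

/-- On a product vector the two off-diagonal terms are mutually adjoint, and the core bound compares
them with the two negative terms. -/
theorem quad_witness_prodVec_nonpos {σ : ℝ} {L : ℕ} {θ : ℝ} (h : CoreBound d m σ L θ)
    (a : Alice d m → ℂ) (b : Bob d m → ℂ) : quad (witness d m σ L θ) (prodVec a b) ≤ 0 := by
  have hb : ∀ i j, block (prodVec a b) (i, j) = prodVec (fun x => a (i, x)) fun x => b (j, x) :=
    fun i j => rfl
  have h1 := h (fun x => a (0, x)) (fun x => b (some 0, x)) (fun x => a (1, x))
    fun x => b (some 1, x)
  have h2 := h (fun x => a (1, x)) (fun x => b (some 1, x)) (fun x => a (0, x))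
    fun x => b (some 0, x)
  rw [quad_witness, hb, hb, hb, hb, quad_one_prodVec, quad_one_prodVec]
  have r1 := Complex.re_le_norm (star (prodVec (fun x => a (0, x)) fun x => b (some 0, x)) ⬝ᵥ
    (opO d m σ L).mulVec (prodVec (fun x => a (1, x)) fun x => b (some 1, x)))
  have r2 := Complex.re_le_norm (star (prodVec (fun x => a (1, x)) fun x => b (some 1, x)) ⬝ᵥ
    (opO d m σ L).mulVec (prodVec (fun x => a (0, x)) fun x => b (some 0, x)))
  linarith

end Witness

/-! ### The hybrid states -/

section HybridState

variable {d m : ℕ}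

theorem posSemidef_bell (s : ℂ) : (bell s).PosSemidef := Matrix.posSemidef_vecMulVec_self_star _

theorem posSemidef_single {ι : Type*} [Fintype ι] [DecidableEq ι] (i : ι) :
    (Matrix.single i i 1 : Matrix ι ι ℂ).PosSemidef := by
  rw [← Matrix.diagonal_single, Matrix.posSemidef_diagonal_iff]
  intro j
  by_cases h : j = i
  · subst h; simp
  · simp [h]

theorem posSemidef_erased : erased.PosSemidef :=
  (Matrix.PosSemidef.one.smul one_half_pos.le).kronecker (posSemidef_single _)

theorem posSemidef_omegaSep : omegaSep.PosSemidef :=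
  ((posSemidef_single _).add (posSemidef_single _)).smul one_half_pos.le

theorem trace_erased : erased.trace = 1 := by
  rw [erased, Matrix.trace_kronecker, Matrix.trace_smul, Matrix.trace_one]
  simp

theorem trace_omegaSep : omegaSep.trace = 1 := by
  rw [omegaSep, Matrix.trace_smul, Matrix.trace_add]
  simp; norm_num

theorem inv_sqrt_two_mul_self : (1 / ((√2 : ℝ) : ℂ)) * (1 / ((√2 : ℝ) : ℂ)) = 1 / 2 := by
  rw [div_mul_div_comm, ← Complex.ofReal_mul, Real.mul_self_sqrt zero_le_two]
  norm_num

theorem trace_bell {s : ℂ} (hs : s * star s = 1) : (bell s).trace = 1 := by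
  have := inv_sqrt_two_mul_self
  rw [bell, Matrix.trace_vecMulVec]
  simp [dotProduct, Fintype.sum_prod_type, bellVec, Fintype.sum_option]
  simp only [one_div, RCLike.star_def] at this hs
  linear_combination (1 + s * (starRingEnd ℂ) s) * this + 2⁻¹ * hs

theorem isDensity_hybridState (hd : 2 ≤ d) {p α : ℝ} (hp : 0 ≤ p) (hp1 : p ≤ 1) (hα : 0 ≤ α)
    (hα1 : α ≤ 1) (hT : 0 < p + α * (1 - p)) :
    (hybridOp d m p α).trace = ((p + α * (1 - p) : ℝ) : ℂ) ∧
      IsDensity (hybridState d m p α) := by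
  have hP : (hybridOp d m p α).PosSemidef := by
    have c : ∀ r : ℝ, 0 ≤ r → (0 : ℂ) ≤ (r : ℂ) := fun r h => Complex.zero_le_real.2 h
    have k : ∀ s, ((α : ℂ) • bell s + ((1 - α : ℝ) : ℂ) • erased).PosSemidef := fun s =>
      ((posSemidef_bell s).smul (c _ hα)).add (posSemidef_erased.smul (c _ (by linarith)))
    exact ((((posSemidef_combine (k 1) (isDensity_tau₁ hd m).1).add
      (posSemidef_combine (k _) (isDensity_tau₂ hd m).1))).smul (c _ (by positivity))).add
      ((posSemidef_combine posSemidef_omegaSep (isDensity_tau₂ hd m).1).smul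
        (c _ (mul_nonneg hα (by linarith))))
  have hT' : (hybridOp d m p α).trace = ((p + α * (1 - p) : ℝ) : ℂ) := by
    simp only [hybridOp, Matrix.trace_add, Matrix.trace_smul, trace_combine,
      (isDensity_tau₁ hd m).2, (isDensity_tau₂ hd m).2, trace_omegaSep, trace_erased]
    rw [trace_bell (by simp), trace_bell (by simp)]
    simp only [smul_eq_mul]
    push_cast
    ring
  refine ⟨hT', ?_, ?_⟩
  · rw [hybridState, hT', ← Complex.ofReal_inv]
    exact hP.smul (Complex.zero_le_real.2 (by positivity))
  · rw [hybridState, Matrix.trace_smul, smul_eq_mul, inv_mul_cancel₀]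
    rw [hT']
    exact_mod_cast hT.ne'

end HybridState

/-! ### Expectations of the witness -/

section WitnessTraces

variable {d m : ℕ}

theorem keyUnit_mul_erased (k : Fin 2 × Option (Fin 2)) (i j : Fin 2) :
    keyUnit k (i, some j) * erased = 0 := by
  ext x y
  rw [Matrix.mul_apply, Matrix.zero_apply]
  refine Finset.sum_eq_zero fun z _ => ?_
  by_cases h : (i, some j) = z
  · subst h
    simp [erased, Matrix.kroneckerMap_apply]
  · simp [h]

theorem witness_mul_combine_erased (σ : ℝ) (L : ℕ) (θ : ℝ)
    (S : Matrix (Shield d m × Shield d m) (Shield d m × Shield d m) ℂ) :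
    witness d m σ L θ * combine erased S = 0 := by
  have h0 : ∀ S : Matrix (Shield d m × Shield d m) (Shield d m × Shield d m) ℂ,
      combine (0 : Matrix (Fin 2 × Option (Fin 2)) (Fin 2 × Option (Fin 2)) ℂ) S = 0 := fun S => by
    ext x y
    simp [combine]
  simp only [witness, sub_mul, add_mul, combine_mul, keyUnit_mul_erased, h0, add_zero, sub_zero]

/-- The part of the hybrid operator in which the key of Bob is not erased. -/
def hybridKeyOp (d m : ℕ) (p : ℝ) : Matrix (Alice d m × Bob d m) (Alice d m × Bob d m) ℂ :=
  ((p / 2 : ℝ) : ℂ) • (combine (bell 1) (tau₁ d m) + combine (bell (-1)) (tau₂ d m)) +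
    ((1 - p : ℝ) : ℂ) • combine omegaSep (tau₂ d m)

/-- An operator that annihilates the erased part sees the hybrid operator as `α` times its part with
intact key. -/
theorem mul_hybridOp {W : Matrix (Alice d m × Bob d m) (Alice d m × Bob d m) ℂ}
    (hW : ∀ S, W * combine erased S = 0) (p α : ℝ) :
    W * hybridOp d m p α = (α : ℂ) • (W * hybridKeyOp d m p) := by
  simp only [hybridOp, hybridKeyOp, combine_add, combine_smul, mul_add, Matrix.mul_smul, hW,
    smul_zero, add_zero, smul_add, smul_smul]
  congr 1
  · congr 2 <;> ring
  · congr 1; push_cast; ring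

theorem trace_combine_keyUnit_mul (k k' : Fin 2 × Option (Fin 2))
    (M S : Matrix (Shield d m × Shield d m) (Shield d m × Shield d m) ℂ)
    (K : Matrix (Fin 2 × Option (Fin 2)) (Fin 2 × Option (Fin 2)) ℂ) :
    (combine (keyUnit k k') M * combine K S).trace = K k' k * (M * S).trace := by
  rw [combine_mul, trace_combine, Matrix.trace_single_mul]
  simp

theorem trace_witness_mul_combine (σ : ℝ) (L : ℕ) (θ : ℝ)
    (K : Matrix (Fin 2 × Option (Fin 2)) (Fin 2 × Option (Fin 2)) ℂ)
    (S : Matrix (Shield d m × Shield d m) (Shield d m × Shield d m) ℂ) :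
    (witness d m σ L θ * combine K S).trace =
      (K (1, some 1) (0, some 0) + K (0, some 0) (1, some 1)) * (opO d m σ L * S).trace -
      (K (0, some 1) (0, some 1) + K (1, some 0) (1, some 0)) *
        (((2.4 : ℝ) : ℂ) * (opQ d m * S).trace + θ * S.trace) := by
  have h : ((((2.4 : ℝ) : ℂ) • opQ d m + (θ : ℂ) • 1) * S).trace =
      ((2.4 : ℝ) : ℂ) * (opQ d m * S).trace + θ * S.trace := by
    rw [add_mul, Matrix.smul_mul, Matrix.smul_mul, one_mul, Matrix.trace_add, Matrix.trace_smul,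
      Matrix.trace_smul, smul_eq_mul, smul_eq_mul]
  rw [witness, sub_mul, sub_mul, add_mul, Matrix.trace_sub, Matrix.trace_sub, Matrix.trace_add]
  simp only [trace_combine_keyUnit_mul, h]
  ring

theorem trace_witness_mul_hybridKeyOp (hd : 2 ≤ d) (σ : ℝ) {L : ℕ} (hL : 0 < L) (θ p : ℝ) :
    (witness d m σ L θ * hybridKeyOp d m p).trace =
      ((p / 2 * (1 - (L : ℝ)⁻¹ * ∑ l ∈ Finset.range L, (1 - σ ^ (l + 1)) ^ m) - (1 - p) * θ : ℝ) :
        ℂ) := by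
  have h2 := inv_sqrt_two_mul_self
  rw [hybridKeyOp, mul_add, Matrix.mul_smul, Matrix.mul_smul, mul_add, Matrix.trace_add,
    Matrix.trace_smul, Matrix.trace_smul, Matrix.trace_add]
  simp only [trace_witness_mul_combine, trace_opO_mul_tau₁ hd, trace_opO_mul_tau₂ hd m σ hL,
    trace_opQ_mul_tau₂ hd, (isDensity_tau₂ hd m).2]
  simp [bell, bellVec, Matrix.vecMulVec_apply, omegaSep]
  simp only [one_div] at h2
  rw [h2]
  ring

end WitnessTraces

/-! ### Separable positive operators and their tensor powers -/

section SeparableCone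

variable {A B A' B' : Type*} [Fintype A] [Fintype B] [Fintype A'] [Fintype B'] [DecidableEq A]
  [DecidableEq B] [DecidableEq A'] [DecidableEq B']

/-- The cone of the separable positive operators: sums of products of positive operators. -/
def separableCone (A B : Type*) [Fintype A] [Fintype B] :
    AddSubmonoid (Matrix (A × B) (A × B) ℂ) :=
  AddSubmonoid.closure {M | ∃ (P : Matrix A A ℂ) (Q : Matrix B B ℂ),
    P.PosSemidef ∧ Q.PosSemidef ∧ M = P ⊗ₖ Q}

theorem kronecker_mem_separableCone {P : Matrix A A ℂ} {Q : Matrix B B ℂ} (hP : P.PosSemidef)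
    (hQ : Q.PosSemidef) : P ⊗ₖ Q ∈ separableCone A B :=
  AddSubmonoid.subset_closure ⟨P, Q, hP, hQ, rfl⟩

theorem smul_mem_separableCone {r : ℝ} (hr : 0 ≤ r) {M : Matrix (A × B) (A × B) ℂ}
    (hM : M ∈ separableCone A B) : (r : ℂ) • M ∈ separableCone A B := by
  induction hM using AddSubmonoid.closure_induction with
  | mem M h =>
    obtain ⟨P, Q, hP, hQ, rfl⟩ := h
    rw [← Matrix.smul_kronecker]
    exact kronecker_mem_separableCone (hP.smul (Complex.zero_le_real.2 hr)) hQ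
  | zero => rw [smul_zero]; exact zero_mem _
  | add M N _ _ hM hN => rw [smul_add]; exact add_mem hM hN

/-- The quadratic form of `M` is at most that of `1` on product vectors. -/
def ProdBounded (M : Matrix (A × B) (A × B) ℂ) : Prop :=
  ∀ a b, quad M (prodVec a b) ≤ quad 1 a * quad 1 b

theorem quad_conjTranspose_mul_mul {ι : Type*} [Fintype ι] [DecidableEq ι] (M X : Matrix ι ι ℂ)
    (v : ι → ℂ) : quad (M.conjTranspose * X * M) v = quad X (M.mulVec v) := by
  rw [quad, quad, ← Matrix.mulVec_mulVec, ← Matrix.mulVec_mulVec, Matrix.dotProduct_mulVec,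
    ← Matrix.star_mulVec]

theorem combine_kronecker_one_mulVec (C : Matrix A A ℂ) (E : Matrix B B ℂ) (a : A × A' → ℂ)
    (b : B × B' → ℂ) :
    (combine (C ⊗ₖ E) (1 : Matrix (A' × B') (A' × B') ℂ)).mulVec (prodVec a b) =
      prodVec (fun x => ∑ i, C x.1 i * a (i, x.2)) fun y => ∑ j, E y.1 j * b (j, y.2) := by
  funext z
  simp only [Matrix.mulVec, dotProduct, combine, Matrix.of_apply, Matrix.kroneckerMap_apply,
    prodVec, Finset.sum_mul_sum, Fintype.sum_prod_type, Matrix.one_apply, Prod.mk.injEq]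
  refine Finset.sum_congr rfl fun i _ => ?_
  rw [Finset.sum_eq_single z.1.2]
  · refine Finset.sum_congr rfl fun j _ => ?_
    rw [Finset.sum_eq_single z.2.2]
    · simp; ring
    · intro y _ hy; simp [hy.symm]
    · simp
  · intro x _ hx; simp [hx.symm]
  · simp

theorem quad_combine_one_left (H : Matrix (A' × B') (A' × B') ℂ) (a : A × A' → ℂ)
    (b : B × B' → ℂ) :
    quad (combine (1 : Matrix (A × B) (A × B) ℂ) H) (prodVec a b) =
      ∑ i, ∑ j, quad H (prodVec (fun x => a (i, x)) fun y => b (j, y)) := by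
  simp only [quad, Matrix.mulVec, dotProduct, combine, Matrix.of_apply, ← Complex.re_sum]
  congr 1
  rw [← (Equiv.prodProdProdComm A B A' B').sum_comp, Fintype.sum_prod_type, Fintype.sum_prod_type]
  refine Finset.sum_congr rfl fun i _ => Finset.sum_congr rfl fun j _ =>
    Finset.sum_congr rfl fun x _ => ?_
  congr 1
  rw [← (Equiv.prodProdProdComm A B A' B').sum_comp, Fintype.sum_prod_type,
    Finset.sum_eq_single (i, j)]
  · refine Finset.sum_congr rfl fun y _ => ?_
    change (1 : Matrix (A × B) (A × B) ℂ) (i, j) (i, j) * H x y * _ = _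
    rw [Matrix.one_apply_eq, one_mul]
    rfl
  · intro k _ hk
    refine Finset.sum_eq_zero fun y _ => ?_
    change (1 : Matrix (A × B) (A × B) ℂ) (i, j) k * H x y * _ = _
    rw [Matrix.one_apply_ne hk.symm, zero_mul, zero_mul]
  · simp

theorem quad_combine_one_right (G : Matrix (A × B) (A × B) ℂ) (a : A × A' → ℂ)
    (b : B × B' → ℂ) :
    quad (combine G (1 : Matrix (A' × B') (A' × B') ℂ)) (prodVec a b) =
      ∑ x, ∑ y, quad G (prodVec (fun i => a (i, x)) fun j => b (j, y)) := by
  refine Eq.trans ?_ (quad_combine_one_left (A := A') (B := B') G (fun x => a x.swap)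
    fun y => b y.swap)
  simp only [quad, Matrix.mulVec, dotProduct, combine, Matrix.of_apply]
  rw [← ((Equiv.prodComm A' A).prodCongr (Equiv.prodComm B' B)).sum_comp]
  congr 1
  refine Finset.sum_congr rfl fun z _ => ?_
  congr 1
  rw [← ((Equiv.prodComm A' A).prodCongr (Equiv.prodComm B' B)).sum_comp]
  refine Finset.sum_congr rfl fun w _ => ?_
  change G (z.1.2, z.2.2) (w.1.2, w.2.2) * (1 : Matrix (A' × B') (A' × B') ℂ) (z.1.1, z.2.1)
    (w.1.1, w.2.1) * _ = (1 : Matrix (A' × B') (A' × B') ℂ) (z.1.1, z.2.1) (w.1.1, w.2.1) *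
      G (z.1.2, z.2.2) (w.1.2, w.2.2) * _
  rw [mul_comm (G _ _)]
  rfl

/-- Sandwiching with a product operator maps product vectors to product vectors, so a bound for `H` on
product vectors is inherited by `G ⊗ H`. -/
theorem quad_combine_le {G : Matrix (A × B) (A × B) ℂ} (hG : G ∈ separableCone A B)
    {H : Matrix (A' × B') (A' × B') ℂ} (hH : ProdBounded H) (a : A × A' → ℂ) (b : B × B' → ℂ) :
    quad (combine G H) (prodVec a b) ≤
      quad (combine G (1 : Matrix (A' × B') (A' × B') ℂ)) (prodVec a b) := by
  induction hG using AddSubmonoid.closure_induction with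
  | mem G h =>
    obtain ⟨P, Q, hP, hQ, rfl⟩ := h
    obtain ⟨C, rfl⟩ := exists_eq_conjTranspose_mul_self hP
    obtain ⟨E, rfl⟩ := exists_eq_conjTranspose_mul_self hQ
    have e : ∀ H : Matrix (A' × B') (A' × B') ℂ,
        combine ((C.conjTranspose * C) ⊗ₖ (E.conjTranspose * E)) H =
          (combine (C ⊗ₖ E) 1).conjTranspose * combine 1 H * combine (C ⊗ₖ E) 1 := fun H => by
      rw [conjTranspose_combine, combine_mul, combine_mul, Matrix.conjTranspose_kronecker,
        Matrix.conjTranspose_one, mul_one, one_mul, mul_one, Matrix.mul_kronecker_mul]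
    rw [e, e, quad_conjTranspose_mul_mul, quad_conjTranspose_mul_mul, combine_kronecker_one_mulVec,
      quad_combine_one_left, quad_combine_one_left]
    refine Finset.sum_le_sum fun i _ => Finset.sum_le_sum fun j _ => ?_
    rw [quad_one_prodVec]
    exact hH _ _
  | zero =>
    rw [← zero_smul ℂ (0 : Matrix (A × B) (A × B) ℂ), combine_smul, combine_smul,
      ← Complex.ofReal_zero, quad_smul, quad_smul, zero_mul, zero_mul]
  | add M N _ _ hM hN =>
    rw [combine_add, combine_add, quad_add, quad_add]
    exact add_le_add hM hN

theorem ProdBounded.combine {G : Matrix (A × B) (A × B) ℂ} (hG : G ∈ separableCone A B)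
    (hG' : ProdBounded G) {H : Matrix (A' × B') (A' × B') ℂ} (hH : ProdBounded H) :
    ProdBounded (combine G H) := by
  intro a b
  refine (quad_combine_le hG hH a b).trans ?_
  rw [quad_combine_one_right]
  refine (Finset.sum_le_sum fun x _ => Finset.sum_le_sum fun y _ => hG' _ _).trans_eq ?_
  rw [← Finset.sum_mul_sum]
  simp only [quad_one, Fintype.sum_prod_type_right]

theorem quad_submatrix {ι κ : Type*} [Fintype ι] [Fintype κ] [DecidableEq ι] [DecidableEq κ]
    (M : Matrix κ κ ℂ) (e : ι ≃ κ) (v : ι → ℂ) :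
    quad (M.submatrix e e) v = quad M (v ∘ e.symm) := by
  rw [quad, quad, Matrix.submatrix_mulVec_equiv, ← comp_equiv_symm_dotProduct]
  rfl

theorem tensorPow_succ {A B : Type*} (n : ℕ) (G : Matrix (A × B) (A × B) ℂ) :
    tensorPow (n + 1) G = (Hybrid.combine G (tensorPow n G)).submatrix
      ((Fin.consEquiv fun _ => A).symm.prodCongr (Fin.consEquiv fun _ => B).symm)
      ((Fin.consEquiv fun _ => A).symm.prodCongr (Fin.consEquiv fun _ => B).symm) := by
  ext x y
  simp only [tensorPow, Matrix.of_apply, Fin.prod_univ_succ]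
  rfl

/-- A separable operator that is bounded by `1` on product vectors has tensor powers with the same
property, even for product vectors that are entangled between the copies. -/
theorem ProdBounded.tensorPow {G : Matrix (A × B) (A × B) ℂ} (hG : G ∈ separableCone A B)
    (hG' : ProdBounded G) (n : ℕ) : ProdBounded (tensorPow n G) := by
  induction n with
  | zero =>
    intro a b
    have : Hybrid.tensorPow 0 G = 1 := by
      ext x y
      rw [Subsingleton.elim x y, Matrix.one_apply_eq]
      simp [Hybrid.tensorPow]
    rw [this, quad_one_prodVec]
  | succ n ih =>
    intro a b
    rw [tensorPow_succ, quad_submatrix]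
    have h := ProdBounded.combine hG hG' ih (a ∘ Fin.consEquiv fun _ => A)
      (b ∘ Fin.consEquiv fun _ => B)
    rw [quad_one, quad_one] at h ⊢
    rw [← (Fin.consEquiv fun _ => A).sum_comp, ← (Fin.consEquiv fun _ => B).sum_comp]
    exact h

end SeparableCone

/-! ### Small perturbations of the identity are separable -/

section NearOne

variable {A B : Type*} [Fintype A] [Fintype B] [DecidableEq A] [DecidableEq B]

theorem abs_quad_le {ι : Type*} [Fintype ι] [DecidableEq ι] (M : Matrix ι ι ℂ) (v : ι → ℂ) :
    |quad M v| ≤ (∑ i, ∑ j, ‖M i j‖) * quad 1 v := by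
  refine (Complex.abs_re_le_norm _).trans ?_
  simp only [dotProduct, Matrix.mulVec, Finset.mul_sum, Finset.sum_mul]
  refine (norm_sum_le _ _).trans (Finset.sum_le_sum fun i _ => (norm_sum_le _ _).trans
    (Finset.sum_le_sum fun j _ => ?_))
  have h : ∀ i, ‖v i‖ ^ 2 ≤ quad 1 v := fun i => by
    rw [quad_one]
    exact Finset.single_le_sum (f := fun i => ‖v i‖ ^ 2) (fun _ _ => by positivity)
      (Finset.mem_univ i)
  rw [norm_mul, norm_mul, Pi.star_apply, norm_star]
  have h2 : ‖v i‖ * ‖v j‖ ≤ quad 1 v := by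
    nlinarith [h i, h j, sq_nonneg (‖v i‖ - ‖v j‖)]
  calc _ = ‖M i j‖ * (‖v i‖ * ‖v j‖) := by ring
    _ ≤ _ := by gcongr

theorem posSemidef_of_quad_nonneg {ι : Type*} [Fintype ι] [DecidableEq ι] {M : Matrix ι ι ℂ}
    (hM : M.IsHermitian) (h : ∀ v, 0 ≤ quad M v) : M.PosSemidef :=
  .of_dotProduct_mulVec_nonneg hM fun v =>
    Complex.nonneg_iff.2 ⟨h v, (hM.im_star_dotProduct_mulVec_self v).symm⟩

theorem isHermitian_ofReal_smul {ι : Type*} {M : Matrix ι ι ℂ} (hM : M.IsHermitian) (r : ℝ) :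
    ((r : ℂ) • M).IsHermitian := by
  rw [Matrix.IsHermitian, Matrix.conjTranspose_smul, hM.eq, RCLike.star_def, Complex.conj_ofReal]

theorem exists_posSemidef_one_add_smul {ι : Type*} [Fintype ι] [DecidableEq ι] {H : Matrix ι ι ℂ}
    (hH : H.IsHermitian) :
    ∃ t₀ > 0, ∀ t : ℝ, |t| ≤ t₀ → (1 + (t : ℂ) • H).PosSemidef := by
  have hS : 0 ≤ ∑ i, ∑ j, ‖H i j‖ := by positivity
  refine ⟨1 / ((∑ i, ∑ j, ‖H i j‖) + 1), by positivity, fun t ht => ?_⟩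
  refine posSemidef_of_quad_nonneg (Matrix.isHermitian_one.add (isHermitian_ofReal_smul hH t))
    fun v => ?_
  rw [quad_add, quad_smul]
  have h1 := abs_quad_le H v
  have h0 := quad_one_vec_nonneg v
  rw [le_div_iff₀ (by positivity)] at ht
  have h2 : |t * quad H v| ≤ quad 1 v := by
    rw [abs_mul]
    calc _ ≤ |t| * ((∑ i, ∑ j, ‖H i j‖) * quad 1 v) := by gcongr
      _ = |t| * (∑ i, ∑ j, ‖H i j‖) * quad 1 v := by ring
      _ ≤ 1 * quad 1 v := by
          gcongr
          nlinarith [abs_nonneg t]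
      _ = _ := one_mul _
  linarith [(abs_le.1 h2).1]

/-- `1 + s M` is separable for all small `s ≥ 0`. -/
def NearOne (M : Matrix (A × B) (A × B) ℂ) : Prop :=
  ∃ s₀ > 0, ∀ s : ℝ, 0 ≤ s → s ≤ s₀ → 1 + (s : ℂ) • M ∈ separableCone A B

theorem NearOne.zero : NearOne (0 : Matrix (A × B) (A × B) ℂ) := by
  refine ⟨1, one_pos, fun s _ _ => ?_⟩
  rw [smul_zero, add_zero, ← Matrix.one_kronecker_one]
  exact kronecker_mem_separableCone .one .one

theorem NearOne.half_add {M N : Matrix (A × B) (A × B) ℂ} (hM : NearOne M) (hN : NearOne N) :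
    NearOne (((1 / 2 : ℝ) : ℂ) • (M + N)) := by
  obtain ⟨s, hs, h⟩ := hM
  obtain ⟨t, ht, h'⟩ := hN
  refine ⟨min s t, lt_min hs ht, fun r hr0 hr => ?_⟩
  have e : (1 : Matrix (A × B) (A × B) ℂ) + (r : ℂ) • (((1 / 2 : ℝ) : ℂ) • (M + N)) =
      ((1 / 2 : ℝ) : ℂ) • ((1 + (r : ℂ) • M) + (1 + (r : ℂ) • N)) := by
    push_cast
    module
  rw [e]
  exact smul_mem_separableCone (by norm_num) (add_mem (h r hr0 (hr.trans (min_le_left _ _)))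
    (h' r hr0 (hr.trans (min_le_right _ _))))

theorem NearOne.smul {M : Matrix (A × B) (A × B) ℂ} (hM : NearOne M) {r : ℝ} (hr : 0 < r) :
    NearOne ((r : ℂ) • M) := by
  obtain ⟨s, hs, h⟩ := hM
  refine ⟨s / r, by positivity, fun t ht0 ht => ?_⟩
  rw [smul_smul, ← Complex.ofReal_mul]
  exact h _ (by positivity) (by rwa [le_div_iff₀ hr] at ht)

theorem NearOne.add {M N : Matrix (A × B) (A × B) ℂ} (hM : NearOne M) (hN : NearOne N) :
    NearOne (M + N) := by
  have h := (hM.half_add hN).smul two_pos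
  rwa [smul_smul, ← Complex.ofReal_mul, show (2 : ℝ) * (1 / 2) = 1 by norm_num, Complex.ofReal_one,
    one_smul] at h

/-- With `t = √s`, the operator `1 + s H ⊗ H'` is the average of `(1 + t H) ⊗ (1 + t H')` and
`(1 - t H) ⊗ (1 - t H')`. -/
theorem NearOne.kronecker {H : Matrix A A ℂ} {H' : Matrix B B ℂ} (hH : H.IsHermitian)
    (hH' : H'.IsHermitian) : NearOne (H ⊗ₖ H') := by
  obtain ⟨t, ht, h⟩ := exists_posSemidef_one_add_smul hH
  obtain ⟨t', ht', h'⟩ := exists_posSemidef_one_add_smul hH'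
  refine ⟨(min t t') ^ 2, by positivity, fun s hs0 hs => ?_⟩
  have hm : 0 < min t t' := lt_min ht ht'
  have hr : √s ≤ min t t' := Real.sqrt_le_iff.2 ⟨hm.le, hs⟩
  have h1 : |√s| ≤ t ∧ |√s| ≤ t' := by
    rw [abs_of_nonneg (Real.sqrt_nonneg s)]
    exact le_min_iff.1 hr
  have h2 : |-√s| ≤ t ∧ |-√s| ≤ t' := by rwa [abs_neg]
  have e : (1 : Matrix (A × B) (A × B) ℂ) + (s : ℂ) • (H ⊗ₖ H') =
      ((1 / 2 : ℝ) : ℂ) • ((1 + ((√s : ℝ) : ℂ) • H) ⊗ₖ (1 + ((√s : ℝ) : ℂ) • H') +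
        (1 + ((-√s : ℝ) : ℂ) • H) ⊗ₖ (1 + ((-√s : ℝ) : ℂ) • H')) := by
    have hs' : (s : ℂ) = ((√s : ℝ) : ℂ) * ((√s : ℝ) : ℂ) := by
      rw [← Complex.ofReal_mul, Real.mul_self_sqrt hs0]
    rw [hs']
    simp only [Matrix.add_kronecker, Matrix.kronecker_add, Matrix.smul_kronecker,
      Matrix.kronecker_smul, Matrix.one_kronecker_one]
    push_cast
    module
  rw [e]
  exact smul_mem_separableCone (by norm_num) (add_mem
    (kronecker_mem_separableCone (h _ h1.1) (h' _ h1.2))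
    (kronecker_mem_separableCone (h _ h2.1) (h' _ h2.2)))

/-- Twice the operator is `(P + Pᴴ) ⊗ (Q + Qᴴ) - i (P - Pᴴ) ⊗ i (Q - Qᴴ)`, with Hermitian factors. -/
theorem NearOne.kronecker_add_conjTranspose (P : Matrix A A ℂ) (Q : Matrix B B ℂ) :
    NearOne (P ⊗ₖ Q + (P ⊗ₖ Q).conjTranspose) := by
  have h := (NearOne.kronecker (Matrix.isHermitian_add_transpose_self P)
    (Matrix.isHermitian_add_transpose_self Q)).half_add
    (NearOne.kronecker (H := -(Complex.I • (P - P.conjTranspose)))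
      (H' := Complex.I • (Q - Q.conjTranspose))
      (by rw [Matrix.IsHermitian]; simp [← smul_neg])
      (by rw [Matrix.IsHermitian]; simp [← smul_neg]))
  convert h using 1
  ext i j
  simp only [Matrix.conjTranspose_kronecker, Matrix.add_apply, Matrix.sub_apply, Matrix.neg_apply,
    Matrix.smul_apply, Matrix.kroneckerMap_apply, smul_eq_mul]
  push_cast
  linear_combination 1 / 2 * (P i.1 j.1 - P.conjTranspose i.1 j.1) *
    (Q i.2 j.2 - Q.conjTranspose i.2 j.2) * Complex.I_sq

theorem NearOne.sum {κ : Type*} (s : Finset κ) {M : κ → Matrix (A × B) (A × B) ℂ}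
    (h : ∀ i ∈ s, NearOne (M i)) : NearOne (∑ i ∈ s, M i) :=
  Finset.sum_induction _ _ (fun _ _ => NearOne.add) NearOne.zero h

/-- The identity is an interior point of the cone of the separable operators. -/
theorem NearOne.of_isHermitian {W : Matrix (A × B) (A × B) ℂ} (hW : W.IsHermitian) :
    NearOne W := by
  have e : W = ((1 / 2 : ℝ) : ℂ) • ∑ x : A × B, ∑ y : A × B,
      (Matrix.single x.1 y.1 (W x y) ⊗ₖ Matrix.single x.2 y.2 1 +
        (Matrix.single x.1 y.1 (W x y) ⊗ₖ Matrix.single x.2 y.2 (1 : ℂ)).conjTranspose) := by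
    have h1 := Matrix.matrix_eq_sum_single W
    have h2 := congrArg Matrix.conjTranspose h1
    simp only [hW.eq, Matrix.conjTranspose_sum] at h2
    simp only [Finset.sum_add_distrib, Matrix.single_kronecker_single, mul_one, Prod.mk.eta]
    rw [← h1, ← h2]
    push_cast
    module
  rw [e]
  exact NearOne.smul (NearOne.sum _ fun x _ => NearOne.sum _ fun y _ =>
    NearOne.kronecker_add_conjTranspose _ _) (by norm_num)

end NearOne

/-! ### Amplification: many copies of a weakly entangled state -/

section UnitaryDiag

variable {ι : Type*} [Fintype ι] [DecidableEq ι]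

/-- The operator `V diag(f) Vᴴ`. -/
def conjDiag (V : Matrix ι ι ℂ) (f : ι → ℝ) : Matrix ι ι ℂ :=
  V * Matrix.diagonal (fun i => (f i : ℂ)) * V.conjTranspose

theorem quad_conjDiag (V : Matrix ι ι ℂ) (f : ι → ℝ) (v : ι → ℂ) :
    quad (conjDiag V f) v = ∑ i, f i * ‖V.conjTranspose.mulVec v i‖ ^ 2 := by
  have h := quad_conjTranspose_mul_mul V.conjTranspose (Matrix.diagonal fun i => (f i : ℂ)) v
  rw [Matrix.conjTranspose_conjTranspose] at h
  rw [conjDiag, h, quad, dotProduct, Complex.re_sum]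
  refine Finset.sum_congr rfl fun i _ => ?_
  rw [Matrix.mulVec_diagonal, mul_left_comm, Complex.re_ofReal_mul, Pi.star_apply,
    RCLike.star_def, Complex.conj_mul', ← Complex.ofReal_pow, Complex.ofReal_re]

theorem conjDiag_one {V : Matrix ι ι ℂ} (hV : V * V.conjTranspose = 1) :
    conjDiag V (fun _ => 1) = 1 := by
  simp [conjDiag, hV]

theorem conjDiag_mul {V : Matrix ι ι ℂ} (hV : V.conjTranspose * V = 1) (f g : ι → ℝ) :
    conjDiag V f * conjDiag V g = conjDiag V fun i => f i * g i := by
  have e : ∀ D E : Matrix ι ι ℂ, V * D * V.conjTranspose * (V * E * V.conjTranspose) =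
      V * (D * E) * V.conjTranspose := fun D E => by
    calc _ = V * D * (V.conjTranspose * V) * (E * V.conjTranspose) := by noncomm_ring
      _ = _ := by rw [hV]; noncomm_ring
  rw [conjDiag, conjDiag, e, Matrix.diagonal_mul_diagonal, conjDiag]
  simp only [Complex.ofReal_mul]

theorem re_trace_conjDiag_mul (V : Matrix ι ι ℂ) (f : ι → ℝ) (ρ : Matrix ι ι ℂ) :
    (conjDiag V f * ρ).trace.re = ∑ i, f i * ((V.conjTranspose * ρ * V) i i).re := by
  rw [conjDiag, mul_assoc, mul_assoc, Matrix.trace_mul_comm, mul_assoc, Matrix.trace,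
    Complex.re_sum]
  refine Finset.sum_congr rfl fun i _ => ?_
  rw [Matrix.diag_apply, Matrix.diagonal_mul, Complex.re_ofReal_mul]

theorem exists_eq_conjDiag {W : Matrix ι ι ℂ} (hW : W.IsHermitian) :
    ∃ (U : Matrix ι ι ℂ) (w : ι → ℝ), U.conjTranspose * U = 1 ∧ U * U.conjTranspose = 1 ∧
      W = conjDiag U w := by
  refine ⟨hW.eigenvectorUnitary, hW.eigenvalues, Unitary.coe_star_mul_self _,
    Unitary.coe_mul_star_self _, ?_⟩
  conv_lhs => rw [hW.spectral_theorem, Unitary.conjStarAlgAut_apply]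
  rfl

end UnitaryDiag

section Amplification

variable {A B : Type*} [Fintype A] [Fintype B] [DecidableEq A] [DecidableEq B]

theorem tensorPow_conjDiag (n : ℕ) (U : Matrix (A × B) (A × B) ℂ) (g : A × B → ℝ) :
    tensorPow n (conjDiag U g) =
      conjDiag (tensorPow n U) fun x => ∏ i, g (x.1 i, x.2 i) := by
  rw [conjDiag, ← tensorPow_mul, ← tensorPow_mul, ← conjTranspose_tensorPow, conjDiag]
  congr 2
  ext x y
  have h : x = y ↔ ∀ i, (x.1 i, x.2 i) = (y.1 i, y.2 i) := by
    simp [Prod.ext_iff, funext_iff, forall_and]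
  simp only [tensorPow, Matrix.of_apply, Matrix.diagonal_apply, Finset.prod_ite_zero,
    Finset.mem_univ, true_imp_iff, h, Complex.ofReal_prod]

/-- Markov's inequality for the likelihood ratio test of `n` copies: `g` is the spectrum of the
separable operator `conjDiag U g`, and the test accepts if the product of the measured values is at
least `Λ`. -/
theorem one_sub_le_sepDist_tensorPow [Nonempty A] [Nonempty B] {U : Matrix (A × B) (A × B) ℂ}
    (hU : U.conjTranspose * U = 1) (hU' : U * U.conjTranspose = 1) {g : A × B → ℝ}
    (hg : ∀ k, 0 < g k) (hcone : conjDiag U g ∈ separableCone A B)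
    (hprod : ProdBounded (conjDiag U g)) {ρ : Matrix (A × B) (A × B) ℂ} (hρ : IsDensity ρ)
    (n : ℕ) {Λ : ℝ} (hΛ : 0 < Λ) :
    1 - Λ * ((conjDiag U fun k => (g k)⁻¹) * ρ).trace.re ^ n - Λ⁻¹ ≤
      sepDist (tensorPow n ρ) := by
  classical
  set V := tensorPow n U
  have hV : V.conjTranspose * V = 1 := by
    rw [conjTranspose_tensorPow, tensorPow_mul, hU, tensorPow_one]
  have hV' : V * V.conjTranspose = 1 := by
    rw [conjTranspose_tensorPow, tensorPow_mul, hU', tensorPow_one]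
  set γ : (Fin n → A) × (Fin n → B) → ℝ := fun x => ∏ i, g (x.1 i, x.2 i)
  have hγ : ∀ x, 0 < γ x := fun x => Finset.prod_pos fun i _ => hg _
  set χ : (Fin n → A) × (Fin n → B) → ℝ := fun x => if Λ ≤ γ x then 1 else 0
  have hχ0 : ∀ x, 0 ≤ χ x := fun x => by simp only [χ]; split_ifs <;> norm_num
  have hχ1 : ∀ x, χ x ≤ 1 := fun x => by simp only [χ]; split_ifs <;> norm_num
  have hχΛ : ∀ x, χ x ≤ Λ⁻¹ * γ x := fun x => by
    simp only [χ]
    split_ifs with h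
    · rwa [inv_mul_eq_div, one_le_div hΛ]
    · have := hγ x
      positivity
  have hone : ∀ v, quad 1 v = ∑ i, 1 * ‖V.conjTranspose.mulVec v i‖ ^ 2 := fun v => by
    rw [← quad_conjDiag V (fun _ => 1), conjDiag_one hV']
  have hdist := le_sepDist (M := conjDiag V χ) (K := Λ⁻¹) (isDensity_tensorPow (n := n) hρ)
    zero_lt_one (fun v => ?_) (fun v => ?_) (fun a b => ?_)
  · refine le_trans ?_ hdist
    rw [sub_zero, div_one]
    have htr : (conjDiag V χ * tensorPow n ρ).trace.re =
        1 - ∑ x, (1 - χ x) * ((V.conjTranspose * tensorPow n ρ * V) x x).re := by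
      have h1 := re_trace_conjDiag_mul V (fun _ => 1) (tensorPow n ρ)
      rw [conjDiag_one hV', one_mul, (isDensity_tensorPow hρ).2, Complex.one_re] at h1
      simp only [sub_mul, Finset.sum_sub_distrib, ← h1, re_trace_conjDiag_mul]
      ring
    rw [htr, re_trace_conjDiag_mul]
    have hR : (U.conjTranspose * ρ * U).PosSemidef := hρ.1.conjTranspose_mul_mul_same U
    set R := U.conjTranspose * ρ * U
    have hRn : V.conjTranspose * tensorPow n ρ * V = tensorPow n R := by
      rw [conjTranspose_tensorPow, tensorPow_mul, tensorPow_mul]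
    have hR0 : ∀ k, 0 ≤ (R k k).re := fun k => (Complex.nonneg_iff.1 hR.diag_nonneg).1
    have hRe : ∀ k, R k k = ((R k k).re : ℂ) := fun k =>
      Complex.ext rfl (Complex.nonneg_iff.1 hR.diag_nonneg).2.symm
    have hRx : ∀ x, (tensorPow n R x x).re = ∏ i, (R (x.1 i, x.2 i) (x.1 i, x.2 i)).re := by
      intro x
      simp only [tensorPow, Matrix.of_apply]
      rw [Finset.prod_congr rfl fun i _ => hRe (x.1 i, x.2 i), ← Complex.ofReal_prod,
        Complex.ofReal_re]
    have hmain : ∑ x, (1 - χ x) * ((V.conjTranspose * tensorPow n ρ * V) x x).re ≤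
        Λ * (∑ k, (g k)⁻¹ * (R k k).re) ^ n := by
      have hpow : (∑ k, (g k)⁻¹ * (R k k).re) ^ n = ∑ x : (Fin n → A) × (Fin n → B),
          ∏ i, ((g (x.1 i, x.2 i))⁻¹ * (R (x.1 i, x.2 i) (x.1 i, x.2 i)).re) := by
        rw [sum_prod_pair fun _ k => (g k)⁻¹ * (R k k).re, Finset.prod_const, Finset.card_univ,
          Fintype.card_fin]
      rw [hpow, Finset.mul_sum, hRn]
      refine Finset.sum_le_sum fun x _ => ?_
      rw [hRx, Finset.prod_mul_distrib, ← mul_assoc]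
      refine mul_le_mul_of_nonneg_right ?_ (Finset.prod_nonneg fun i _ => hR0 _)
      rw [Finset.prod_inv_distrib]
      simp only [χ]
      split_ifs with h
      · have := hγ x
        rw [sub_self]
        exact mul_nonneg hΛ.le (inv_nonneg.2 this.le)
      · rw [sub_zero, ← div_eq_mul_inv, one_le_div (hγ x)]
        exact (not_le.1 h).le
    linarith
  · rw [zero_mul, quad_conjDiag]
    exact Finset.sum_nonneg fun i _ => mul_nonneg (hχ0 i) (by positivity)
  · rw [quad_conjDiag, one_mul, hone]
    gcongr with i
    exact hχ1 i
  · have h := ProdBounded.tensorPow hcone hprod n a b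
    rw [tensorPow_conjDiag, quad_conjDiag] at h
    rw [quad_conjDiag]
    calc _ ≤ ∑ i, Λ⁻¹ * γ i * ‖V.conjTranspose.mulVec (prodVec a b) i‖ ^ 2 := by
          gcongr with i
          exact hχΛ i
      _ = Λ⁻¹ * ∑ i, γ i * ‖V.conjTranspose.mulVec (prodVec a b) i‖ ^ 2 := by
          rw [Finset.mul_sum]
          exact Finset.sum_congr rfl fun i _ => mul_assoc _ _ _
      _ ≤ _ := by gcongr

theorem inv_one_add_le {x : ℝ} (hx : |x| ≤ 1 / 2) : (1 + x)⁻¹ ≤ 1 - x + 2 * x ^ 2 := by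
  have h := (abs_le.1 hx).1
  rw [inv_le_iff_one_le_mul₀ (by linarith)]
  nlinarith [mul_nonneg (sq_nonneg x) (by linarith : (0 : ℝ) ≤ 1 + 2 * x)]

/-- If a witness `W` detects the entanglement of `ρ n` with strength of order `α n`, and has a
variance of order `α n`, then `n` copies of `ρ n` are asymptotically at maximal distance from the
separable states as soon as `n α n → ∞`. -/
theorem tendsto_sepDist_tensorPow [Nonempty A] [Nonempty B] {W : Matrix (A × B) (A × B) ℂ}
    (hW : W.IsHermitian) (hprod : ∀ a b, quad W (prodVec a b) ≤ 0)
    {ρ : ℕ → Matrix (A × B) (A × B) ℂ} (hρ : ∀ᶠ n in atTop, IsDensity (ρ n)) {α : ℕ → ℝ}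
    (hα : ∀ᶠ n in atTop, 0 ≤ α n) (hlim : Tendsto (fun n : ℕ => n * α n) atTop atTop) {c₁ c₂ : ℝ}
    (hc₁ : 0 < c₁) (hc₂ : 0 < c₂) (h₁ : ∀ᶠ n in atTop, c₁ * α n ≤ (W * ρ n).trace.re)
    (h₂ : ∀ᶠ n in atTop, (W * W * ρ n).trace.re ≤ c₂ * α n) :
    Tendsto (fun n : ℕ => sepDist (tensorPow n (ρ n))) atTop (𝓝 1) := by
  obtain ⟨U, w, hU, hU', hWw⟩ := exists_eq_conjDiag hW
  obtain ⟨s₀, hs₀, hnear⟩ := NearOne.of_isHermitian hW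
  have hS : 0 ≤ ∑ k, |w k| := by positivity
  -- `s` is so small that `1 + s W` is separable and positive, and that the second-order term of its
  -- inverse costs at most half of the first-order gain.
  set s : ℝ := min s₀ (min (1 / (2 * (∑ k, |w k| + 1))) (c₁ / (4 * c₂)))
  have hs : 0 < s := by positivity
  have hs1 : s ≤ s₀ := min_le_left _ _
  have hs2 : s ≤ 1 / (2 * (∑ k, |w k| + 1)) := (min_le_right _ _).trans (min_le_left _ _)
  have hs3 : s ≤ c₁ / (4 * c₂) := (min_le_right _ _).trans (min_le_right _ _)
  rw [le_div_iff₀ (by positivity)] at hs2 hs3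
  have hsw : ∀ k, |s * w k| ≤ 1 / 2 := fun k => by
    have : |w k| ≤ ∑ k, |w k| :=
      Finset.single_le_sum (f := fun k => |w k|) (fun _ _ => abs_nonneg _) (Finset.mem_univ k)
    rw [abs_mul, abs_of_pos hs]
    nlinarith
  have hG : 1 + (s : ℂ) • W = conjDiag U fun k => 1 + s * w k := by
    rw [hWw, ← conjDiag_one hU', conjDiag, conjDiag, conjDiag, ← Matrix.smul_mul, ← Matrix.mul_smul,
      ← Matrix.diagonal_smul, ← add_mul, ← mul_add, Matrix.diagonal_add]
    congr 3
    ext k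
    simp
  have hGb : ProdBounded (1 + (s : ℂ) • W) := fun a b => by
    rw [quad_add, quad_smul, quad_one_prodVec]
    nlinarith [hprod a b]
  have hcone := hnear s hs.le hs1
  rw [hG] at hcone hGb
  have hg : ∀ k, 0 < 1 + s * w k := fun k => by linarith [(abs_le.1 (hsw k)).1]
  have hbound : ∀ᶠ n : ℕ in atTop, 1 - 2 * Real.exp (-(s * c₁ / 4) * (n * α n)) ≤
      sepDist (tensorPow n (ρ n)) := by
    filter_upwards [hρ, hα, h₁, h₂] with n hρ hα h₁ h₂
    have h := one_sub_le_sepDist_tensorPow hU hU' hg hcone hGb hρ n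
      (Real.exp_pos (s * c₁ / 4 * (n * α n)))
    refine le_trans ?_ h
    have hR : (U.conjTranspose * ρ n * U).PosSemidef := hρ.1.conjTranspose_mul_mul_same U
    have hR0 : ∀ k, 0 ≤ ((U.conjTranspose * ρ n * U) k k).re := fun k =>
      (Complex.nonneg_iff.1 hR.diag_nonneg).1
    have htr : ((conjDiag U fun k => (1 + s * w k)⁻¹) * ρ n).trace.re ≤
        1 - s * (W * ρ n).trace.re + 2 * s ^ 2 * (W * W * ρ n).trace.re := by
      have h1 : (1 : ℝ) = ∑ k, 1 * ((U.conjTranspose * ρ n * U) k k).re := by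
        rw [← re_trace_conjDiag_mul U (fun _ => 1), conjDiag_one hU', one_mul, hρ.2,
          Complex.one_re]
      rw [hWw, conjDiag_mul hU, re_trace_conjDiag_mul, re_trace_conjDiag_mul,
        re_trace_conjDiag_mul]
      nth_rewrite 2 [h1]
      rw [Finset.mul_sum, Finset.mul_sum, ← Finset.sum_sub_distrib, ← Finset.sum_add_distrib]
      refine Finset.sum_le_sum fun k _ => ?_
      have := mul_le_mul_of_nonneg_right (inv_one_add_le (hsw k)) (hR0 k)
      linarith
    have htr0 : 0 ≤ ((conjDiag U fun k => (1 + s * w k)⁻¹) * ρ n).trace.re := by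
      rw [re_trace_conjDiag_mul]
      exact Finset.sum_nonneg fun k _ => mul_nonneg (inv_nonneg.2 (hg k).le) (hR0 k)
    have hle : ((conjDiag U fun k => (1 + s * w k)⁻¹) * ρ n).trace.re ≤
        Real.exp (-(s * c₁ / 2 * α n)) := by
      refine htr.trans (le_trans ?_ (Real.add_one_le_exp _))
      have e1 : 2 * s ^ 2 * (W * W * ρ n).trace.re ≤ 2 * s ^ 2 * (c₂ * α n) := by gcongr
      have e2 : s * (c₁ * α n) ≤ s * (W * ρ n).trace.re := by gcongr
      have e3 := mul_le_mul_of_nonneg_right hs3 (mul_nonneg hs.le hα)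
      linarith
    have hpow := pow_le_pow_left₀ htr0 hle n
    rw [← Real.exp_nat_mul] at hpow
    have hmul : Real.exp (s * c₁ / 4 * (n * α n)) *
        ((conjDiag U fun k => (1 + s * w k)⁻¹) * ρ n).trace.re ^ n ≤
        Real.exp (-(s * c₁ / 4) * (n * α n)) := by
      refine (mul_le_mul_of_nonneg_left hpow (Real.exp_pos _).le).trans_eq ?_
      rw [← Real.exp_add]
      congr 1
      ring
    rw [← Real.exp_neg, ← neg_mul]
    linarith
  have hto : Tendsto (fun n : ℕ => 1 - 2 * Real.exp (-(s * c₁ / 4) * (n * α n))) atTop (𝓝 1) := by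
    have h1 := hlim.const_mul_atTop_of_neg (show -(s * c₁ / 4) < 0 by
      have : 0 < s * c₁ := by positivity
      linarith)
    have h2 := ((Real.tendsto_exp_atBot.comp h1).const_mul 2).const_sub 1
    simpa using h2
  refine tendsto_of_tendsto_of_tendsto_of_le_of_le' hto tendsto_const_nhds hbound ?_
  filter_upwards [hρ] with n hρ using sepDist_le_one (isDensity_tensorPow hρ)

end Amplification

/-! ### The distance of the hybrid states to the separable states -/

section Distance

variable {d m : ℕ}

theorem re_trace_mul_hybridState (hd : 2 ≤ d) {p α : ℝ} (hp : 0 < p) (hp1 : p ≤ 1) (hα : 0 ≤ α)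
    (hα1 : α ≤ 1) {W : Matrix (Alice d m × Bob d m) (Alice d m × Bob d m) ℂ}
    (hW : ∀ S, W * combine erased S = 0) :
    (W * hybridState d m p α).trace.re =
      α / (p + α * (1 - p)) * (W * hybridKeyOp d m p).trace.re := by
  rw [hybridState, (isDensity_hybridState hd hp.le hp1 hα hα1
    (add_pos_of_pos_of_nonneg hp (mul_nonneg hα (by linarith)))).1, Matrix.mul_smul,
    mul_hybridOp hW, smul_smul, Matrix.trace_smul, smul_eq_mul, ← Complex.ofReal_inv,
    ← Complex.ofReal_mul, Complex.re_ofReal_mul]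
  ring

/-- For `m` large, uniformly in `d`, there is a witness that detects the key part of the hybrid
operator. The spectrum of this witness has length at most `3.401`, which together with the value
`0.122` yields the constant `1 / 28`. -/
theorem exists_witness : ∃ (σ θ : ℝ) (L m₀ : ℕ), ∀ m, m₀ ≤ m → ∀ d, 2 ≤ d →
    (∀ v, -2.401 * quad 1 v ≤ quad (witness d m σ L θ) v) ∧
    (∀ v, quad (witness d m σ L θ) v ≤ 1 * quad 1 v) ∧
    (∀ a b, quad (witness d m σ L θ) (prodVec a b) ≤ 0) ∧
    ∀ p ∈ Set.Ioo (1 / 4 : ℝ) (1 / 3),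
      0.122 ≤ (witness d m σ L θ * hybridKeyOp d m p).trace.re := by
  obtain ⟨σ, hσ0, hσ1, L, hL, hcore⟩ := exists_coreBound (θ := 0.001) (by norm_num) (by norm_num)
  have hμ : Tendsto (fun m : ℕ => (L : ℝ)⁻¹ * ∑ l ∈ Finset.range L, (1 - σ ^ (l + 1)) ^ m) atTop
      (𝓝 0) := by
    have h := (tendsto_finsetSum (Finset.range L) fun l _ =>
      tendsto_pow_atTop_nhds_zero_of_lt_one (r := 1 - σ ^ (l + 1))
        (sub_nonneg.2 (pow_le_one₀ hσ0.le (by linarith))) (by linarith [pow_pos hσ0 (l + 1)]))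
    simpa using h.const_mul ((L : ℝ)⁻¹)
  obtain ⟨m₀, hm₀⟩ := eventually_atTop.1 (hμ.eventually_lt_const (u := 0.01) (by norm_num))
  refine ⟨σ, 0.001, L, m₀, fun m hm d hd => ⟨fun v => ?_, fun v => ?_, ?_, fun p hp => ?_⟩⟩
  · refine le_trans (le_of_eq ?_) (le_quad_witness hσ0 hσ1 hL (by norm_num) v)
    norm_num
  · exact quad_witness_le hσ0 hσ1 hL (by norm_num) v
  · exact quad_witness_prodVec_nonpos (hcore d m hd)
  · rw [trace_witness_mul_hybridKeyOp hd σ hL, Complex.ofReal_re]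
    obtain ⟨hp1, hp2⟩ := hp
    nlinarith [hm₀ m hm]

theorem tendsto_mul_one_div_floor {f : ℕ → ℝ} (hf : f =o[atTop] fun n : ℕ => (n : ℝ))
    (hf1 : ∀ᶠ n in atTop, 1 ≤ f n) :
    Tendsto (fun n : ℕ => (n : ℝ) * (1 / (⌊f n⌋₊ : ℝ))) atTop atTop := by
  refine tendsto_atTop.2 fun C => ?_
  filter_upwards [hf1, hf.def (c := 1 / (|C| + 1)) (by positivity)] with n h1 h2
  have h3 : (1 : ℝ) ≤ ⌊f n⌋₊ := by exact_mod_cast (Nat.one_le_floor_iff _).2 h1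
  have h4 := Nat.floor_le (zero_le_one.trans h1)
  rw [Real.norm_of_nonneg (by linarith), Real.norm_natCast, div_mul_eq_mul_div, one_mul,
    le_div_iff₀ (by positivity)] at h2
  rw [mul_one_div, le_div_iff₀ (by linarith)]
  nlinarith [le_abs_self C, abs_nonneg C]

end Distance

end Hybrid

end

theorem lemma3 :
    ∃ m₀ : ℕ, ∀ m : ℕ, m₀ ≤ m → ∀ d : ℕ, 2 ≤ d →
      ∀ p : ℝ, p ∈ Set.Ioo (1 / 4 : ℝ) (1 / 3) →
      ∀ f : ℕ → ℝ, f =o[atTop] (fun n : ℕ => (n : ℝ)) → (∀ᶠ n in atTop, 1 ≤ f n) →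
        (∀ ps : ℝ, ps ∈ Set.Ioo (1 / 32 : ℝ) (1 / 28) → ∀ n : ℕ, 1 ≤ f n →
          ps / (⌊f n⌋₊ : ℝ) ≤ Hybrid.sepDist (Hybrid.hybridState d m p (1 / (⌊f n⌋₊ : ℝ)))) ∧
        Tendsto (fun n : ℕ => Hybrid.sepDist
          (Hybrid.tensorPow n (Hybrid.hybridState d m p (1 / (⌊f n⌋₊ : ℝ))))) atTop (𝓝 1) := by
  obtain ⟨σ, θ, L, m₀, hm₀⟩ := Hybrid.exists_witness
  refine ⟨m₀, fun m hm d hd p hp f hf hf1 => ?_⟩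
  obtain ⟨hlo, hhi, hprod, htr⟩ := hm₀ m hm d hd
  replace htr := htr p hp
  obtain ⟨hp1, hp2⟩ := hp
  have : Nonempty (Fin d) := ⟨⟨0, by omega⟩⟩
  set W := Hybrid.witness d m σ L θ
  have hW : ∀ S, W * Hybrid.combine Hybrid.erased S = 0 :=
    Hybrid.witness_mul_combine_erased σ L θ
  have hW2 : ∀ S, W * W * Hybrid.combine Hybrid.erased S = 0 := fun S => by
    rw [mul_assoc, hW, mul_zero]
  have hα : ∀ n, 1 ≤ f n → 0 < 1 / (⌊f n⌋₊ : ℝ) ∧ 1 / (⌊f n⌋₊ : ℝ) ≤ 1 := fun n hn => by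
    have h : (1 : ℝ) ≤ ⌊f n⌋₊ := by exact_mod_cast (Nat.one_le_floor_iff _).2 hn
    exact ⟨by positivity, by rwa [div_le_one (by linarith)]⟩
  have hT : ∀ α : ℝ, 0 ≤ α → α ≤ 1 → 1 / 4 < p + α * (1 - p) ∧ p + α * (1 - p) ≤ 1 :=
    fun α h0 h1 => ⟨by nlinarith, by nlinarith⟩
  have hdens : ∀ α : ℝ, 0 ≤ α → α ≤ 1 → Hybrid.IsDensity (Hybrid.hybridState d m p α) :=
    fun α h0 h1 => (Hybrid.isDensity_hybridState hd (by linarith) (by linarith) h0 h1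
      (by linarith [(hT α h0 h1).1])).2
  have hval : ∀ α : ℝ, 0 ≤ α → α ≤ 1 →
      0.122 * α ≤ (W * Hybrid.hybridState d m p α).trace.re := fun α h0 h1 => by
    obtain ⟨hT0, hT1⟩ := hT α h0 h1
    rw [Hybrid.re_trace_mul_hybridState hd (by linarith) (by linarith) h0 h1 hW, mul_comm]
    have h2 : α ≤ α / (p + α * (1 - p)) := by
      rw [le_div_iff₀ (by linarith)]
      nlinarith
    gcongr
  refine ⟨fun ps hps n hn => ?_, ?_⟩
  · obtain ⟨h0, h1⟩ := hα n hn
    have h := Hybrid.le_sepDist (K := 0) (hdens _ h0.le h1) (by norm_num) hlo hhi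
      fun a b => (hprod a b).trans_eq (zero_mul _).symm
    refine le_trans ?_ h
    have h2 := hval _ h0.le h1
    rw [le_div_iff₀ (by norm_num), ← mul_one_div]
    nlinarith [hps.2]
  · refine Hybrid.tendsto_sepDist_tensorPow (Hybrid.isHermitian_witness σ L θ) hprod ?_ ?_
      (Hybrid.tendsto_mul_one_div_floor hf hf1) (c₁ := 0.122)
      (c₂ := 4 * (|(W * W * Hybrid.hybridKeyOp d m p).trace.re| + 1)) (by norm_num)
      (by positivity) ?_ ?_
    · filter_upwards [hf1] with n hn using hdens _ (hα n hn).1.le (hα n hn).2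
    · filter_upwards [hf1] with n hn using (hα n hn).1.le
    · filter_upwards [hf1] with n hn using hval _ (hα n hn).1.le (hα n hn).2
    · filter_upwards [hf1] with n hn
      obtain ⟨h0, h1⟩ := hα n hn
      obtain ⟨hT0, hT1⟩ := hT _ h0.le h1
      set α := 1 / (⌊f n⌋₊ : ℝ)
      rw [Hybrid.re_trace_mul_hybridState hd (by linarith) (by linarith) h0.le h1 hW2]
      have h2 : α / (p + α * (1 - p)) ≤ 4 * α := by
        rw [div_le_iff₀ (by linarith)]
        nlinarith
      calc _ ≤ α / (p + α * (1 - p)) * (|(W * W * Hybrid.hybridKeyOp d m p).trace.re| + 1) := by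
            gcongr
            linarith [le_abs_self (W * W * Hybrid.hybridKeyOp d m p).trace.re]
        _ ≤ 4 * α * (|(W * W * Hybrid.hybridKeyOp d m p).trace.re| + 1) := by gcongr
        _ = _ := by ring
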